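/- Consider general relativity ($8\pi G=c=1$) with a canonical, minimally coupled scalar field $\psi$ of potential $V(\psi)=V_0e^{-\lambda\psi}$, $V_0\ge 0$ (unless said otherwise), and static spherically symmetric solutions $$ds^2=-A\,dt^2+d\ell^2+r^2d\Omega^2,\qquad A=N^2,\ N>0,\ r>0,\qquad B=(dr/d\ell)^2.$$ Put $K=1/r^2$, let $\hat f=df/d\ell$, $f'=\hat f/\sqrt K$, and $$x_2=\hat r,\quad x_3=r\hat N/N,\quad y_1=r\hat\psi/\sqrt2,\quad (X_2,X_3,Y_1)=\frac{(x_2,x_3,y_1)}{\sqrt{1+x_2^2+x_3^2+y_1^2}},\quad \tilde f=\sqrt{1-X_2^2-X_3^2-Y_1^2}\,f' .$$ With $\mathcal I=2X_2^2+2X_2X_3+X_3^2-1$ the field equations give the system $$\tilde X_2=-\tfrac{\lambda}{\sqrt2}X_2Y_1\mathcal I+Y_1^2[X_2(2X_2+X_3)-1]-X_2X_3[X_2(3X_2+X_3)-2],$$ $$\tilde X_3=-\tfrac{\lambda}{\sqrt2}X_3Y_1\mathcal I-3X_2^2X_3^2+2X_2^2-X_2X_3^3+X_3Y_1^2(2X_2+X_3)+X_2X_3+X_3^2-1,$$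 $$\tilde Y_1=\tfrac{\lambda}{\sqrt2}(1-Y_1^2)\mathcal I-X_2Y_1(3X_2X_3+X_3^2+1)+Y_1^3(2X_2+X_3)$$ on the compact phase space $\{\mathcal I\le 0,\ X_2^2+X_3^2+Y_1^2\le1\}$. An orbit is finite if $X_2^2+X_3^2+Y_1^2<1$ along it. Every solution parametrized as above (parameter $\tau\in\mathbb R$, $d/d\tau=\tilde{\ }$) gives a finite orbit, with $\mathcal I=0$ if $V_0=0$ and $\mathcal I<0$ if $V_0>0$; conversely each finite orbit with $\mathcal I=0$ (resp. $\mathcal I<0$) comes from a solution with $V_0=0$ (resp. with any prescribed $V_0>0$). Let $M$ and $\bar M$ be the parts $X_2+X_3=\sqrt{1-X_2^2}$ and $X_2+X_3=-\sqrt{1-X_2^2}$ of the closed unit ball, and $\mathcal C\subset M$, $\bar{\mathcal C}\subset\bar M$ the curves where in addition $X_2^2+X_3^2+Y_1^2=1$. Let $P_M=(\frac1{\sqrt2},0,0)$ (Minkowski), $P_H=(0,1,0)$ (horizon), $P_\lambda=\frac{1}{\sqrt{\lambda^2+4}}(\sqrt2,\sqrt2,\lambda)$, and $\bar P_M,\bar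 P_H,\bar P_\lambda$ their opposites. A naked singularity at an end of the orbit means: $r\to0$, $B\to\infty$, the Kretschmann scalar tends to $\infty$, and the end lies at finite proper distance and finite light-travel time $\int d\ell/N$. 1. $\{\mathcal I=0\}$ is an invariant surface of the system; within the closed ball it is the disjoint union of $M$ and $\bar M$, each of which is invariant. The map $\gamma(\tau)\mapsto-\gamma(-\tau)$ sends orbits to orbits, and $p\mapsto -p$ interchanges $M$ and $\bar M$. 2. On $M$ write $X_2=\cos\theta$, $X_3=\sin\theta-\cos\theta$, $\theta\in[\arccos\frac2{\sqrt5},\frac\pi2]$. Then $$\tilde\theta=-\tfrac{\cos\theta-\sin\theta}2\,[1+2Y_1^2+\cos2\theta-2\sin2\theta],\qquad \tilde Y_1=Y_1\tfrac{\cos\theta+\sin\theta}2\,[1+2Y_1^2+\cos2\theta-2\sin2\theta],$$ and along each orbit on $M$ either $Y_1=c_1(\cos\theta-\sin\theta)$ for a constant $c_1$, or $\theta\equiv\pi/4$. 3. Up to a shift of $\tau$ there is exactly one orbit in the phase space from $P_H$ to $P_M$; it is finite and lies on $M$. It and its reverse (from $\bar P_M$ to $\bar P_H$) are the exterior Schwarzschild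 solution of positive mass, with $V_0=0$ and constant $\psi$. 4. Every finite orbit on $M$ other than $P_M$ tends to $P_M$ as $\tau\to\infty$ and to a point $p\in\mathcal C$ as $\tau\to-\infty$; if $p\ne P_H$ the solution has a naked singularity there. The reversed statement holds on $\bar M$. 5. Let $\lambda\ne0$. Every finite orbit with $\mathcal I<0$ tends, as $\tau\to-\infty$, to a point $p$ that is $P_M$, or in $\mathcal C$, or $P_\lambda$ with $\lambda^2>6$; and, as $\tau\to+\infty$, to a point $q$ that is $\bar P_M$, or in $\bar{\mathcal C}$, or $\bar P_\lambda$ with $\lambda^2>6$. One of the following holds. (a) $X_2$ vanishes at exactly one $\tau_0$, is positive before and negative after it; $r$ has its strict global maximum at $\tau_0$, where $x_2=0$, $x_2'=-y_1^2\le 0$, and the flare-out condition ($d^2r/dz^2>0$ for the embedding $dz^2=(1-B)\,d\ell^2$) fails. (b) $X_2>0$ throughout, $q=\bar P_H$, and $r$ increases to a finite positive limit while $N\to0$, as $\tau\to+\infty$ (the maximum radius is reached only at the horizon). (c) $X_2<0$ throughout, $p=P_H$, and $r$ is decreasing in $\tau$, with a finite positive limit while $N\to0$, as $\tau\to-\infty$.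 The solution has a naked singularity at $p$ unless $p\in\{P_M,P_H\}$, and at $q$ unless $q\in\{\bar P_M,\bar P_H\}$; and it is impossible that both $p\in\{P_M,P_H\}$ and $q\in\{\bar P_M,\bar P_H\}$. 6. Hence, for $\lambda\neq0$ and $V_0\ge0$, every such solution whose orbit is not one of the fixed points $P_M,\bar P_M$ is exterior Schwarzschild or has a naked singularity at one of its ends. 7. Let $\lambda\ne0$. The points $\pm(\frac1{\sqrt2},\frac1{\sqrt2},0)$, which represent anti-de Sitter space, are not critical points, and no integral curve of the system in the closed ball (with any sign of $\mathcal I$) tends to one of them as $\tau\to\pm\infty$. For no $V_0\in\mathbb R$ of either sign is there a static spherically symmetric solution that is asymptotically anti-de Sitter, that is, with $r\to\infty$, $B/r^2\to1/L^2$ for some $L>0$, and $d\ln A/d\ln r\to2$ at an end. -/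

import Mathlib

open Filter Topology

noncomputable section

namespace ExpPotential

/-! ### The compactified dynamical system -/

/-- Points `(X₂, X₃, Y₁)` of the compactified (Poincare) phase space. -/
abbrev Pt : Type := ℝ × ℝ × ℝ

/-- `X₂² + X₃² + Y₁²`; the value `1` is the boundary at infinity. -/
def normSq (p : Pt) : ℝ := p.1 ^ 2 + p.2.1 ^ 2 + p.2.2 ^ 2

/-- `I = 2 X₂² + 2 X₂ X₃ + X₃² - 1`. -/
def surf (p : Pt) : ℝ := 2 * p.1 ^ 2 + 2 * p.1 * p.2.1 + p.2.1 ^ 2 - 1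

/-- The vector field of the compactified system for `V = V₀ exp (-lam ψ)` and a canonical field. -/
def field (lam : ℝ) (p : Pt) : Pt :=
  let a := p.1
  let b := p.2.1
  let y := p.2.2
  ( -(lam / √2) * a * y * (2 * a ^ 2 + 2 * a * b + b ^ 2 - 1)
      + y ^ 2 * (a * (2 * a + b) - 1) - a * b * (a * (3 * a + b) - 2),
    -(lam / √2) * b * y * (2 * a ^ 2 + 2 * a * b + b ^ 2 - 1)
      - 3 * a ^ 2 * b ^ 2 + 2 * a ^ 2 - a * b ^ 3 + b * y ^ 2 * (2 * a + b)
      + a * b + b ^ 2 - 1,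
    lam / √2 * (1 - y ^ 2) * (2 * a ^ 2 + 2 * a * b + b ^ 2 - 1)
      - a * y * (3 * a * b + b ^ 2 + 1) + y ^ 3 * (2 * a + b) )

/-- Phase space of the non-negative potentials. -/
def phaseSpace : Set Pt := {p | surf p ≤ 0 ∧ normSq p ≤ 1}

/-- The surface `M`. -/
def surfM : Set Pt := {p | p.1 + p.2.1 = √(1 - p.1 ^ 2) ∧ p.1 ^ 2 ≤ 1 ∧ normSq p ≤ 1}

/-- The surface `M̄`. -/
def surfMbar : Set Pt := {p | p.1 + p.2.1 = -√(1 - p.1 ^ 2) ∧ p.1 ^ 2 ≤ 1 ∧ normSq p ≤ 1}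

/-- The critical curve, the part at infinity of `M`. -/
def critCurve : Set Pt := {p | p ∈ surfM ∧ normSq p = 1}

/-- The critical curve at infinity of `M̄`. -/
def critCurveBar : Set Pt := {p | p ∈ surfMbar ∧ normSq p = 1}

/-- Minkowski point `(x₂, x₃, y₁) = (1, 0, 0)`. -/
def PM : Pt := (1 / √2, 0, 0)

/-- Minkowski point `(x₂, x₃, y₁) = (-1, 0, 0)`. -/
def PMbar : Pt := (-(1 / √2), 0, 0)

/-- The horizon point. -/
def PH : Pt := (0, 1, 0)

/-- The dual horizon point. -/
def PHbar : Pt := (0, -1, 0)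

/-- The point `P_lam`. -/
def Plam (lam : ℝ) : Pt := (√2 / √(lam ^ 2 + 4), √2 / √(lam ^ 2 + 4), lam / √(lam ^ 2 + 4))

/-- The point `P̄_lam`. -/
def PlamBar (lam : ℝ) : Pt :=
  (-(√2 / √(lam ^ 2 + 4)), -(√2 / √(lam ^ 2 + 4)), -(lam / √(lam ^ 2 + 4)))

/-- The anti-de Sitter point. -/
def PAdS : Pt := (1 / √2, 1 / √2, 0)

/-- The dual anti-de Sitter point. -/
def PAdSbar : Pt := (-(1 / √2), -(1 / √2), 0)

/-- Integral curves on the whole time line. -/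
def IsFlowLine (lam : ℝ) (γ : ℝ → Pt) : Prop := ∀ τ, HasDerivAt γ (field lam (γ τ)) τ

/-- Parametrized orbits in the phase space of the non-negative potentials (they are complete, the
phase space being compact). -/
def IsOrbit (lam : ℝ) (γ : ℝ → Pt) : Prop := IsFlowLine lam γ ∧ ∀ τ, γ τ ∈ phaseSpace

/-- The curve does not lie in the boundary at infinity. -/
def IsFinite (γ : ℝ → Pt) : Prop := ∀ τ, normSq (γ τ) < 1

/-! ### Static spherically symmetric spacetimes -/

/-- The potential `V₀ exp (-lam ψ)`. -/
def expPotential (V0 lam : ℝ) (ψ : ℝ) : ℝ := V0 * Real.exp (-lam * ψ)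

/-- The metric `-lapse² dt² + density² dτ² + radius² dΩ²` together with a scalar field. -/
structure Config where
  radius : ℝ → ℝ
  lapse : ℝ → ℝ
  density : ℝ → ℝ
  scalar : ℝ → ℝ

namespace Config

variable (S : Config)

/-- Derivative along the unit radial vector. -/
def hat (f : ℝ → ℝ) (τ : ℝ) : ℝ := deriv f τ / S.density τ

/-- Sheet expansion `φ`. -/
def sheetExp (τ : ℝ) : ℝ := 2 * S.hat S.radius τ / S.radius τ

/-- Acceleration of the static observers. -/
def accel (τ : ℝ) : ℝ := S.hat S.lapse τ / S.lapse τ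

/-- Gaussian curvature of the sheets. -/
def gaussK (τ : ℝ) : ℝ := 1 / S.radius τ ^ 2

/-- `Ψ`, the derivative of the scalar field along the unit radial vector. -/
def scalarHat (τ : ℝ) : ℝ := S.hat S.scalar τ

/-- The electric Weyl scalar, as given by the first constraint. -/
def weyl (V : ℝ → ℝ) (τ : ℝ) : ℝ :=
  -S.accel τ * S.sheetExp τ - 2 * V (S.scalar τ) / 3 + S.scalarHat τ ^ 2 / 3

/-- The field equations of general relativity with a canonical minimally coupled scalar field of
potential `V`, in `1+1+2` form (`8πG = c = 1`). The propagation equation of the Gaussian curvature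
holds by the definition of `gaussK`; that of the Weyl scalar follows from the other ones. -/
structure IsSolution (V : ℝ → ℝ) : Prop where
  radius_smooth : ContDiff ℝ 2 S.radius
  lapse_smooth : ContDiff ℝ 2 S.lapse
  scalar_smooth : ContDiff ℝ 2 S.scalar
  density_smooth : ContDiff ℝ 1 S.density
  radius_pos : ∀ τ, 0 < S.radius τ
  lapse_pos : ∀ τ, 0 < S.lapse τ
  density_pos : ∀ τ, 0 < S.density τ
  sheetExp_eq : ∀ τ, S.hat S.sheetExp τ =
    -(1 / 2) * S.sheetExp τ ^ 2 - 2 / 3 * (S.scalarHat τ ^ 2 + V (S.scalar τ)) - S.weyl V τ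
  accel_eq : ∀ τ, S.hat S.accel τ =
    -(S.accel τ + S.sheetExp τ) * S.accel τ - V (S.scalar τ)
  scalar_eq : ∀ τ, S.hat S.scalarHat τ =
    -(S.accel τ + S.sheetExp τ) * S.scalarHat τ + deriv V (S.scalar τ)
  gauss_eq : ∀ τ, S.gaussK τ =
    S.accel τ * S.sheetExp τ + V (S.scalar τ) - S.scalarHat τ ^ 2 / 2 + S.sheetExp τ ^ 2 / 4

/-- `x₂ = φ / (2 √K)`. -/
def x2 (τ : ℝ) : ℝ := S.sheetExp τ / (2 * √(S.gaussK τ))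

/-- `x₃ = 𝒜 / √K`. -/
def x3 (τ : ℝ) : ℝ := S.accel τ / √(S.gaussK τ)

/-- `y₁ = Ψ / √(2 K)`. -/
def y1 (τ : ℝ) : ℝ := S.scalarHat τ / √(2 * S.gaussK τ)

/-- The normalized radial derivative `f̂ / √K`. -/
def normDeriv (f : ℝ → ℝ) (τ : ℝ) : ℝ := S.hat f τ / √(S.gaussK τ)

/-- The compactified variables `(X₂, X₃, Y₁)`. -/
def poincare (τ : ℝ) : Pt :=
  let D := √(1 + S.x2 τ ^ 2 + S.x3 τ ^ 2 + S.y1 τ ^ 2)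
  (S.x2 τ / D, S.x3 τ / D, S.y1 τ / D)

/-- The radial parameter is the one of the compactified system: the derivative with respect to it is
`√(1 - X₂² - X₃² - Y₁²)` times the normalized radial derivative. -/
def HasPoincareParam : Prop :=
  ∀ τ, S.density τ = √(1 - normSq (S.poincare τ)) / √(S.gaussK τ)

/-- `S` is a solution for the potential `V₀ exp (-lam ψ)` whose orbit is `γ`. -/
def Realizes (V0 lam : ℝ) (γ : ℝ → Pt) : Prop :=
  S.IsSolution (expPotential V0 lam) ∧ S.HasPoincareParam ∧ ∀ τ, S.poincare τ = γ τ

/-- The metric function `B`, where the metric is `-A dt² + dr² / B + r² dΩ²`. -/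
def metricB (τ : ℝ) : ℝ := S.hat S.radius τ ^ 2

/-- The Kretschmann scalar, four times the sum of the squares of the six sectional curvatures of
the orthonormal coordinate planes. -/
def kretschmann (τ : ℝ) : ℝ :=
  4 * ((S.hat (S.hat S.lapse) τ / S.lapse τ) ^ 2
    + 2 * (S.hat S.lapse τ * S.hat S.radius τ / (S.lapse τ * S.radius τ)) ^ 2
    + 2 * (S.hat (S.hat S.radius) τ / S.radius τ) ^ 2
    + ((1 - S.hat S.radius τ ^ 2) / S.radius τ ^ 2) ^ 2)

/-- The exterior Schwarzschild solution of some positive mass `m`, up to a constant rescaling of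
the static time, with a constant scalar field. -/
def IsSchwarzschild : Prop :=
  ∃ m > 0, ∃ c > 0,
    (∀ τ, S.metricB τ = 1 - 2 * m / S.radius τ ∧
      S.lapse τ ^ 2 = c ^ 2 * (1 - 2 * m / S.radius τ)) ∧
    Set.range S.radius = Set.Ioi (2 * m) ∧ ∃ ψ0, ∀ τ, S.scalar τ = ψ0

/-- A naked singularity at the end `l` (`atBot` or `atTop`) of the static region: the radius tends
to zero, `B` and the curvature blow up, and the end is at a finite proper distance and at a finite
light-travel time (in the static time) from the interior, so that no horizon hides it. -/
def NakedSingularity (l : Filter ℝ) : Prop :=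
  Tendsto S.radius l (𝓝 0) ∧ Tendsto S.metricB l atTop ∧ Tendsto S.kretschmann l atTop ∧
  MeasureTheory.IntegrableAtFilter S.density l MeasureTheory.volume ∧
  MeasureTheory.IntegrableAtFilter (fun τ => S.density τ / S.lapse τ) l MeasureTheory.volume

/-- The flare-out condition `d²r/dz² > 0` at a point with `B = 0`, where `dz = √(1 - B) dℓ` is the
height of the embedding in flat space and `dℓ` the proper length. -/
def FlareOut (τ : ℝ) : Prop :=
  S.metricB τ = 0 ∧
    0 < S.hat (fun t => S.hat S.radius t / √(1 - S.hat S.radius t ^ 2)) τ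
      / √(1 - S.hat S.radius τ ^ 2)

/-- Asymptotically anti-de Sitter at the end `l`: as `r → ∞`, `B ~ r² / L²` for some `L > 0` and
`d ln A / d ln r → 2`. -/
def AsymptoticallyAdS (l : Filter ℝ) : Prop :=
  Tendsto S.radius l atTop ∧
  (∃ L > 0, Tendsto (fun τ => S.metricB τ / S.radius τ ^ 2) l (𝓝 (1 / L ^ 2))) ∧
  Tendsto (fun τ => 2 * S.accel τ / (S.hat S.radius τ / S.radius τ)) l (𝓝 2)

end Config

end ExpPotential

end

open ExpPotential

noncomputable section

namespace ExpPotential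

/-! ### One-variable calculus -/

/-! Splitting off `growth`, the logarithmic derivative of D = 1/√(1 - normSq), leaves quadratic
equations. Along flow lines `surf` and `1 - normSq` satisfy homogeneous linear equations, so their
zeros and signs persist; this yields the invariance statements. The logarithmic derivatives of
radius and lapse are X₂ and X₃, and V r² (1 - normSq) obeys the same linear equation as `surf`, so a
metric can be integrated back from a finite orbit (`exists_traces`).

Limits rest on one monotone quantity: x₂ + x₃ (`slope`) does not increase when surf ≤ 0. If it stays
bounded towards -∞, Barbalat's lemma sends X₃, Y₁ and surf to 0, so the orbit starts at a Minkowski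
point (`tendsto_minkowski_of_slope_le`). If it diverges, division by X₂ + X₃ turns the flow near
infinity into motion along straight lines through (1/2, μ/2), μ = λ/√2, with an error controlled by
a monotone function (`planar_limit`). The limit is then on a circle, which is the critical curve, or
at the centre, which is P_λ; the centre lies in surf < 0 only if λ² > 6. The symmetry γ(τ) ↦ -γ(-τ)
treats the other end. At the limit point the rates of radius, density and density/lapse are positive
except at P_M and P_H, so these functions decay exponentially and the end is a naked singularity.

On M the variables X₃ and Y₁ solve the same linear equation, which gives the first integral. For Y₁
= 0 one scalar autonomous equation for the angle remains; its solution from π/2 to π/4 is unique up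
to a shift and is Schwarzschild.

For V₀ > 0 and λ ≠ 0, X₂ times a positive factor decreases strictly, hence vanishes at most once.
The exponential potential has a scaling symmetry with conserved charge (y₁ - μ x₃) r N. Its
vanishing or its sign at P_M, P_H and their opposites, together with the sign of X₃ near P_M,
excludes two regular ends (`not_both_regular`). The same charge would force y₁/x₂ → μ at an anti-de
Sitter end, which makes x₂ grow more slowly than r (`not_asymptoticallyAdS_atTop`). -/

theorem exists_integratingFactor {g : ℝ → ℝ} (hg : Continuous g) :
    ∃ E : ℝ → ℝ, (∀ t, 0 < E t) ∧ ∀ t, HasDerivAt E (g t * E t) t := by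
  refine ⟨fun t => Real.exp (∫ s in (0 : ℝ)..t, g s), fun t => Real.exp_pos _, fun t => ?_⟩
  have h := (intervalIntegral.integral_hasDerivAt_right (hg.intervalIntegrable 0 t)
    (hg.stronglyMeasurableAtFilter _ _) hg.continuousAt).exp
  simpa [mul_comm] using h

/-- Values of a solution of a homogeneous linear equation are positive multiples of each other. -/
theorem exists_pos_mul_of_linear {J : Set ℝ} (hJ : J.OrdConnected) {f g : ℝ → ℝ}
    (hg : ContinuousOn g J) (hf : ∀ t ∈ J, HasDerivWithinAt f (g t * f t) J t) {s t : ℝ}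
    (hs : s ∈ J) (ht : t ∈ J) : ∃ c > 0, f t = c * f s := by
  have hsub : Set.uIcc s t ⊆ J := hJ.uIcc_subset hs ht
  have hsub' : Set.Icc (min s t) (max s t) ⊆ J := hsub
  -- Constant extension beyond the segment makes the coefficient continuous on the whole line, where
  -- an integrating factor is available.
  let e : ℝ → ℝ := Set.IccExtend (min_le_max : min s t ≤ max s t) (fun x => g x)
  have he : Continuous e := (continuousOn_iff_continuous_domRestrict.1 (hg.mono hsub')).Icc_extend'
  obtain ⟨E, hE, hE'⟩ := exists_integratingFactor he.neg
  have key : ∀ x ∈ Set.uIcc s t, HasDerivWithinAt (fun x => f x * E x) 0 (Set.uIcc s t) x := by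
    intro x hx
    have h := ((hf x (hsub hx)).mono hsub).mul (hE' x).hasDerivWithinAt
    have hex : e x = g x := Set.IccExtend_of_mem _ _ hx
    refine h.congr_deriv ?_
    rw [Pi.neg_apply, hex]; ring
  have hc := (convex_uIcc s t).norm_image_sub_le_of_norm_hasDerivWithin_le (C := 0) key
    (by simp) Set.left_mem_uIcc Set.right_mem_uIcc
  have hc' : f t * E t = f s * E s := by
    have := norm_le_zero_iff.1 (hc.trans (by simp)); linarith
  refine ⟨E s / E t, div_pos (hE s) (hE t), ?_⟩
  have := (hE t).ne'
  field_simp; linarith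

theorem linear_pos {f g : ℝ → ℝ} (hg : Continuous g) (hf : ∀ t, HasDerivAt f (g t * f t) t)
    {s : ℝ} (hs : 0 < f s) (t : ℝ) : 0 < f t := by
  obtain ⟨c, hc, h⟩ := exists_pos_mul_of_linear Set.ordConnected_univ hg.continuousOn
    (fun t _ => (hf t).hasDerivWithinAt) (Set.mem_univ s) (Set.mem_univ t)
  rw [h]; positivity

theorem linear_eq_zero {f g : ℝ → ℝ} (hg : Continuous g) (hf : ∀ t, HasDerivAt f (g t * f t) t)
    {s : ℝ} (hs : f s = 0) (t : ℝ) : f t = 0 := by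
  obtain ⟨c, hc, h⟩ := exists_pos_mul_of_linear Set.ordConnected_univ hg.continuousOn
    (fun t _ => (hf t).hasDerivWithinAt) (Set.mem_univ s) (Set.mem_univ t)
  rw [h, hs, mul_zero]

/-- Two solutions of the same homogeneous linear equation are proportional. -/
theorem linear_mul_eq {f h g : ℝ → ℝ} (hf : ∀ t, HasDerivAt f (g t * f t) t)
    (hh : ∀ t, HasDerivAt h (g t * h t) t) (hne : ∀ t, h t ≠ 0) :
    ∃ c, ∀ t, f t = c * h t := by
  have hd : ∀ t, HasDerivAt (fun t => f t / h t) 0 t := fun t => by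
    have := (hf t).div (hh t) (hne t)
    refine this.congr_deriv ?_
    have := hne t
    field_simp; ring
  refine ⟨f 0 / h 0, fun t => ?_⟩
  have := is_const_of_deriv_eq_zero (fun t => (hd t).differentiableAt) (fun t => (hd t).deriv) t 0
  have hn := hne t
  rw [← this]; field_simp

theorem monotoneOn_Iic_of_hasDerivAt {f f' : ℝ → ℝ} {T : ℝ}
    (hf : ∀ t ≤ T, HasDerivAt f (f' t) t) (h : ∀ t ≤ T, 0 ≤ f' t) : MonotoneOn f (Set.Iic T) := by
  refine monotoneOn_of_hasDerivWithinAt_nonneg (convex_Iic T)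
    (fun t ht => (hf t ht).continuousAt.continuousWithinAt)
    (fun t ht => (hf t (interior_subset (s := Set.Iic T) ht)).hasDerivWithinAt)
    (fun t ht => h t (interior_subset (s := Set.Iic T) ht))

theorem antitoneOn_Ici_of_hasDerivAt {f f' : ℝ → ℝ} {T : ℝ}
    (hf : ∀ t ≥ T, HasDerivAt f (f' t) t) (h : ∀ t ≥ T, f' t ≤ 0) : AntitoneOn f (Set.Ici T) := by
  refine antitoneOn_of_hasDerivWithinAt_nonpos (convex_Ici T)
    (fun t ht => (hf t ht).continuousAt.continuousWithinAt)
    (fun t ht => (hf t (interior_subset ht)).hasDerivWithinAt) (fun t ht => h t (interior_subset ht))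

theorem antitone_of_hasDerivAt {f f' : ℝ → ℝ} (hf : ∀ t, HasDerivAt f (f' t) t)
    (h : ∀ t, f' t ≤ 0) : Antitone f :=
  antitone_of_deriv_nonpos (fun t => (hf t).differentiableAt) fun t => by rw [(hf t).deriv]; exact h t

/-- A function whose derivative is nonnegative near `-∞` and that is bounded below converges. -/
theorem exists_tendsto_atBot {f f' : ℝ → ℝ} {T c : ℝ} (hf : ∀ t ≤ T, HasDerivAt f (f' t) t)
    (h : ∀ t ≤ T, 0 ≤ f' t) (hc : ∀ t ≤ T, c ≤ f t) :
    ∃ L, Tendsto f atBot (𝓝 L) ∧ ∀ t ≤ T, L ≤ f t := by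
  have hm := monotoneOn_Iic_of_hasDerivAt hf h
  have hm' : Monotone fun t => f (min t T) := fun s t hst =>
    hm (Set.mem_Iic.2 (min_le_right _ _)) (Set.mem_Iic.2 (min_le_right _ _)) (min_le_min_right T hst)
  have hb : BddBelow (Set.range fun t => f (min t T)) :=
    ⟨c, by rintro _ ⟨t, rfl⟩; exact hc _ (min_le_right _ _)⟩
  have hlim := tendsto_atBot_ciInf hm' hb
  refine ⟨_, hlim.congr' ?_, fun t ht => ?_⟩
  · filter_upwards [eventually_le_atBot T] with t ht
    simp [min_eq_left ht]
  · simpa [min_eq_left ht] using ciInf_le hb t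

theorem tendsto_neg_neg_atTop {α : Type*} [TopologicalSpace α] {f : ℝ → α} {l : Filter α}
    (h : Tendsto (fun t => f (-t)) atBot l) : Tendsto f atTop l := by
  simpa [Function.comp_def] using h.comp tendsto_neg_atTop_atBot

/-- If a function and its derivative converge, the limit of the derivative is zero. -/
theorem limit_deriv_eq_zero_atTop {f f' : ℝ → ℝ} {L m T : ℝ}
    (hf : ∀ t ≥ T, HasDerivAt f (f' t) t)
    (h : Tendsto f atTop (𝓝 L)) (h' : Tendsto f' atTop (𝓝 m)) : m = 0 := by
  have h1 : Tendsto (fun t => f (t + 1) - f t) atTop (𝓝 0) := by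
    simpa using (h.comp (tendsto_atTop_add_const_right _ 1 tendsto_id)).sub h
  -- Increments over unit steps tend to 0, and each is a value of the derivative at a point that
  -- recedes to infinity.
  have hx : ∀ t ≥ T, ∃ x, t ≤ x ∧ f' x = f (t + 1) - f t := fun t ht => by
    obtain ⟨x, hx, hx'⟩ := exists_hasDerivAt_eq_slope f f' (by linarith : t < t + 1)
      (fun x hx => (hf x (ht.le.trans hx.1)).continuousAt.continuousWithinAt)
      (fun x hx => hf x (ht.le.trans hx.1.le))
    exact ⟨x, hx.1.le, by rw [hx']; simp⟩
  choose! x hx hx' using hx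
  have h2 : Tendsto (fun t => f' (x t)) atTop (𝓝 m) :=
    h'.comp (tendsto_atTop_mono' _ ((eventually_ge_atTop T).mono hx) tendsto_id)
  exact tendsto_nhds_unique h2 (h1.congr' ((eventually_ge_atTop T).mono fun t ht => (hx' t ht).symm))

theorem hasDerivAt_comp_neg {f : ℝ → ℝ} {f' t : ℝ} (hf : HasDerivAt f f' (-t)) :
    HasDerivAt (fun t => f (-t)) (-f') t := by
  have h := hf.scomp t (hasDerivAt_neg t)
  simp only [neg_smul, one_smul] at h
  exact h

theorem limit_deriv_eq_zero_atBot {f f' : ℝ → ℝ} {L m T : ℝ}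
    (hf : ∀ t ≤ T, HasDerivAt f (f' t) t)
    (h : Tendsto f atBot (𝓝 L)) (h' : Tendsto f' atBot (𝓝 m)) : m = 0 := by
  have := limit_deriv_eq_zero_atTop (T := -T)
    (fun t ht => hasDerivAt_comp_neg (hf (-t) (by linarith)))
    (h.comp tendsto_neg_atTop_atBot) (h'.comp tendsto_neg_atTop_atBot).neg
  linarith

/-- A positive function whose logarithmic derivative is bounded below by a positive constant near
`-∞` decays exponentially there. -/
theorem exp_decay_atBot {f g : ℝ → ℝ} {k : ℝ} (hk : 0 < k) (hpos : ∀ t, 0 < f t)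
    (hf : ∀ t, HasDerivAt f (g t * f t) t) (hg : Tendsto g atBot (𝓝 k)) :
    Tendsto f atBot (𝓝 0) ∧ MeasureTheory.IntegrableAtFilter f atBot MeasureTheory.volume := by
  obtain ⟨T, hT⟩ := eventually_atBot.1 (hg.eventually (lt_mem_nhds (half_lt_self hk)))
  -- Comparison with an exponential of half the limiting rate, which the true rate eventually
  -- exceeds.
  have hm : MonotoneOn (fun t => f t * Real.exp (-(k / 2 * t))) (Set.Iic T) := by
    refine monotoneOn_Iic_of_hasDerivAt (f' := fun t => (g t - k / 2) * (f t * Real.exp (-(k / 2 * t))))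
      (fun t _ => ?_) fun t ht => ?_
    · have h := (hf t).mul (((hasDerivAt_id t).const_mul (k / 2)).neg.exp)
      refine h.congr_deriv ?_
      simp; ring
    · have := hT t ht
      have := hpos t
      have : 0 ≤ g t - k / 2 := by linarith
      positivity
  set C := f T * Real.exp (-(k / 2 * T)) with hC
  have hle : ∀ t ≤ T, f t ≤ C * Real.exp (k / 2 * t) := fun t ht => by
    have := hm ht (Set.mem_Iic.2 le_rfl) ht
    simp only at this
    rw [Real.exp_neg, ← div_eq_mul_inv, div_le_iff₀ (Real.exp_pos _)] at this
    exact this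
  have hlim : Tendsto (fun t => C * Real.exp (k / 2 * t)) atBot (𝓝 0) := by
    have : Tendsto (fun t : ℝ => k / 2 * t) atBot atBot :=
      tendsto_id.const_mul_atBot (half_pos hk)
    simpa using (Real.tendsto_exp_atBot.comp this).const_mul C
  refine ⟨?_, Set.Iic T, Iic_mem_atBot T, ?_⟩
  · refine tendsto_of_tendsto_of_tendsto_of_le_of_le' tendsto_const_nhds hlim
      (Eventually.of_forall fun t => (hpos t).le) ?_
    filter_upwards [eventually_le_atBot T] with t ht using hle t ht
  · have hi := (integrableOn_exp_mul_Iic (half_pos hk) T).const_mul C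
    have hcont : Continuous f := continuous_iff_continuousAt.2 fun t => (hf t).continuousAt
    refine hi.mono' hcont.aestronglyMeasurable ?_
    filter_upwards [MeasureTheory.self_mem_ae_restrict measurableSet_Iic] with t ht
    rw [Real.norm_of_nonneg (hpos t).le]
    exact hle t ht

/-- Barbalat: a nonnegative rate of decrease with bounded derivative tends to zero if the
decreasing function is bounded above. -/
theorem tendsto_zero_of_rate {f f' φ φ' : ℝ → ℝ} {L C : ℝ} (hf : ∀ t, HasDerivAt f (f' t) t)
    (hφ : ∀ t, HasDerivAt φ (φ' t) t) (h0 : ∀ t, 0 ≤ φ t) (hle : ∀ t, f' t ≤ -φ t)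
    (hL : ∀ t, |φ' t| ≤ L) (hC : ∀ t, f t ≤ C) : Tendsto φ atBot (𝓝 0) := by
  obtain ⟨ℓ, hℓ, -⟩ := exists_tendsto_atBot (T := 0) (c := -C) (fun t _ => (hf t).neg)
    (fun t _ => by linarith [hle t, h0 t]) (fun t _ => by simpa using hC t)
  have hL0 : 0 ≤ L := (abs_nonneg _).trans (hL 0)
  rw [Metric.tendsto_nhds]
  intro ε hε
  -- Over a step of this length φ varies by at most ε/2, so one point of the step where φ < ε/2
  -- suffices.
  set h := ε / (2 * (L + 1)) with hh
  have hh0 : 0 < h := by positivity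
  have hd : Tendsto (fun t => f t - f (t + h)) atBot (𝓝 0) := by
    have := (hℓ.comp (tendsto_atBot_add_const_right _ h tendsto_id)).sub hℓ
    simp only [sub_self] at this
    exact this.congr fun t => by simp; ring
  filter_upwards [hd.eventually (gt_mem_nhds (show (0 : ℝ) < h * (ε / 2) by positivity))] with t ht
  rw [Real.dist_0_eq_abs, abs_of_nonneg (h0 t)]
  obtain ⟨x, hx, hx'⟩ := exists_hasDerivAt_eq_slope f f' (by linarith : t < t + h)
    (fun x _ => (hf x).continuousAt.continuousWithinAt) (fun x _ => hf x)
  have hlip := (convex_univ (𝕜 := ℝ) (E := ℝ)).norm_image_sub_le_of_norm_hasDerivWithin_le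
    (fun x _ => (hφ x).hasDerivWithinAt) (fun x _ => hL x) (Set.mem_univ t) (Set.mem_univ x)
  rw [Real.norm_eq_abs, Real.norm_eq_abs, abs_of_pos (by linarith [hx.1] : 0 < x - t)] at hlip
  have h1 : φ t ≤ φ x + L * h := by
    have := (abs_le.1 hlip).1
    have : L * (x - t) ≤ L * h := mul_le_mul_of_nonneg_left (by linarith [hx.2]) hL0
    linarith
  have h2 : φ x * h < h * (ε / 2) := by
    have e : f' x * h = f (t + h) - f t := by rw [hx', add_sub_cancel_left]; field_simp
    have := mul_le_mul_of_nonneg_right (hle x) hh0.le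
    linarith
  have h3 : φ x < ε / 2 := by
    by_contra hcon
    push Not at hcon
    nlinarith [mul_le_mul_of_nonneg_left hcon hh0.le]
  have h4 : L * h ≤ ε / 2 := by
    rw [hh, mul_div_assoc', div_le_iff₀ (by positivity)]
    nlinarith
  linarith

/-- Global solutions of a scalar autonomous equation with a bounded Lipschitz right-hand side. -/
theorem exists_global_solution {v : ℝ → ℝ} {K L : NNReal} (hv : LipschitzWith K v)
    (hb : ∀ x, ‖v x‖ ≤ L) (x₀ : ℝ) : ∃ θ : ℝ → ℝ, θ 0 = x₀ ∧ ∀ t, HasDerivAt θ (v (θ t)) t := by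
  have hloc : ∀ T : ℝ, 0 < T → ∃ α : ℝ → ℝ, α 0 = x₀ ∧
      ∀ t ∈ Set.Ioo (-T) T, HasDerivAt α (v (α t)) t := by
    intro T hT
    have hp : IsPicardLindelof (fun _ => v) (tmin := -T) (tmax := T)
        ⟨0, by constructor <;> linarith⟩ x₀ (L * ⟨T, hT.le⟩) 0 L K :=
      IsPicardLindelof.of_time_independent (fun x _ => hb x) hv.lipschitzOnWith
        (by show (L : ℝ) * max (T - 0) (0 - -T) ≤ L * T - 0; simp)
    obtain ⟨α, h0, hα⟩ := hp.exists_eq_forall_mem_Icc_hasDerivWithinAt₀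
    exact ⟨α, h0, fun t ht => (hα t ⟨ht.1.le, ht.2.le⟩).hasDerivAt (Icc_mem_nhds ht.1 ht.2)⟩
  choose! α h0 hα using hloc
  have heq : ∀ S T : ℝ, 0 < S → S ≤ T → Set.EqOn (α S) (α T) (Set.Ioo (-S) S) := by
    intro S T hS hST
    refine ODE_solution_unique_of_mem_Ioo (v := fun _ => v) (s := fun _ => Set.univ) (t₀ := 0)
      (K := K) (fun t _ => hv.lipschitzOnWith) ⟨by linarith, hS⟩
      (fun t ht => ⟨hα S hS t ht, trivial⟩)
      (fun t ht => ⟨hα T (hS.trans_le hST) t ⟨by linarith [ht.1], by linarith [ht.2]⟩, trivial⟩) ?_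
    rw [h0 S hS, h0 T (hS.trans_le hST)]
  -- A diagonal choice among the solutions on (-T, T); near t it coincides with the single solution
  -- `α (|t| + 2)` by uniqueness.
  refine ⟨fun t => α (|t| + 1) t, h0 _ (by positivity), fun t => ?_⟩
  have hT : 0 < |t| + 2 := by positivity
  have hmem : t ∈ Set.Ioo (-(|t| + 1)) (|t| + 1) := abs_lt.1 (by linarith)
  have hev : (fun t => α (|t| + 1) t) =ᶠ[𝓝 t] α (|t| + 2) := by
    filter_upwards [Ioo_mem_nhds hmem.1 hmem.2] with s hs
    have hs' : |s| < |t| + 1 := abs_lt.2 hs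
    exact heq _ _ (by positivity) (by linarith) (abs_lt.1 (by linarith))
  have h := hα _ hT t (abs_lt.1 (by linarith))
  rw [← hev.self_of_nhds] at h
  exact h.congr_of_eventuallyEq hev

/-! ### The flow -/

/-- Half of the logarithmic rate of change of `(1 - normSq)⁻¹`. -/
def growth (lam : ℝ) (p : Pt) : ℝ :=
  3 * p.1 ^ 2 * p.2.1 + p.1 * p.2.1 ^ 2 - p.2.1 - (2 * p.1 + p.2.1) * p.2.2 ^ 2
    + lam / √2 * p.2.2 * surf p

/-- This form of the component shows the equation for x₂ = D X₂ before compactification: normalising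
by D only adds the term with `growth`. The next two identities do the same for X₃ and Y₁. -/
theorem field_fst (lam : ℝ) (p : Pt) :
    (field lam p).1 = p.1 * p.2.1 - p.2.2 ^ 2 - growth lam p * p.1 := by
  simp only [field, growth, surf]; ring

theorem field_snd (lam : ℝ) (p : Pt) :
    (field lam p).2.1 = -((p.1 + p.2.1) * p.2.1) + surf p - growth lam p * p.2.1 := by
  simp only [field, growth, surf]; ring

theorem field_trd (lam : ℝ) (p : Pt) :
    (field lam p).2.2 =
      -((p.1 + p.2.1) * p.2.2) + lam / √2 * surf p - growth lam p * p.2.2 := by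
  simp only [field, growth, surf]; ring

/-- All monomials of the field have even degree. Hence reflection combined with reversal of τ maps
orbits to orbits, and every result at -∞ has a counterpart at +∞. -/
theorem field_neg (lam : ℝ) (p : Pt) : field lam (-p) = field lam p := by
  simp only [field, Prod.fst_neg, Prod.snd_neg, Prod.mk.injEq]
  refine ⟨?_, ?_, ?_⟩ <;> ring

theorem surf_neg (p : Pt) : surf (-p) = surf p := by
  simp only [surf, Prod.fst_neg, Prod.snd_neg]; ring

theorem normSq_neg (p : Pt) : normSq (-p) = normSq p := by
  simp only [normSq, Prod.fst_neg, Prod.snd_neg]; ring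

theorem growth_neg (lam : ℝ) (p : Pt) : growth lam (-p) = -growth lam p := by
  simp only [growth, surf_neg, Prod.fst_neg, Prod.snd_neg]; ring

theorem continuous_surf : Continuous surf := by unfold surf; fun_prop

theorem continuous_normSq : Continuous normSq := by unfold normSq; fun_prop

theorem continuous_growth (lam : ℝ) : Continuous (growth lam) := by
  have := continuous_surf
  unfold growth; fun_prop

theorem continuous_field (lam : ℝ) : Continuous (field lam) := by unfold field; fun_prop

theorem isCompact_ball : IsCompact {p : Pt | normSq p ≤ 1} := by
  refine (isCompact_Icc (a := ((-1, -1, -1) : Pt)) (b := (1, 1, 1))).of_isClosed_subset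
    (isClosed_le continuous_normSq continuous_const) fun p hp => ?_
  simp only [normSq, Set.mem_ofPred_eq] at hp
  refine ⟨⟨?_, ?_, ?_⟩, ?_, ?_, ?_⟩ <;> simp only <;>
    nlinarith [sq_nonneg p.1, sq_nonneg p.2.1, sq_nonneg p.2.2]

theorem HasDerivWithinAt.pt_fst {γ : ℝ → Pt} {v : Pt} {J : Set ℝ} {τ : ℝ}
    (h : HasDerivWithinAt γ v J τ) : HasDerivWithinAt (fun t => (γ t).1) v.1 J τ :=
  (ContinuousLinearMap.fst ℝ ℝ (ℝ × ℝ)).hasFDerivAt.comp_hasDerivWithinAt τ h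

theorem HasDerivWithinAt.pt_snd {γ : ℝ → Pt} {v : Pt} {J : Set ℝ} {τ : ℝ}
    (h : HasDerivWithinAt γ v J τ) : HasDerivWithinAt (fun t => (γ t).2.1) v.2.1 J τ :=
  ((ContinuousLinearMap.fst ℝ ℝ ℝ).comp (ContinuousLinearMap.snd ℝ ℝ (ℝ × ℝ))).hasFDerivAt
    |>.comp_hasDerivWithinAt τ h

theorem HasDerivWithinAt.pt_trd {γ : ℝ → Pt} {v : Pt} {J : Set ℝ} {τ : ℝ}
    (h : HasDerivWithinAt γ v J τ) : HasDerivWithinAt (fun t => (γ t).2.2) v.2.2 J τ :=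
  ((ContinuousLinearMap.snd ℝ ℝ ℝ).comp (ContinuousLinearMap.snd ℝ ℝ (ℝ × ℝ))).hasFDerivAt
    |>.comp_hasDerivWithinAt τ h

section Local

variable {lam : ℝ} {γ : ℝ → Pt} {J : Set ℝ} {τ : ℝ}

theorem hasDerivWithinAt_surf (h : HasDerivWithinAt γ (field lam (γ τ)) J τ) :
    HasDerivWithinAt (fun t => surf (γ t))
      (2 * ((γ τ).1 - lam / √2 * (γ τ).2.2 - growth lam (γ τ)) * surf (γ τ)) J τ := by
  have h1 := HasDerivWithinAt.pt_fst h
  have h2 := HasDerivWithinAt.pt_snd h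
  rw [field_fst] at h1
  rw [field_snd] at h2
  have h' := ((((h1.pow 2).const_mul 2).add ((h1.const_mul 2).mul h2)).add (h2.pow 2)).sub_const 1
  refine h'.congr_deriv ?_
  simp only [growth, surf]
  push_cast
  ring

theorem hasDerivWithinAt_normSq (h : HasDerivWithinAt γ (field lam (γ τ)) J τ) :
    HasDerivWithinAt (fun t => 1 - normSq (γ t))
      (-2 * growth lam (γ τ) * (1 - normSq (γ τ))) J τ := by
  have h1 := HasDerivWithinAt.pt_fst h
  have h2 := HasDerivWithinAt.pt_snd h
  have h3 := HasDerivWithinAt.pt_trd h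
  rw [field_fst] at h1
  rw [field_snd] at h2
  rw [field_trd] at h3
  have h' := (((h1.pow 2).add (h2.pow 2)).add (h3.pow 2)).const_sub 1
  refine h'.congr_deriv ?_
  simp only [growth, surf, normSq]
  push_cast
  ring

end Local

theorem hasDerivAt_surf {lam : ℝ} {γ : ℝ → Pt} (h : IsFlowLine lam γ) (τ : ℝ) :
    HasDerivAt (fun t => surf (γ t))
      (2 * ((γ τ).1 - lam / √2 * (γ τ).2.2 - growth lam (γ τ)) * surf (γ τ)) τ := by
  simpa using hasDerivWithinAt_surf (h τ).hasDerivWithinAt (J := Set.univ)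

theorem hasDerivAt_normSq {lam : ℝ} {γ : ℝ → Pt} (h : IsFlowLine lam γ) (τ : ℝ) :
    HasDerivAt (fun t => 1 - normSq (γ t))
      (-2 * growth lam (γ τ) * (1 - normSq (γ τ))) τ := by
  simpa using hasDerivWithinAt_normSq (h τ).hasDerivWithinAt (J := Set.univ)

namespace IsFlowLine

variable {lam : ℝ} {γ : ℝ → Pt} (h : IsFlowLine lam γ)

include h

theorem continuous : Continuous γ := continuous_iff_continuousAt.2 fun τ => (h τ).continuousAt

theorem hasDerivAt_fst (τ : ℝ) : HasDerivAt (fun t => (γ t).1)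
    ((γ τ).1 * (γ τ).2.1 - (γ τ).2.2 ^ 2 - growth lam (γ τ) * (γ τ).1) τ := by
  rw [← field_fst]
  simpa using HasDerivWithinAt.pt_fst (h τ).hasDerivWithinAt (J := Set.univ)

theorem hasDerivAt_snd (τ : ℝ) : HasDerivAt (fun t => (γ t).2.1)
    (-(((γ τ).1 + (γ τ).2.1) * (γ τ).2.1) + surf (γ τ) - growth lam (γ τ) * (γ τ).2.1) τ := by
  rw [← field_snd]
  simpa using HasDerivWithinAt.pt_snd (h τ).hasDerivWithinAt (J := Set.univ)

theorem hasDerivAt_trd (τ : ℝ) : HasDerivAt (fun t => (γ t).2.2)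
    (-(((γ τ).1 + (γ τ).2.1) * (γ τ).2.2) + lam / √2 * surf (γ τ)
      - growth lam (γ τ) * (γ τ).2.2) τ := by
  rw [← field_trd]
  simpa using HasDerivWithinAt.pt_trd (h τ).hasDerivWithinAt (J := Set.univ)

theorem neg : IsFlowLine lam fun τ => -γ (-τ) := fun τ => by
  have h' := ((h (-τ)).scomp τ (hasDerivAt_neg τ)).neg
  refine h'.congr_deriv ?_
  rw [field_neg]; simp

end IsFlowLine

theorem IsOrbit.neg {lam : ℝ} {γ : ℝ → Pt} (h : IsOrbit lam γ) : IsOrbit lam fun τ => -γ (-τ) :=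
  ⟨h.1.neg, fun τ => by
    have := h.2 (-τ)
    simpa only [phaseSpace, Set.mem_ofPred_eq, surf_neg, normSq_neg] using this⟩

theorem IsFinite.neg {γ : ℝ → Pt} (h : IsFinite γ) : IsFinite fun τ => -γ (-τ) :=
  fun τ => by rw [normSq_neg]; exact h _

/-! ### The invariant surface -/

theorem surf_eq_zero_iff (p : Pt) : surf p = 0 ↔ (p.1 + p.2.1) ^ 2 = 1 - p.1 ^ 2 := by
  simp only [surf]; constructor <;> intro h <;> linarith

/-- On surf = 0 the sum X₂ + X₃ cannot vanish in the ball: it would give X₂² = X₃² = 1 and normSq ≥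
2. Its sign therefore separates the two sheets and replaces the square root. -/
theorem mem_surfM_iff (p : Pt) :
    p ∈ surfM ↔ surf p = 0 ∧ normSq p ≤ 1 ∧ 0 < p.1 + p.2.1 := by
  rw [surf_eq_zero_iff]
  simp only [surfM, Set.mem_ofPred_eq]
  constructor
  · rintro ⟨h1, h2, h3⟩
    have h4 : (p.1 + p.2.1) ^ 2 = 1 - p.1 ^ 2 := by rw [h1, Real.sq_sqrt (by linarith)]
    refine ⟨h4, h3, lt_of_le_of_ne (h1 ▸ Real.sqrt_nonneg _) fun h5 => ?_⟩
    rw [← h5] at h4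
    simp only [normSq] at h3
    rw [show p.2.1 = -p.1 by linarith] at h3
    nlinarith [sq_nonneg p.2.2]
  · rintro ⟨h1, h2, h3⟩
    refine ⟨?_, by nlinarith [sq_nonneg (p.1 + p.2.1)], h2⟩
    rw [← h1, Real.sqrt_sq h3.le]

theorem mem_surfM_iff_neg (p : Pt) : p ∈ surfM ↔ -p ∈ surfMbar := by
  simp only [surfM, surfMbar, Set.mem_ofPred_eq, normSq_neg, Prod.fst_neg, Prod.snd_neg, neg_sq]
  constructor <;> rintro ⟨h1, h2, h3⟩ <;> exact ⟨by linarith, h2, h3⟩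

theorem mem_surfMbar_iff_neg (p : Pt) : p ∈ surfMbar ↔ -p ∈ surfM := by
  rw [mem_surfM_iff_neg, neg_neg]

theorem mem_surfMbar_iff (p : Pt) :
    p ∈ surfMbar ↔ surf p = 0 ∧ normSq p ≤ 1 ∧ p.1 + p.2.1 < 0 := by
  rw [mem_surfMbar_iff_neg, mem_surfM_iff, surf_neg, normSq_neg]
  simp only [Prod.fst_neg, Prod.snd_neg]
  refine and_congr_right fun _ => and_congr_right fun _ => ?_
  constructor <;> intro h <;> linarith

theorem sum_ne_zero_of_surf_eq_zero {p : Pt} (h : surf p = 0) (hn : normSq p ≤ 1) :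
    p.1 + p.2.1 ≠ 0 := fun h0 => by
  rw [surf_eq_zero_iff, h0] at h
  simp only [normSq] at hn
  rw [show p.2.1 = -p.1 by linarith] at hn
  nlinarith [sq_nonneg p.2.2]

theorem surf_zero_ball_eq : {p : Pt | surf p = 0 ∧ normSq p ≤ 1} = surfM ∪ surfMbar := by
  ext p
  simp only [Set.mem_ofPred_eq, Set.mem_union, mem_surfM_iff, mem_surfMbar_iff]
  constructor
  · rintro ⟨h1, h2⟩
    rcases lt_or_gt_of_ne (sum_ne_zero_of_surf_eq_zero h1 h2) with h | h
    · exact Or.inr ⟨h1, h2, h⟩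
    · exact Or.inl ⟨h1, h2, h⟩
  · rintro (⟨h1, h2, -⟩ | ⟨h1, h2, -⟩) <;> exact ⟨h1, h2⟩

theorem disjoint_surfM_surfMbar : Disjoint surfM surfMbar := by
  rw [Set.disjoint_left]
  intro p h h'
  rw [mem_surfM_iff] at h
  rw [mem_surfMbar_iff] at h'
  linarith [h.2.2, h'.2.2]

section Invariance

variable {lam : ℝ} {γ : ℝ → Pt} {J : Set ℝ} {s t : ℝ}

theorem surf_eq_zero_on (hJ : J.OrdConnected)
    (hγ : ∀ τ ∈ J, HasDerivWithinAt γ (field lam (γ τ)) J τ) (hs : s ∈ J) (ht : t ∈ J)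
    (h : surf (γ s) = 0) : surf (γ t) = 0 := by
  have hc : ContinuousOn γ J := fun τ hτ => (hγ τ hτ).continuousWithinAt
  have hg := (continuous_growth lam).comp_continuousOn hc
  obtain ⟨c, -, hc⟩ := exists_pos_mul_of_linear hJ (f := fun t => surf (γ t))
    (g := fun τ => 2 * ((γ τ).1 - lam / √2 * (γ τ).2.2 - growth lam (γ τ)))
    (by simp only [Function.comp_def] at hg; fun_prop)
    (fun τ hτ => hasDerivWithinAt_surf (hγ τ hτ)) hs ht
  rw [hc, h, mul_zero]

theorem normSq_le_one_on (hJ : J.OrdConnected)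
    (hγ : ∀ τ ∈ J, HasDerivWithinAt γ (field lam (γ τ)) J τ) (hs : s ∈ J) (ht : t ∈ J)
    (h : normSq (γ s) ≤ 1) : normSq (γ t) ≤ 1 := by
  have hc : ContinuousOn γ J := fun τ hτ => (hγ τ hτ).continuousWithinAt
  have hg := (continuous_growth lam).comp_continuousOn hc
  obtain ⟨c, hc0, hc⟩ := exists_pos_mul_of_linear hJ (f := fun t => 1 - normSq (γ t))
    (g := fun τ => -2 * growth lam (γ τ))
    (by simp only [Function.comp_def] at hg; fun_prop)
    (fun τ hτ => hasDerivWithinAt_normSq (hγ τ hτ)) hs ht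
  have : 0 ≤ c * (1 - normSq (γ s)) := mul_nonneg hc0.le (by linarith)
  linarith

theorem mem_surfM_on (hJ : J.OrdConnected)
    (hγ : ∀ τ ∈ J, HasDerivWithinAt γ (field lam (γ τ)) J τ) (hs : s ∈ J) (ht : t ∈ J)
    (h : γ s ∈ surfM) : γ t ∈ surfM := by
  rw [mem_surfM_iff] at h ⊢
  refine ⟨surf_eq_zero_on hJ hγ hs ht h.1, normSq_le_one_on hJ hγ hs ht h.2.1, ?_⟩
  have hc : ContinuousOn (fun τ => (γ τ).1 + (γ τ).2.1) (Set.uIcc s t) := by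
    have : ContinuousOn γ (Set.uIcc s t) := fun τ hτ =>
      (hγ τ (hJ.uIcc_subset hs ht hτ)).continuousWithinAt.mono (hJ.uIcc_subset hs ht)
    fun_prop
  by_contra hcon
  push Not at hcon
  -- Passing to the other sheet would require a zero of X₂ + X₃ on the invariant surface.
  obtain ⟨x, hx, hx0⟩ := intermediate_value_uIcc hc
    (show (0 : ℝ) ∈ Set.uIcc _ _ from Set.mem_uIcc.2 (Or.inr ⟨hcon, h.2.2.le⟩))
  have hxJ := hJ.uIcc_subset hs ht hx
  exact sum_ne_zero_of_surf_eq_zero (surf_eq_zero_on hJ hγ hs hxJ h.1)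
    (normSq_le_one_on hJ hγ hs hxJ h.2.1) hx0

end Invariance

theorem mem_surfMbar_on {lam : ℝ} {γ : ℝ → Pt} {J : Set ℝ} {s t : ℝ} (hJ : J.OrdConnected)
    (hγ : ∀ τ ∈ J, HasDerivWithinAt γ (field lam (γ τ)) J τ) (hs : s ∈ J) (ht : t ∈ J)
    (h : γ s ∈ surfMbar) : γ t ∈ surfMbar := by
  rw [mem_surfMbar_iff_neg] at h ⊢
  have hmap : Set.MapsTo (fun τ : ℝ => -τ) (-J) J := fun τ hτ => hτ
  refine mem_surfM_on (lam := lam) (γ := fun τ => -γ (-τ)) (J := -J) (s := -s) (t := -t)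
    ?_ (fun τ hτ => ?_) (by simpa) (by simpa) (by simpa using h) |> fun h => by simpa using h
  · exact hJ.preimage_anti fun _ _ h => neg_le_neg h
  · have h' := ((hγ (-τ) hτ).scomp τ (hasDerivAt_neg τ).hasDerivWithinAt hmap).neg
    refine h'.congr_deriv ?_
    rw [field_neg]; simp

/-! ### Limits of finite orbits -/

theorem tendsto_pt {γ : ℝ → Pt} {l : Filter ℝ} {p : Pt} (h1 : Tendsto (fun t => (γ t).1) l (𝓝 p.1))
    (h2 : Tendsto (fun t => (γ t).2.1) l (𝓝 p.2.1)) (h3 : Tendsto (fun t => (γ t).2.2) l (𝓝 p.2.2)) :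
    Tendsto γ l (𝓝 p) := h1.prodMk_nhds (h2.prodMk_nhds h3)

theorem tendsto_zero_of_sq {f : ℝ → ℝ} {l : Filter ℝ} (h : Tendsto (fun t => f t ^ 2) l (𝓝 0)) :
    Tendsto f l (𝓝 0) := by
  have := h.sqrt
  simp only [Real.sqrt_sq_eq_abs, Real.sqrt_zero] at this
  exact (tendsto_zero_iff_abs_tendsto_zero _).2 this

/-- The ratio `x₂ + x₃`, which decreases along finite orbits. -/
def slope (p : Pt) : ℝ := (p.1 + p.2.1) / √(1 - normSq p)

section

variable {lam : ℝ} {γ : ℝ → Pt}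

theorem hasDerivAt_sqrt (h : IsFlowLine lam γ) (hf : IsFinite γ) (τ : ℝ) :
    HasDerivAt (fun t => √(1 - normSq (γ t)))
      (-growth lam (γ τ) * √(1 - normSq (γ τ))) τ := by
  have hw : 0 < 1 - normSq (γ τ) := by linarith [hf τ]
  refine ((hasDerivAt_normSq h τ).sqrt hw.ne').congr_deriv ?_
  have h2 := Real.sq_sqrt hw.le
  have h3 := (Real.sqrt_pos.2 hw).ne'
  field_simp
  rw [h2]

theorem hasDerivAt_sum (h : IsFlowLine lam γ) (τ : ℝ) :
    HasDerivAt (fun t => (γ t).1 + (γ t).2.1)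
      (-((γ τ).2.2 ^ 2 + (γ τ).2.1 ^ 2 - surf (γ τ))
        - growth lam (γ τ) * ((γ τ).1 + (γ τ).2.1)) τ :=
  ((h.hasDerivAt_fst τ).add (h.hasDerivAt_snd τ)).congr_deriv (by ring)

/-- The `growth` terms of numerator and denominator cancel; what remains has a definite sign once
surf ≤ 0. -/
theorem hasDerivAt_slope (h : IsFlowLine lam γ) (hf : IsFinite γ) (τ : ℝ) :
    HasDerivAt (fun t => slope (γ t))
      (-((γ τ).2.2 ^ 2 + (γ τ).2.1 ^ 2 - surf (γ τ)) / √(1 - normSq (γ τ))) τ := by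
  have hw : 0 < 1 - normSq (γ τ) := by linarith [hf τ]
  have h3 := (Real.sqrt_pos.2 hw).ne'
  refine ((hasDerivAt_sum h τ).div (hasDerivAt_sqrt h hf τ) h3).congr_deriv ?_
  field_simp
  ring

theorem slope_rate_nonneg (hs : ∀ τ, surf (γ τ) ≤ 0) (τ : ℝ) :
    0 ≤ (γ τ).2.2 ^ 2 + (γ τ).2.1 ^ 2 - surf (γ τ) := by
  have := hs τ
  nlinarith [sq_nonneg (γ τ).2.2, sq_nonneg (γ τ).2.1]

theorem antitone_slope (h : IsFlowLine lam γ) (hf : IsFinite γ) (hs : ∀ τ, surf (γ τ) ≤ 0) :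
    Antitone fun t => slope (γ t) := by
  refine antitone_of_hasDerivAt (hasDerivAt_slope h hf) fun τ => ?_
  have := slope_rate_nonneg hs τ
  exact div_nonpos_of_nonpos_of_nonneg (by linarith) (Real.sqrt_nonneg _)

theorem normSq_nonneg (p : Pt) : 0 ≤ normSq p := by unfold normSq; positivity

/-- If `x₂ + x₃` stays bounded towards `-∞`, the orbit comes from a Minkowski point. -/
theorem tendsto_minkowski_of_slope_le (h : IsFlowLine lam γ) (hf : IsFinite γ)
    (hs : ∀ τ, surf (γ τ) ≤ 0) {C : ℝ} (hC : ∀ τ, slope (γ τ) ≤ C) :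
    Tendsto γ atBot (𝓝 PM) ∨ Tendsto γ atBot (𝓝 PMbar) := by
  -- The rate of decrease is polynomial in the point, so its derivative is bounded on the compact
  -- ball, as Barbalat's lemma requires.
  have hφ : ∀ τ, HasDerivAt (fun t => (γ t).2.2 ^ 2 + (γ t).2.1 ^ 2 - surf (γ t))
      (2 * (γ τ).2.2 * (field lam (γ τ)).2.2 + 2 * (γ τ).2.1 * (field lam (γ τ)).2.1
        - 2 * ((γ τ).1 - lam / √2 * (γ τ).2.2 - growth lam (γ τ)) * surf (γ τ)) τ := fun τ => by
    have h2 := h.hasDerivAt_snd τ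
    have h3 := h.hasDerivAt_trd τ
    rw [← field_snd] at h2
    rw [← field_trd] at h3
    refine (((h3.pow 2).add (h2.pow 2)).sub (hasDerivAt_surf h τ)).congr_deriv ?_
    push_cast; ring
  have hcont : Continuous fun p : Pt =>
      2 * p.2.2 * (field lam p).2.2 + 2 * p.2.1 * (field lam p).2.1
        - 2 * (p.1 - lam / √2 * p.2.2 - growth lam p) * surf p := by
    have := continuous_field lam
    have := continuous_growth lam
    have := continuous_surf
    fun_prop
  obtain ⟨L, hL⟩ := isCompact_ball.exists_bound_of_continuousOn hcont.continuousOn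
  -- The denominator √(1 - normSq) is at most 1, so dropping it only weakens the rate of decrease.
  have hφ0 := tendsto_zero_of_rate (hasDerivAt_slope h hf) hφ (slope_rate_nonneg hs)
    (fun τ => by
      rw [neg_div]
      refine neg_le_neg (le_div_self (slope_rate_nonneg hs τ)
        (Real.sqrt_pos.2 (by linarith [hf τ])) (Real.sqrt_le_one.2 ?_))
      linarith [normSq_nonneg (γ τ)])
    (fun τ => hL (γ τ) (hf τ).le) hC
  have hy : Tendsto (fun t => (γ t).2.2) atBot (𝓝 0) := by
    refine tendsto_zero_of_sq (squeeze_zero (fun t => sq_nonneg _) (fun t => ?_) hφ0)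
    nlinarith [hs t, sq_nonneg (γ t).2.1]
  have hb : Tendsto (fun t => (γ t).2.1) atBot (𝓝 0) := by
    refine tendsto_zero_of_sq (squeeze_zero (fun t => sq_nonneg _) (fun t => ?_) hφ0)
    nlinarith [hs t, sq_nonneg (γ t).2.2]
  have hI : Tendsto (fun t => surf (γ t)) atBot (𝓝 0) := by
    have := ((hy.pow 2).add (hb.pow 2)).sub hφ0
    simp only [ne_eq, OfNat.ofNat_ne_zero, not_false_eq_true, zero_pow, add_zero, sub_zero] at this
    exact this.congr fun t => by ring
  obtain ⟨ℓ, hℓ, -⟩ := exists_tendsto_atBot (T := 0) (c := -C)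
    (fun t _ => (hasDerivAt_slope h hf t).neg)
    (fun t _ => by
      rw [neg_div, neg_neg]
      exact div_nonneg (slope_rate_nonneg hs t) (Real.sqrt_nonneg _))
    (fun t _ => by simpa using hC t)
  have hab : Tendsto (fun t => (γ t).1 * (γ t).2.1) atBot (𝓝 0) := by
    refine squeeze_zero_norm (fun t => ?_) (by simpa using hb.norm)
    rw [norm_mul]
    refine mul_le_of_le_one_left (norm_nonneg _) (abs_le_one_iff_mul_self_le_one.2 ?_)
    have := hf t
    simp only [normSq] at this
    nlinarith [sq_nonneg (γ t).2.1, sq_nonneg (γ t).2.2]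
  have ha2 : Tendsto (fun t => (γ t).1 ^ 2) atBot (𝓝 (1 / 2)) := by
    have := ((hI.sub (hab.const_mul 2)).sub (hb.pow 2)).const_add 1 |>.div_const 2
    norm_num at this ⊢
    refine this.congr fun t => ?_
    simp only [surf]; ring
  have hw : Tendsto (fun t => √(1 - normSq (γ t))) atBot (𝓝 √(1 / 2)) := by
    have := (((ha2.add (hb.pow 2)).add (hy.pow 2)).const_sub 1).sqrt
    norm_num at this ⊢
    exact this
  -- X₂² → 1/2 leaves the sign undecided; X₂ itself converges because the slope does.
  have ha : Tendsto (fun t => (γ t).1) atBot (𝓝 (-ℓ * √(1 / 2))) := by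
    have := (hℓ.neg.mul hw).sub hb
    rw [sub_zero] at this
    refine this.congr fun t => ?_
    have := (Real.sqrt_pos.2 (by linarith [hf t] : 0 < 1 - normSq (γ t))).ne'
    simp only [Pi.neg_apply, slope, neg_neg]
    field_simp; ring
  have hsq := tendsto_nhds_unique (ha.pow 2) ha2
  generalize √(1 / 2 : ℝ) = x at ha hsq
  rw [show (1 : ℝ) / 2 = (1 / √2) ^ 2 by rw [div_pow, Real.sq_sqrt zero_le_two, one_pow],
    sq_eq_sq_iff_eq_or_eq_neg] at hsq
  rcases hsq with hsq | hsq
  · rw [hsq] at ha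
    exact Or.inl (tendsto_pt ha hb hy)
  · rw [hsq] at ha
    exact Or.inr (tendsto_pt ha hb hy)

end

/-- The dynamics near infinity: a planar system that, up to an integrable error, moves along the
straight lines through `(1/2, μ/2)`. -/
theorem planar_limit {S k P Q : ℝ → ℝ} {μ T : ℝ} (hS : ∀ t ≤ T, 0 < S t) (hk : ∀ t ≤ T, 0 < k t)
    (hk' : ∀ t ≤ T, k t ≤ 1 / 2) (hZ : ∀ t ≤ T, 0 ≤ k t + P t ^ 2 + Q t ^ 2 - 1)
    (hSn : ∀ t ≤ T, S t ^ 2 * (k t + (1 - P t) ^ 2 + P t ^ 2 + Q t ^ 2) = 1)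
    (hkd : ∀ t ≤ T, HasDerivAt k
      (2 * S t * k t * (2 * (k t + P t ^ 2 + Q t ^ 2 - 1) + 1 - k t)) t)
    (hPd : ∀ t ≤ T, HasDerivAt P (S t * (P t * (2 * (k t + P t ^ 2 + Q t ^ 2 - 1) - k t)
      - (k t + P t ^ 2 + Q t ^ 2 - 1))) t)
    (hQd : ∀ t ≤ T, HasDerivAt Q (S t * (Q t * (2 * (k t + P t ^ 2 + Q t ^ 2 - 1) - k t)
      - μ * (k t + P t ^ 2 + Q t ^ 2 - 1))) t)
    (hk0 : Tendsto k atBot (𝓝 0)) :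
    ∃ p q, Tendsto P atBot (𝓝 p) ∧ Tendsto Q atBot (𝓝 q) ∧
      (p ^ 2 + q ^ 2 = 1 ∨ p = 1 / 2 ∧ q = μ / 2) := by
  set Z : ℝ → ℝ := fun t => k t + P t ^ 2 + Q t ^ 2 - 1 with hZdef
  -- For k = 0 the equations read (P, Q)' = 2SZ ((P, Q) - (1/2, μ/2)), a radial motion. Here m is
  -- the squared distance to the centre, and e enters its derivative only multiplied by k.
  set m : ℝ → ℝ := fun t => (P t - 1 / 2) ^ 2 + (Q t - μ / 2) ^ 2 with hm
  set e : ℝ → ℝ := fun t => (P t - 1 / 2) + μ * (Q t - μ / 2) with he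
  have hm0 : ∀ t, 0 ≤ m t := fun t => by positivity
  have hmd : ∀ t ≤ T, HasDerivAt m (S t * (2 * (2 * Z t - k t) * m t - k t * e t)) t :=
    fun t ht => by
      refine ((((hPd t ht).sub_const (1 / 2)).pow 2).add
        (((hQd t ht).sub_const (μ / 2)).pow 2)).congr_deriv ?_
      simp only [hm, he, hZdef]; push_cast; ring
  have hee : ∀ t, e t ≤ m t / 2 + (1 + μ ^ 2) / 2 := fun t => by
    simp only [hm, he]
    nlinarith [sq_nonneg (P t - 1 / 2 - 1), sq_nonneg (Q t - μ / 2 - μ)]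
  -- Since k' ≥ S k, adding a suitable multiple of k absorbs any error of size S k.
  have hkge : ∀ t ≤ T, S t * k t ≤ 2 * S t * k t * (2 * Z t + 1 - k t) := fun t ht => by
    have h1 := mul_pos (hS t ht) (hk t ht)
    have h2 : 1 / 2 ≤ 2 * Z t + 1 - k t := by linarith [hZ t ht, hk' t ht]
    nlinarith
  -- The factor 3 + μ² works because e ≤ m/2 + (1 + μ²)/2. The shift by 1 in the logarithm is needed
  -- while m may still tend to 0.
  obtain ⟨L, hL, -⟩ := exists_tendsto_atBot (f := fun t => Real.log (m t + 1) + (3 + μ ^ 2) * k t)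
    (T := T) (c := 0)
    (fun t ht => (((hmd t ht).add_const 1).log (by linarith [hm0 t])).add
      ((hkd t ht).const_mul (3 + μ ^ 2)))
    (fun t ht => by
      have hm1 : 0 < m t + 1 := by linarith [hm0 t]
      have h1 := mul_le_mul_of_nonneg_left (hkge t ht) (by positivity : 0 ≤ 3 + μ ^ 2)
      have h2 : -((3 + μ ^ 2) * (S t * k t)) ≤
          S t * (2 * (2 * Z t - k t) * m t - k t * e t) / (m t + 1) := by
        rw [le_div_iff₀ hm1]
        have h3 := mul_nonneg (mul_nonneg (hS t ht).le (hZ t ht)) (hm0 t)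
        have h4 := mul_pos (hS t ht) (hk t ht)
        have h5 : 0 ≤ (3 + μ ^ 2) * (m t + 1) - 2 * m t - e t := by
          nlinarith [hee t, hm0 t, mul_nonneg (sq_nonneg μ) (hm0 t), sq_nonneg μ]
        nlinarith [mul_nonneg h4.le h5]
      linarith)
    (fun t ht => add_nonneg (Real.log_nonneg (by linarith [hm0 t]))
      (mul_nonneg (by positivity) (hk t ht).le))
  have hmlim : Tendsto m atBot (𝓝 (Real.exp L - 1)) := by
    have h1 : Tendsto (fun t => Real.log (m t + 1)) atBot (𝓝 L) := by
      have := hL.sub (hk0.const_mul (3 + μ ^ 2))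
      rw [mul_zero, sub_zero] at this
      exact this.congr fun t => by ring
    have := ((Real.continuous_exp.tendsto L).comp h1).sub_const 1
    refine this.congr fun t => ?_
    simp only [Function.comp_apply]
    rw [Real.exp_log (by linarith [hm0 t])]; ring
  generalize Real.exp L - 1 = ms at hmlim
  have hms : 0 ≤ ms := ge_of_tendsto' hmlim hm0
  rcases hms.eq_or_lt with rfl | hms
  · refine ⟨1 / 2, μ / 2, ?_, ?_, Or.inr ⟨rfl, rfl⟩⟩
    · have := tendsto_zero_of_sq (squeeze_zero (fun t => sq_nonneg (P t - 1 / 2))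
        (fun t => le_add_of_nonneg_right (sq_nonneg (Q t - μ / 2))) hmlim)
      have h2 := this.add_const (1 / 2)
      rw [zero_add] at h2
      exact h2.congr fun t => sub_add_cancel _ _
    · have := tendsto_zero_of_sq (squeeze_zero (fun t => sq_nonneg (Q t - μ / 2))
        (fun t => le_add_of_nonneg_left (sq_nonneg (P t - 1 / 2))) hmlim)
      have h2 := this.add_const (μ / 2)
      rw [zero_add] at h2
      exact h2.congr fun t => sub_add_cancel _ _
  obtain ⟨T', hT'⟩ := eventually_atBot.1 (((hmlim.eventually (lt_mem_nhds (half_lt_self hms))).and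
    (hmlim.eventually (gt_mem_nhds (lt_add_one ms)))).and (eventually_le_atBot T))
  -- For m > ms/2 the choice of C gives e ≤ (C - 3) m; this leaves the margin S (4Z + k) in the
  -- derivative of log m + C k.
  set C : ℝ := 4 + (1 + μ ^ 2) / ms with hC
  have hC0 : 0 < C := by positivity
  have hH : ∀ t ≤ T', HasDerivAt (fun t => Real.log (m t) + C * k t)
      (S t * (2 * (2 * Z t - k t) * m t - k t * e t) / m t
        + C * (2 * S t * k t * (2 * Z t + 1 - k t))) t := fun t ht => by
    obtain ⟨⟨h1, h2⟩, h3⟩ := hT' t ht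
    exact ((hmd t h3).log (by linarith)).add ((hkd t h3).const_mul C)
  have hHge : ∀ t ≤ T', S t * (4 * Z t + k t) ≤
      S t * (2 * (2 * Z t - k t) * m t - k t * e t) / m t
        + C * (2 * S t * k t * (2 * Z t + 1 - k t)) := fun t ht => by
    obtain ⟨⟨h1, h2⟩, h3⟩ := hT' t ht
    have hmt : 0 < m t := by linarith
    have h4 := mul_le_mul_of_nonneg_left (hkge t h3) hC0.le
    have h5 := mul_pos (hS t h3) (hk t h3)
    have h6 : S t * (4 * Z t - 2 * k t) - S t * k t * (C - 3) ≤
        S t * (2 * (2 * Z t - k t) * m t - k t * e t) / m t := by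
      rw [le_div_iff₀ hmt]
      have h7 : (1 + μ ^ 2) / 2 ≤ (1 + μ ^ 2) / ms * m t := by
        rw [div_mul_eq_mul_div, le_div_iff₀ hms]
        nlinarith [sq_nonneg μ]
      have h8 : e t ≤ (C - 3) * m t := by
        rw [hC]; nlinarith [hee t]
      nlinarith [mul_le_mul_of_nonneg_left h8 h5.le]
    nlinarith
  set R : ℝ := ms + 2 with hR
  have hPb : ∀ t ≤ T', |P t - 1 / 2| ≤ R := fun t ht => by
    obtain ⟨⟨h1, h2⟩, h3⟩ := hT' t ht
    simp only [hm] at h2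
    exact abs_le.2 ⟨by nlinarith [sq_nonneg (P t - 1 / 2 + 1), sq_nonneg (Q t - μ / 2)],
      by nlinarith [sq_nonneg (P t - 1 / 2 - 1), sq_nonneg (Q t - μ / 2)]⟩
  have hQb : ∀ t ≤ T', |Q t - μ / 2| ≤ R := fun t ht => by
    obtain ⟨⟨h1, h2⟩, h3⟩ := hT' t ht
    simp only [hm] at h2
    exact abs_le.2 ⟨by nlinarith [sq_nonneg (Q t - μ / 2 + 1), sq_nonneg (P t - 1 / 2)],
      by nlinarith [sq_nonneg (Q t - μ / 2 - 1), sq_nonneg (P t - 1 / 2)]⟩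
  have hlogm : ∀ t ≤ T', Real.log (ms / 2) ≤ Real.log (m t) + C * k t := fun t ht => by
    obtain ⟨⟨h1, h2⟩, h3⟩ := hT' t ht
    have := Real.log_le_log (half_pos hms) h1.le
    have := mul_pos hC0 (hk t h3)
    linarith
  have hHlim : Tendsto (fun t => Real.log (m t) + C * k t) atBot (𝓝 (Real.log ms)) := by
    simpa using (hmlim.log hms.ne').add (hk0.const_mul C)
  -- X' is bounded below by -(R + 1 + |ν|) S (4Z + k). Adding that multiple of log m + C k yields a
  -- monotone function bounded below; it converges, and so does X. The cases are X = P with ν = 1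
  -- and X = Q with ν = μ.
  have key : ∀ (X : ℝ → ℝ) (ν : ℝ), (∀ t ≤ T', |X t - ν / 2| ≤ R) →
      (∀ t ≤ T', HasDerivAt X (S t * (X t * (2 * Z t - k t) - ν * Z t)) t) →
      ∃ x, Tendsto X atBot (𝓝 x) := fun X ν hXb hXd => by
    obtain ⟨x, hx, -⟩ := exists_tendsto_atBot (T := T')
      (c := ν / 2 - R + (R + 1 + |ν|) * Real.log (ms / 2))
      (fun t ht => (hXd t ht).add ((hH t ht).const_mul (R + 1 + |ν|)))
      (fun t ht => by
        have h3 := (hT' t ht).2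
        have h4 := mul_le_mul_of_nonneg_left (hHge t ht) (by positivity : 0 ≤ R + 1 + |ν|)
        have h5 := abs_le.1 (hXb t ht)
        have h6 := hZ t h3
        have h7 := hk t h3
        have h8 : 0 ≤ X t * (2 * Z t - k t) - ν * Z t + (R + 1 + |ν|) * (4 * Z t + k t) := by
          have e1 : X t * (2 * Z t - k t) - ν * Z t
              = (X t - ν / 2) * (2 * Z t) - (X t - ν / 2) * k t - ν / 2 * k t := by ring
          have e2 := mul_le_mul_of_nonneg_right h5.1 (by linarith : 0 ≤ 2 * Z t)
          have e3 := mul_le_mul_of_nonneg_right h5.2 h7.le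
          have e4 := mul_le_mul_of_nonneg_right (le_abs_self ν) h7.le
          have e5 := mul_nonneg (abs_nonneg ν) h6
          have e6 := mul_nonneg (by linarith : 0 ≤ R) h6
          have e7 := mul_nonneg (abs_nonneg ν) h7.le
          rw [e1]
          nlinarith
        have h9 := mul_nonneg (hS t h3).le h8
        linarith)
      (fun t ht => by
        have h5 := abs_le.1 (hXb t ht)
        have h4 := mul_le_mul_of_nonneg_left (hlogm t ht) (by positivity : 0 ≤ R + 1 + |ν|)
        show _ ≤ X t + (R + 1 + |ν|) * (Real.log (m t) + C * k t)
        linarith)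
    refine ⟨x - (R + 1 + |ν|) * Real.log ms, ?_⟩
    refine (hx.sub (hHlim.const_mul (R + 1 + |ν|))).congr fun t => ?_
    simp
  have hT'T : ∀ t ≤ T', t ≤ T := fun t ht => (hT' t ht).2
  obtain ⟨p, hp⟩ := key P 1 hPb fun t ht => by simpa using hPd t (hT'T t ht)
  obtain ⟨q, hq⟩ := key Q μ hQb fun t ht => hQd t (hT'T t ht)
  refine ⟨p, q, hp, hq, Or.inl ?_⟩
  have hD : Tendsto (fun t => k t + (1 - P t) ^ 2 + P t ^ 2 + Q t ^ 2) atBot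
      (𝓝 (0 + (1 - p) ^ 2 + p ^ 2 + q ^ 2)) :=
    ((hk0.add ((hp.const_sub 1).pow 2)).add (hp.pow 2)).add (hq.pow 2)
  have hD0 : 0 < 0 + (1 - p) ^ 2 + p ^ 2 + q ^ 2 := by nlinarith [sq_nonneg (2 * p - 1), sq_nonneg q]
  have hSlim : Tendsto S atBot (𝓝 (√(0 + (1 - p) ^ 2 + p ^ 2 + q ^ 2))⁻¹) := by
    refine (hD.sqrt.inv₀ (Real.sqrt_pos.2 hD0).ne').congr' ?_
    filter_upwards [eventually_le_atBot T] with t ht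
    have h1 := hSn t ht
    have h2 : k t + (1 - P t) ^ 2 + P t ^ 2 + Q t ^ 2 = (S t)⁻¹ ^ 2 := by
      have := (hS t ht).ne'
      field_simp; linarith
    rw [h2, Real.sqrt_sq (inv_pos.2 (hS t ht)).le, inv_inv]
  have hZlim : Tendsto Z atBot (𝓝 (0 + p ^ 2 + q ^ 2 - 1)) :=
    ((hk0.add (hp.pow 2)).add (hq.pow 2)).sub_const 1
  -- Both m and m' converge, so m' → 0. As m has a positive limit, Z → 0, which puts (p, q) on the
  -- unit circle.
  have hmlim' := limit_deriv_eq_zero_atBot hmd hmlim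
    (hSlim.mul (((((hZlim.const_mul 2).sub hk0).const_mul 2).mul hmlim).sub
      (hk0.mul ((hp.sub_const (1 / 2)).add ((hq.sub_const (μ / 2)).const_mul μ)))))
  have hSpos : 0 < (√(0 + (1 - p) ^ 2 + p ^ 2 + q ^ 2))⁻¹ := inv_pos.2 (Real.sqrt_pos.2 hD0)
  have := (mul_eq_zero.1 hmlim').resolve_left hSpos.ne'
  simp only [zero_mul, sub_zero, mul_eq_zero, hms.ne', or_false, OfNat.ofNat_ne_zero, false_or] at this
  linarith

theorem mem_critCurve_iff (p : Pt) :
    p ∈ critCurve ↔ surf p = 0 ∧ normSq p = 1 ∧ 0 < p.1 + p.2.1 := by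
  simp only [critCurve, Set.mem_ofPred_eq, mem_surfM_iff]
  constructor
  · rintro ⟨⟨h1, -, h2⟩, h3⟩; exact ⟨h1, h3, h2⟩
  · rintro ⟨h1, h2, h3⟩; exact ⟨⟨h1, h2.le, h3⟩, h2⟩

section

variable {lam : ℝ} {γ : ℝ → Pt}

/-- If `x₂ + x₃ → ∞` towards `-∞`, the orbit comes from the critical curve or from `P_lam`. -/
theorem exists_limit_of_slope_atTop (h : IsFlowLine lam γ) (hf : IsFinite γ)
    (hs : ∀ τ, surf (γ τ) ≤ 0) (hsl : Tendsto (fun t => slope (γ t)) atBot atTop) :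
    ∃ p, Tendsto γ atBot (𝓝 p) ∧ (p ∈ critCurve ∨ (6 < lam ^ 2 ∧ p = Plam lam)) := by
  set μ : ℝ := lam / √2 with hμ
  set S : ℝ → ℝ := fun t => (γ t).1 + (γ t).2.1 with hS
  obtain ⟨T, hT⟩ := eventually_atBot.1 (hsl.eventually (eventually_ge_atTop 2))
  have hw : ∀ t, 0 < 1 - normSq (γ t) := fun t => by linarith [hf t]
  have hSpos : ∀ t ≤ T, 0 < S t := fun t ht => by
    have h1 := hT t ht
    by_contra hcon
    have : slope (γ t) ≤ 0 :=
      div_nonpos_of_nonpos_of_nonneg (not_lt.1 hcon) (Real.sqrt_nonneg _)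
    linarith
  -- Projective coordinates k = 1/(x₂ + x₃)², P = x₃/(x₂ + x₃), Q = y₁/(x₂ + x₃). Infinity is k = 0,
  -- and slope ≥ 2 keeps k below the bound 1/2.
  set k : ℝ → ℝ := fun t => (1 - normSq (γ t)) / S t ^ 2 with hk
  have hkslope : ∀ t, k t = (slope (γ t) ^ 2)⁻¹ := fun t => by
    simp only [hk, slope, div_pow, inv_div, Real.sq_sqrt (hw t).le, hS]
  set P : ℝ → ℝ := fun t => (γ t).2.1 / S t with hP
  set Q : ℝ → ℝ := fun t => (γ t).2.2 / S t with hQ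
  have hZ : ∀ t ≤ T, k t + P t ^ 2 + Q t ^ 2 - 1 = -surf (γ t) / S t ^ 2 := fun t ht => by
    have := (hSpos t ht).ne'
    simp only [hk, hP, hQ]
    field_simp
    simp only [hS, normSq, surf]; ring
  have hk0 : Tendsto k atBot (𝓝 0) := by
    have h1 : Tendsto (fun t => slope (γ t) ^ 2) atBot atTop :=
      (tendsto_pow_atTop two_ne_zero).comp hsl
    exact (h1.inv_tendsto_atTop).congr fun t => (hkslope t).symm
  have hSd : ∀ t, HasDerivAt S (-((γ t).2.2 ^ 2 + (γ t).2.1 ^ 2 - surf (γ t))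
      - growth lam (γ t) * S t) t := fun t => hasDerivAt_sum h t
  obtain ⟨p, q, hp, hq, hpq⟩ := planar_limit (μ := μ) hSpos
    (fun t ht => div_pos (hw t) (pow_pos (hSpos t ht) 2))
    (fun t ht => by
      show k t ≤ 1 / 2
      rw [hkslope, inv_le_comm₀ (by nlinarith [hT t ht]) (by norm_num)]
      nlinarith [hT t ht])
    (fun t ht => by
      rw [hZ t ht]
      exact div_nonneg (by linarith [hs t]) (sq_nonneg _))
    (fun t ht => by
      have := (hSpos t ht).ne'
      simp only [hP, hQ]
      field_simp
      simp only [hS, normSq]; ring)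
    (fun t ht => by
      have hne := (hSpos t ht).ne'
      refine ((hasDerivAt_normSq h t).div ((hSd t).pow 2) (pow_ne_zero 2 hne)).congr_deriv ?_
      rw [hZ t ht]
      have e : surf (γ t) = -(1 - normSq (γ t)) - (γ t).2.1 ^ 2 - (γ t).2.2 ^ 2 + S t ^ 2 := by
        simp only [surf, normSq, hS]; ring
      simp only [Pi.pow_apply]
      field_simp
      rw [e]
      push_cast
      ring)
    (fun t ht => by
      have hne := (hSpos t ht).ne'
      refine ((h.hasDerivAt_snd t).div (hSd t) hne).congr_deriv ?_
      have e : surf (γ t) = -(1 - normSq (γ t)) - (γ t).2.1 ^ 2 - (γ t).2.2 ^ 2 + S t ^ 2 := by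
        simp only [surf, normSq, hS]; ring
      rw [hZ t ht]
      simp only [hP]
      rw [show (γ t).1 + (γ t).2.1 = S t from rfl]
      field_simp
      rw [e]
      ring)
    (fun t ht => by
      have hne := (hSpos t ht).ne'
      refine ((h.hasDerivAt_trd t).div (hSd t) hne).congr_deriv ?_
      have e : surf (γ t) = -(1 - normSq (γ t)) - (γ t).2.1 ^ 2 - (γ t).2.2 ^ 2 + S t ^ 2 := by
        simp only [surf, normSq, hS]; ring
      rw [hZ t ht]
      simp only [hQ]
      rw [show (γ t).1 + (γ t).2.1 = S t from rfl, ← hμ]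
      generalize μ = μ
      field_simp
      rw [e]
      ring) hk0
  set D : ℝ := (1 - p) ^ 2 + p ^ 2 + q ^ 2 with hD
  have hD0 : 0 < D := by nlinarith [sq_nonneg (2 * p - 1), sq_nonneg q]
  set s : ℝ := (√D)⁻¹ with hs'
  have hs0 : 0 < s := inv_pos.2 (Real.sqrt_pos.2 hD0)
  have hsD : s ^ 2 * D = 1 := by
    rw [hs', inv_pow, Real.sq_sqrt hD0.le, inv_mul_cancel₀ hD0.ne']
  have hSlim : Tendsto S atBot (𝓝 s) := by
    have hD' : Tendsto (fun t => k t + (1 - P t) ^ 2 + P t ^ 2 + Q t ^ 2) atBot (𝓝 D) := by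
      have := ((hk0.add ((hp.const_sub 1).pow 2)).add (hp.pow 2)).add (hq.pow 2)
      rwa [zero_add] at this
    refine (hD'.sqrt.inv₀ (Real.sqrt_pos.2 hD0).ne').congr' ?_
    filter_upwards [eventually_le_atBot T] with t ht
    have hne := hSpos t ht
    have h2 : k t + (1 - P t) ^ 2 + P t ^ 2 + Q t ^ 2 = (S t)⁻¹ ^ 2 := by
      have := hne.ne'
      simp only [hk, hP, hQ]
      field_simp
      simp only [hS, normSq]; ring
    rw [h2, Real.sqrt_sq (inv_pos.2 hne).le, inv_inv]
  have hlim : Tendsto γ atBot (𝓝 (s * (1 - p), s * p, s * q)) := by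
    refine tendsto_pt ?_ ?_ ?_
    · refine (hSlim.mul (hp.const_sub 1)).congr' ?_
      filter_upwards [eventually_le_atBot T] with t ht
      have := (hSpos t ht).ne'
      simp only [hP]; field_simp
      simp [hS]
    · refine (hSlim.mul hp).congr' ?_
      filter_upwards [eventually_le_atBot T] with t ht
      have := (hSpos t ht).ne'
      simp only [hP]; field_simp
    · refine (hSlim.mul hq).congr' ?_
      filter_upwards [eventually_le_atBot T] with t ht
      have := (hSpos t ht).ne'
      simp only [hQ]; field_simp
  refine ⟨_, hlim, ?_⟩
  have hn1 : normSq (s * (1 - p), s * p, s * q) = 1 := by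
    refine Eq.trans ?_ hsD; simp only [normSq, hD]; ring
  have hsf : surf (s * (1 - p), s * p, s * q) ≤ 0 :=
    le_of_tendsto' ((continuous_surf.tendsto _).comp hlim) hs
  have hsf' : surf (s * (1 - p), s * p, s * q) = -(s ^ 2 * (p ^ 2 + q ^ 2 - 1)) := by
    have : surf (s * (1 - p), s * p, s * q) = s ^ 2 * ((1 - p) ^ 2 + 1) - 1 := by
      simp only [surf]; ring
    rw [this]; simp only [hD] at hsD; linarith
  rw [mem_critCurve_iff]
  -- A limit with surf = 0 is on the critical curve. With surf < 0 the circle is excluded, and the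
  -- centre requires 1/4 + μ²/4 > 1, that is λ² > 6.
  rcases hsf.eq_or_lt with h0 | h0
  · exact Or.inl ⟨h0, hn1, by show 0 < s * (1 - p) + s * p; nlinarith⟩
  · right
    rcases hpq with h1 | ⟨rfl, rfl⟩
    · rw [hsf', h1] at h0; simp at h0
    · have hμ2 : μ ^ 2 = lam ^ 2 / 2 := by rw [hμ, div_pow, Real.sq_sqrt zero_le_two]
      have hD8 : D = (lam ^ 2 + 4) / 8 := by rw [hD]; nlinarith
      refine ⟨?_, ?_⟩
      · rw [hsf'] at h0
        have : 0 < (1 / 2 : ℝ) ^ 2 + (μ / 2) ^ 2 - 1 := by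
          by_contra hcon
          nlinarith [mul_nonneg (sq_nonneg s) (by linarith : 0 ≤ -((1 / 2 : ℝ) ^ 2 + (μ / 2) ^ 2 - 1))]
        nlinarith
      · have h22 : (√2 : ℝ) ^ 2 = 2 := Real.sq_sqrt zero_le_two
        have hs2 : s / 2 = √2 / √(lam ^ 2 + 4) := by
          have h8 : √(8 : ℝ) = 2 * √2 := by
            rw [show (8 : ℝ) = 2 ^ 2 * 2 by norm_num, Real.sqrt_mul (by norm_num),
              Real.sqrt_sq (by norm_num)]
          rw [hs', hD8, Real.sqrt_div (by positivity), h8]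
          have : √(lam ^ 2 + 4) ≠ 0 := (Real.sqrt_pos.2 (by positivity)).ne'
          field_simp
        have e1 : s * (1 - 1 / 2) = √2 / √(lam ^ 2 + 4) := by rw [← hs2]; ring
        have e2 : s * (1 / 2) = √2 / √(lam ^ 2 + 4) := by rw [← hs2]; ring
        have e3 : s * (μ / 2) = lam / √(lam ^ 2 + 4) := by
          rw [show s * (μ / 2) = s / 2 * μ by ring, hs2, hμ]
          field_simp
        simp only [Plam, e1, e2, e3]

/-- A monotone slope is either bounded or tends to +∞ towards -∞; the two cases are the two
preceding results. -/
theorem exists_limit_atBot (h : IsFlowLine lam γ) (hf : IsFinite γ) (hs : ∀ τ, surf (γ τ) ≤ 0) :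
    Tendsto γ atBot (𝓝 PM) ∨ Tendsto γ atBot (𝓝 PMbar) ∨
      ∃ p, Tendsto γ atBot (𝓝 p) ∧ (p ∈ critCurve ∨ (6 < lam ^ 2 ∧ p = Plam lam)) := by
  by_cases hC : ∃ C, ∀ τ, slope (γ τ) ≤ C
  · obtain ⟨C, hC⟩ := hC
    have := tendsto_minkowski_of_slope_le h hf hs hC
    tauto
  · push Not at hC
    refine Or.inr (Or.inr (exists_limit_of_slope_atTop h hf hs ?_))
    refine tendsto_atBot_atTop.2 fun C => ?_
    obtain ⟨τ, hτ⟩ := hC C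
    exact ⟨τ, fun t ht => hτ.le.trans (antitone_slope h hf hs ht)⟩

end

/-! ### Behaviour at the Minkowski points and on the critical curve -/

theorem inv_sqrt_two_sq : (1 / √2 : ℝ) ^ 2 = 1 / 2 := by
  rw [div_pow, Real.sq_sqrt zero_le_two, one_pow]

theorem inv_sqrt_two_pos : (0 : ℝ) < 1 / √2 := by positivity

theorem growth_PM (lam : ℝ) : growth lam PM = 0 := by simp [growth, PM]

theorem surf_PM : surf PM = 0 := by
  simp only [surf, PM]; linarith [inv_sqrt_two_sq]

theorem normSq_PM : normSq PM = 1 / 2 := by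
  simp only [normSq, PM]; linarith [inv_sqrt_two_sq]

theorem neg_PM : -PM = PMbar := by simp [PM, PMbar]

theorem neg_PMbar : -PMbar = PM := by rw [← neg_PM, neg_neg]

theorem neg_PH : -PH = PHbar := by simp [PH, PHbar]

theorem neg_PHbar : -PHbar = PH := by rw [← neg_PH, neg_neg]

theorem neg_Plam (lam : ℝ) : -Plam lam = PlamBar lam := by simp [Plam, PlamBar]

theorem mem_critCurveBar_iff_neg (p : Pt) : p ∈ critCurveBar ↔ -p ∈ critCurve := by
  simp only [critCurve, critCurveBar, Set.mem_ofPred_eq, mem_surfMbar_iff_neg, normSq_neg]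

/-- Away from the invariant surface no orbit tends to `P_M`. -/
theorem not_tendsto_PM_atTop {lam : ℝ} {γ : ℝ → Pt} (h : IsFlowLine lam γ)
    (hs : ∀ τ, surf (γ τ) < 0) : ¬ Tendsto γ atTop (𝓝 PM) := fun hlim => by
  have hg : Tendsto (fun τ => 2 * ((γ τ).1 - lam / √2 * (γ τ).2.2 - growth lam (γ τ))) atTop
      (𝓝 (2 * (PM.1 - lam / √2 * PM.2.2 - growth lam PM))) := by
    have : Continuous fun p : Pt => 2 * (p.1 - lam / √2 * p.2.2 - growth lam p) := by
      have := continuous_growth lam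
      fun_prop
    exact (this.tendsto PM).comp hlim
  -- The linear rate of `surf` at P_M is √2, so a negative value is driven away from 0.
  have hpos : 0 < 2 * (PM.1 - lam / √2 * PM.2.2 - growth lam PM) := by
    rw [growth_PM]; simp [PM]
  obtain ⟨T, hT⟩ := eventually_atTop.1 (hg.eventually (lt_mem_nhds hpos))
  have hanti := antitoneOn_Ici_of_hasDerivAt (T := T) (fun t _ => hasDerivAt_surf h t)
    (fun t ht => mul_nonpos_of_nonneg_of_nonpos (hT t ht).le (hs t).le)
  have hI : Tendsto (fun t => surf (γ t)) atTop (𝓝 0) := by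
    rw [← surf_PM]; exact (continuous_surf.tendsto _).comp hlim
  have := le_of_tendsto hI ((eventually_ge_atTop T).mono fun t ht =>
    hanti (Set.mem_Ici.2 le_rfl) ht ht)
  linarith [hs T]

theorem tendsto_neg_of_atBot {γ : ℝ → Pt} {p : Pt} (h : Tendsto γ atBot (𝓝 p)) :
    Tendsto (fun τ => -γ (-τ)) atTop (𝓝 (-p)) := (h.comp tendsto_neg_atTop_atBot).neg

theorem tendsto_neg_of_atTop {γ : ℝ → Pt} {p : Pt} (h : Tendsto γ atTop (𝓝 p)) :
    Tendsto (fun τ => -γ (-τ)) atBot (𝓝 (-p)) := (h.comp tendsto_neg_atBot_atTop).neg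

theorem not_tendsto_PMbar_atBot {lam : ℝ} {γ : ℝ → Pt} (h : IsFlowLine lam γ)
    (hs : ∀ τ, surf (γ τ) < 0) : ¬ Tendsto γ atBot (𝓝 PMbar) := fun hlim =>
  not_tendsto_PM_atTop h.neg (fun τ => by rw [surf_neg]; exact hs _)
    (by have := tendsto_neg_of_atBot hlim; rwa [neg_PMbar] at this)

/-- On the invariant surface, the growth rate depends on `X₂ + X₃` and the distance to infinity. -/
theorem growth_of_surf_eq_zero (lam : ℝ) {p : Pt} (h : surf p = 0) :
    growth lam p = -(p.1 + p.2.1) + (2 * p.1 + p.2.1) * (1 - normSq p) := by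
  have e : growth lam p = -(p.1 + p.2.1) + (2 * p.1 + p.2.1) * (1 - normSq p)
      + (lam / √2 * p.2.2 + p.1 + p.2.1) * surf p := by
    simp only [growth, surf, normSq]; ring
  rw [e, h]; ring

/-- On the closed invariant surface `M` the radius does not decrease. -/
theorem fst_nonneg_of_mem_surfM {p : Pt} (h : p ∈ surfM) : 0 ≤ p.1 := by
  rw [mem_surfM_iff] at h
  obtain ⟨h1, h2, h3⟩ := h
  simp only [surf] at h1
  simp only [normSq] at h2
  by_contra hcon
  push Not at hcon
  nlinarith [sq_nonneg p.2.2, mul_pos_of_neg_of_neg hcon hcon]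

theorem eq_PH_of_mem_critCurve {p : Pt} (h : p ∈ critCurve) (h0 : p.1 = 0) : p = PH := by
  rw [mem_critCurve_iff] at h
  obtain ⟨h1, h2, h3⟩ := h
  simp only [surf, h0] at h1
  simp only [normSq, h0] at h2
  rw [h0] at h3
  have hb : p.2.1 = 1 := by nlinarith
  have hy : p.2.2 = 0 := by rw [hb] at h2; nlinarith
  ext <;> simp [PH, h0, hb, hy]

theorem growth_PH (lam : ℝ) : growth lam PH = -1 := by simp [growth, PH, surf]

/-! ### From the field equations to the compactified system and back. -/

theorem contDiff_succ_of_hasDerivAt {f f' : ℝ → ℝ} (n : ℕ) (hf : ∀ t, HasDerivAt f (f' t) t)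
    (hf' : ContDiff ℝ n f') : ContDiff ℝ (n + 1) f := by
  rw [contDiff_succ_iff_deriv]
  refine ⟨fun t => (hf t).differentiableAt, fun h => ?_, ?_⟩
  · exact absurd h (by simp)
  · rwa [show deriv f = f' from funext fun t => (hf t).deriv]

theorem deriv_expPotential (V0 lam ψ : ℝ) :
    deriv (expPotential V0 lam) ψ = -lam * expPotential V0 lam ψ := by
  have h : HasDerivAt (expPotential V0 lam) (V0 * (Real.exp (-lam * ψ) * (-lam * 1))) ψ :=
    (((hasDerivAt_id ψ).const_mul (-lam)).exp).const_mul V0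
  rw [h.deriv, expPotential]; ring

namespace Config

variable {S : Config}

theorem hat_eq_of_hasDerivAt {f : ℝ → ℝ} {f' τ : ℝ} (h : HasDerivAt f f' τ) :
    S.hat f τ = f' / S.density τ := by rw [hat, h.deriv]

theorem hasDerivAt_hat {f : ℝ → ℝ} {τ : ℝ} (hd : 0 < S.density τ) (hf : DifferentiableAt ℝ f τ) :
    HasDerivAt f (S.density τ * S.hat f τ) τ := by
  rw [hat, mul_div_cancel₀ _ hd.ne']; exact hf.hasDerivAt

theorem sqrt_gaussK {τ : ℝ} (hr : 0 < S.radius τ) : √(S.gaussK τ) = 1 / S.radius τ := by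
  rw [gaussK, Real.sqrt_div zero_le_one, Real.sqrt_sq hr.le, Real.sqrt_one]

theorem x2_eq {τ : ℝ} (hr : 0 < S.radius τ) : S.x2 τ = S.hat S.radius τ := by
  rw [x2, sqrt_gaussK hr, sheetExp]
  field_simp

theorem x3_eq {τ : ℝ} (hr : 0 < S.radius τ) : S.x3 τ = S.radius τ * S.accel τ := by
  rw [x3, sqrt_gaussK hr]
  field_simp

theorem y1_eq {τ : ℝ} (hr : 0 < S.radius τ) : S.y1 τ = S.radius τ * S.scalarHat τ / √2 := by
  rw [y1, Real.sqrt_mul zero_le_two, sqrt_gaussK hr]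
  field_simp

namespace IsSolution

variable {V : ℝ → ℝ} (h : S.IsSolution V)

include h

theorem differentiableAt_hat {f : ℝ → ℝ} (hf : ContDiff ℝ 2 f) (τ : ℝ) :
    DifferentiableAt ℝ (S.hat f) τ := by
  have h1 : ContDiff ℝ 1 (deriv f) := by
    have : ContDiff ℝ (1 + 1) f := by simpa [one_add_one_eq_two] using hf
    exact (contDiff_succ_iff_deriv.1 this).2.2
  exact (h1.differentiable one_ne_zero τ).div (h.density_smooth.differentiable one_ne_zero τ)
    (h.density_pos τ).ne'

theorem hasDerivAt_radius (τ : ℝ) :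
    HasDerivAt S.radius (S.density τ / S.radius τ * S.x2 τ * S.radius τ) τ := by
  have hr := h.radius_pos τ
  refine (hasDerivAt_hat (h.density_pos τ)
    (h.radius_smooth.differentiable two_ne_zero τ)).congr_deriv ?_
  rw [x2_eq hr]; field_simp

theorem hasDerivAt_lapse (τ : ℝ) :
    HasDerivAt S.lapse (S.density τ / S.radius τ * S.x3 τ * S.lapse τ) τ := by
  have hr := h.radius_pos τ
  have hN := h.lapse_pos τ
  refine (hasDerivAt_hat (h.density_pos τ)
    (h.lapse_smooth.differentiable two_ne_zero τ)).congr_deriv ?_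
  rw [x3_eq hr, accel]; field_simp

theorem hasDerivAt_scalar (τ : ℝ) :
    HasDerivAt S.scalar (S.density τ / S.radius τ * (√2 * S.y1 τ)) τ := by
  have hr := h.radius_pos τ
  refine (hasDerivAt_hat (h.density_pos τ)
    (h.scalar_smooth.differentiable two_ne_zero τ)).congr_deriv ?_
  rw [y1_eq hr, scalarHat]; field_simp

theorem gauss (τ : ℝ) : S.radius τ ^ 2 * V (S.scalar τ)
    = 1 + S.y1 τ ^ 2 - S.x2 τ ^ 2 - 2 * S.x2 τ * S.x3 τ := by
  have hr := h.radius_pos τ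
  have hg := h.gauss_eq τ
  have h2 : (√2 : ℝ) ^ 2 = 2 := Real.sq_sqrt zero_le_two
  rw [x2_eq hr, x3_eq hr, y1_eq hr, div_pow, h2]
  rw [gaussK, sheetExp] at hg
  field_simp at hg ⊢
  linarith

theorem hasDerivAt_x2 (τ : ℝ) : HasDerivAt S.x2
    (S.density τ / S.radius τ * (S.x2 τ * S.x3 τ - S.y1 τ ^ 2)) τ := by
  have hr := h.radius_pos τ
  have hd := h.density_pos τ
  have h2 : (√2 : ℝ) ^ 2 = 2 := Real.sq_sqrt zero_le_two
  have hfun : S.x2 = fun t => S.radius t * S.sheetExp t / 2 := funext fun t => by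
    rw [x2, sqrt_gaussK (h.radius_pos t)]; field_simp
  have hrad := hasDerivAt_hat hd (h.radius_smooth.differentiable two_ne_zero τ)
  have hφ : DifferentiableAt ℝ S.sheetExp τ := by
    have := ((h.differentiableAt_hat h.radius_smooth τ).const_mul 2).div
      (h.radius_smooth.differentiable two_ne_zero τ) hr.ne'
    exact this
  have key := (hrad.mul (hasDerivAt_hat hd hφ)).div_const 2
  rw [h.sheetExp_eq, weyl] at key
  have key' := key.congr_of_eventuallyEq (f₁ := S.x2) (Eventually.of_forall (congrFun hfun))
  refine key'.congr_deriv ?_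
  rw [x2_eq hr, x3_eq hr, y1_eq hr, div_pow, mul_pow, h2, sheetExp]
  field_simp
  ring

theorem hasDerivAt_x3 (τ : ℝ) : HasDerivAt S.x3
    (S.density τ / S.radius τ * (-((S.x2 τ + S.x3 τ) * S.x3 τ)
      - S.radius τ ^ 2 * V (S.scalar τ))) τ := by
  have hr := h.radius_pos τ
  have hd := h.density_pos τ
  have hfun : S.x3 = fun t => S.radius t * S.accel t := funext fun t => x3_eq (h.radius_pos t)
  have hrad := hasDerivAt_hat hd (h.radius_smooth.differentiable two_ne_zero τ)
  have hA : DifferentiableAt ℝ S.accel τ :=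
    (h.differentiableAt_hat h.lapse_smooth τ).div
      (h.lapse_smooth.differentiable two_ne_zero τ) (h.lapse_pos τ).ne'
  have key := hrad.mul (hasDerivAt_hat hd hA)
  rw [h.accel_eq] at key
  have key' := key.congr_of_eventuallyEq (f₁ := S.x3) (Eventually.of_forall (congrFun hfun))
  refine key'.congr_deriv ?_
  rw [x2_eq hr, x3_eq hr, sheetExp]
  field_simp
  ring

theorem hasDerivAt_y1 (τ : ℝ) : HasDerivAt S.y1
    (S.density τ / S.radius τ * (-((S.x2 τ + S.x3 τ) * S.y1 τ)
      + S.radius τ ^ 2 * deriv V (S.scalar τ) / √2)) τ := by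
  have hr := h.radius_pos τ
  have hd := h.density_pos τ
  have hfun : S.y1 = fun t => S.radius t * S.scalarHat t / √2 :=
    funext fun t => y1_eq (h.radius_pos t)
  have hrad := hasDerivAt_hat hd (h.radius_smooth.differentiable two_ne_zero τ)
  have hΨ : DifferentiableAt ℝ S.scalarHat τ := h.differentiableAt_hat h.scalar_smooth τ
  have key := (hrad.mul (hasDerivAt_hat hd hΨ)).div_const √2
  rw [h.scalar_eq] at key
  have key' := key.congr_of_eventuallyEq (f₁ := S.y1) (Eventually.of_forall (congrFun hfun))
  refine key'.congr_deriv ?_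
  rw [x2_eq hr, x3_eq hr, y1_eq hr, sheetExp]
  field_simp
  ring

end IsSolution

/-- The metric and the scalar field in terms of an orbit of the compactified system. -/
structure Traces (S : Config) (V0 lam : ℝ) (γ : ℝ → Pt) : Prop where
  radius_pos : ∀ τ, 0 < S.radius τ
  lapse_pos : ∀ τ, 0 < S.lapse τ
  radius_deriv : ∀ τ, HasDerivAt S.radius ((γ τ).1 * S.radius τ) τ
  lapse_deriv : ∀ τ, HasDerivAt S.lapse ((γ τ).2.1 * S.lapse τ) τ
  scalar_deriv : ∀ τ, HasDerivAt S.scalar (√2 * (γ τ).2.2) τ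
  density_eq : ∀ τ, S.density τ = S.radius τ * √(1 - normSq (γ τ))
  potential : ∀ τ, expPotential V0 lam (S.scalar τ) * S.radius τ ^ 2 * (1 - normSq (γ τ))
    = -surf (γ τ)

section Forward

variable {V0 lam : ℝ} {γ : ℝ → Pt}

/-- One common denominator D makes the later identities between (x₂, x₃, y₁) and γ rational in D. -/
theorem Realizes.scale (h : S.Realizes V0 lam γ) (τ : ℝ) :
    ∃ D > 0, D ^ 2 = 1 + S.x2 τ ^ 2 + S.x3 τ ^ 2 + S.y1 τ ^ 2 ∧
      D = √(1 + S.x2 τ ^ 2 + S.x3 τ ^ 2 + S.y1 τ ^ 2) ∧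
      γ τ = (S.x2 τ / D, S.x3 τ / D, S.y1 τ / D) ∧ 1 - normSq (γ τ) = 1 / D ^ 2 ∧
      S.density τ = S.radius τ / D := by
  have hpos : 0 < 1 + S.x2 τ ^ 2 + S.x3 τ ^ 2 + S.y1 τ ^ 2 := by positivity
  have hD := Real.sq_sqrt hpos.le
  have hD0 := Real.sqrt_pos.2 hpos
  have hγ := (h.2.2 τ).symm
  have hn : 1 - normSq (γ τ) = 1 / √(1 + S.x2 τ ^ 2 + S.x3 τ ^ 2 + S.y1 τ ^ 2) ^ 2 := by
    rw [hγ]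
    simp only [poincare, normSq]
    have := hD0.ne'
    field_simp
    rw [hD]; ring
  refine ⟨_, hD0, hD, rfl, hγ, hn, ?_⟩
  rw [h.2.1 τ, h.2.2 τ, hn, sqrt_gaussK (h.1.radius_pos τ), Real.sqrt_div zero_le_one,
    Real.sqrt_sq hD0.le, Real.sqrt_one]
  have := (h.1.radius_pos τ).ne'
  field_simp

theorem Realizes.isFinite (h : S.Realizes V0 lam γ) : IsFinite γ := fun τ => by
  obtain ⟨D, hD0, -, -, -, hn, -⟩ := h.scale τ
  have : 0 < 1 / D ^ 2 := by positivity
  linarith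

theorem Realizes.potential (h : S.Realizes V0 lam γ) (τ : ℝ) :
    expPotential V0 lam (S.scalar τ) * S.radius τ ^ 2 * (1 - normSq (γ τ)) = -surf (γ τ) := by
  obtain ⟨D, hD0, hD, -, hγ, hn, -⟩ := h.scale τ
  have hg := h.1.gauss τ
  rw [hn, mul_comm (expPotential _ _ _), hg, hγ]
  simp only [surf]
  field_simp
  rw [hD]; ring

theorem Realizes.isFlowLine (h : S.Realizes V0 lam γ) : IsFlowLine lam γ := fun τ => by
  obtain ⟨D, hD0, hD, hDdef, hγ, hn, hdens⟩ := h.scale τ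
  have hr := (h.1.radius_pos τ).ne'
  have hdr : S.density τ / S.radius τ = 1 / D := by rw [hdens]; field_simp
  have h1 := h.1.hasDerivAt_x2 τ
  have h2 := h.1.hasDerivAt_x3 τ
  have h3 := h.1.hasDerivAt_y1 τ
  rw [deriv_expPotential] at h3
  have hz : S.radius τ ^ 2 * expPotential V0 lam (S.scalar τ) = -surf (γ τ) * D ^ 2 := by
    rw [← h.potential τ, hn]; field_simp
  rw [mul_left_comm, hz] at h3
  rw [hz] at h2
  rw [hdr] at h1 h2 h3
  have hpos : 0 < 1 + S.x2 τ ^ 2 + S.x3 τ ^ 2 + S.y1 τ ^ 2 := by positivity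
  have hDd := ((((h1.pow 2).const_add 1).add (h2.pow 2)).add (h3.pow 2)).sqrt hpos.ne'
  have ha : S.x2 τ = (γ τ).1 * D := by rw [hγ]; field_simp
  have hb : S.x3 τ = (γ τ).2.1 * D := by rw [hγ]; field_simp
  have hy : S.y1 τ = (γ τ).2.2 * D := by rw [hγ]; field_simp
  -- This identifies `growth` as the logarithmic derivative of D; the quotient rule then produces
  -- the compactified field.
  have hDd' : HasDerivAt (fun t => √(1 + S.x2 t ^ 2 + S.x3 t ^ 2 + S.y1 t ^ 2))
      (growth lam (γ τ) * D) τ := by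
    refine hDd.congr_deriv ?_
    simp only [Pi.add_apply, Pi.pow_apply]
    rw [← hDdef, ha, hb, hy]
    simp only [growth, surf]
    push_cast
    field_simp
    ring
  have hfun : γ = fun t => (S.x2 t / √(1 + S.x2 t ^ 2 + S.x3 t ^ 2 + S.y1 t ^ 2),
      S.x3 t / √(1 + S.x2 t ^ 2 + S.x3 t ^ 2 + S.y1 t ^ 2),
      S.y1 t / √(1 + S.x2 t ^ 2 + S.x3 t ^ 2 + S.y1 t ^ 2)) := funext fun t => (h.2.2 t).symm
  have hne : √(1 + S.x2 τ ^ 2 + S.x3 τ ^ 2 + S.y1 τ ^ 2) ≠ 0 := (Real.sqrt_pos.2 hpos).ne'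
  have key := (h1.div hDd' hne).prodMk ((h2.div hDd' hne).prodMk (h3.div hDd' hne))
  have key' := key.congr_of_eventuallyEq (f₁ := γ) (Eventually.of_forall (congrFun hfun))
  refine key'.congr_deriv ?_
  rw [← hDdef, ha, hb, hy]
  ext
  · rw [field_fst]; simp only; field_simp
  · rw [field_snd]; simp only; field_simp; ring
  · rw [field_trd]; simp only; field_simp

theorem Realizes.traces (h : S.Realizes V0 lam γ) : S.Traces V0 lam γ where
  radius_pos := h.1.radius_pos
  lapse_pos := h.1.lapse_pos
  radius_deriv τ := by
    obtain ⟨D, hD0, hD, hDdef, hγ, hn, hdens⟩ := h.scale τ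
    have hr := (h.1.radius_pos τ).ne'
    refine (h.1.hasDerivAt_radius τ).congr_deriv ?_
    rw [hdens, hγ]; simp only; field_simp
  lapse_deriv τ := by
    obtain ⟨D, hD0, hD, hDdef, hγ, hn, hdens⟩ := h.scale τ
    have hr := (h.1.radius_pos τ).ne'
    refine (h.1.hasDerivAt_lapse τ).congr_deriv ?_
    rw [hdens, hγ]; simp only; field_simp
  scalar_deriv τ := by
    obtain ⟨D, hD0, hD, hDdef, hγ, hn, hdens⟩ := h.scale τ
    have hr := (h.1.radius_pos τ).ne'
    refine (h.1.hasDerivAt_scalar τ).congr_deriv ?_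
    rw [hdens, hγ]; simp only; field_simp
  density_eq τ := by
    obtain ⟨D, hD0, hD, hDdef, hγ, hn, hdens⟩ := h.scale τ
    rw [hdens, hn, Real.sqrt_div zero_le_one, Real.sqrt_sq hD0.le, Real.sqrt_one]; ring
  potential := h.potential

end Forward

namespace Traces

variable {V0 lam : ℝ} {γ : ℝ → Pt} (h : S.Traces V0 lam γ)

include h

theorem density_pos (hf : IsFinite γ) (τ : ℝ) : 0 < S.density τ := by
  rw [h.density_eq]
  exact mul_pos (h.radius_pos τ) (Real.sqrt_pos.2 (by linarith [hf τ]))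

theorem hasDerivAt_density (hγ : IsFlowLine lam γ) (hf : IsFinite γ) (τ : ℝ) :
    HasDerivAt S.density (((γ τ).1 - growth lam (γ τ)) * S.density τ) τ := by
  rw [show S.density = fun t => S.radius t * √(1 - normSq (γ t)) from funext h.density_eq]
  exact ((h.radius_deriv τ).mul (hasDerivAt_sqrt hγ hf τ)).congr_deriv (by ring)

theorem hat_radius (τ : ℝ) : S.hat S.radius τ = (γ τ).1 / √(1 - normSq (γ τ)) := by
  rw [hat_eq_of_hasDerivAt (h.radius_deriv τ), h.density_eq]
  have := (h.radius_pos τ).ne'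
  field_simp

theorem sheetExp_eq (τ : ℝ) : S.sheetExp τ = 2 * ((γ τ).1 / S.density τ) := by
  rw [sheetExp, h.hat_radius, h.density_eq]
  have := (h.radius_pos τ).ne'
  field_simp

theorem accel_eq (τ : ℝ) : S.accel τ = (γ τ).2.1 / S.density τ := by
  rw [accel, hat_eq_of_hasDerivAt (h.lapse_deriv τ)]
  have := (h.lapse_pos τ).ne'
  field_simp

theorem scalarHat_eq (τ : ℝ) : S.scalarHat τ = √2 * ((γ τ).2.2 / S.density τ) := by
  rw [scalarHat, hat_eq_of_hasDerivAt (h.scalar_deriv τ)]; ring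

/-- The identity `potential` amounts to V = -surf / density². With it each propagation equation
becomes one component of the flow, and the Gauss equation becomes the definition of `surf`. -/
theorem isSolution (hγ : IsFlowLine lam γ) (hf : IsFinite γ) :
    S.IsSolution (expPotential V0 lam) := by
  have hd := h.density_pos hf
  have hdd := h.hasDerivAt_density hγ hf
  have h2 : (√2 : ℝ) ^ 2 = 2 := Real.sq_sqrt zero_le_two
  have hV : ∀ τ, expPotential V0 lam (S.scalar τ) = -surf (γ τ) / S.density τ ^ 2 := fun τ => by
    rw [eq_div_iff (pow_pos (hd τ) 2).ne', ← h.potential τ, h.density_eq, mul_pow,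
      Real.sq_sqrt (by linarith [hf τ]), mul_assoc]
  have hcγ := hγ.continuous
  have hcr : Continuous S.radius :=
    continuous_iff_continuousAt.2 fun τ => (h.radius_deriv τ).continuousAt
  have hcN : Continuous S.lapse :=
    continuous_iff_continuousAt.2 fun τ => (h.lapse_deriv τ).continuousAt
  have hcd : Continuous S.density := continuous_iff_continuousAt.2 fun τ => (hdd τ).continuousAt
  have hcg := continuous_growth lam
  have hcf := continuous_field lam
  have hγ1 : ContDiff ℝ 1 fun t => (γ t).1 := by
    have := contDiff_succ_of_hasDerivAt 0 (fun τ => hγ.hasDerivAt_fst τ)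
      (contDiff_zero.2 (by fun_prop))
    simpa using this
  have hγ2 : ContDiff ℝ 1 fun t => (γ t).2.1 := by
    have hcs := continuous_surf
    have := contDiff_succ_of_hasDerivAt 0 (fun τ => hγ.hasDerivAt_snd τ)
      (contDiff_zero.2 (by fun_prop))
    simpa using this
  have hγ3 : ContDiff ℝ 1 fun t => (γ t).2.2 := by
    have hcs := continuous_surf
    have := contDiff_succ_of_hasDerivAt 0 (fun τ => hγ.hasDerivAt_trd τ)
      (contDiff_zero.2 (by fun_prop))
    simpa using this
  have hr1 : ContDiff ℝ 1 S.radius := by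
    have := contDiff_succ_of_hasDerivAt 0 h.radius_deriv (contDiff_zero.2 (by fun_prop))
    simpa using this
  have hN1 : ContDiff ℝ 1 S.lapse := by
    have := contDiff_succ_of_hasDerivAt 0 h.lapse_deriv (contDiff_zero.2 (by fun_prop))
    simpa using this
  refine ⟨?_, ?_, ?_, ?_, h.radius_pos, h.lapse_pos, hd, fun τ => ?_, fun τ => ?_, fun τ => ?_,
    fun τ => ?_⟩
  · have := contDiff_succ_of_hasDerivAt 1 h.radius_deriv (by exact_mod_cast hγ1.mul hr1)
    simpa [one_add_one_eq_two] using this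
  · have := contDiff_succ_of_hasDerivAt 1 h.lapse_deriv (by exact_mod_cast hγ2.mul hN1)
    simpa [one_add_one_eq_two] using this
  · have := contDiff_succ_of_hasDerivAt 1 h.scalar_deriv
      (by exact_mod_cast contDiff_const.mul hγ3)
    simpa [one_add_one_eq_two] using this
  · have := contDiff_succ_of_hasDerivAt 0 hdd (contDiff_zero.2 (by fun_prop))
    simpa using this
  · have hne := (hd τ).ne'
    have key := ((hγ.hasDerivAt_fst τ).div (hdd τ) hne).const_mul 2
    have key' := key.congr_of_eventuallyEq (f₁ := S.sheetExp) (Eventually.of_forall h.sheetExp_eq)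
    rw [hat_eq_of_hasDerivAt key', weyl, h.sheetExp_eq, h.accel_eq, h.scalarHat_eq, hV, mul_pow √2, h2]
    field_simp; ring
  · have hne := (hd τ).ne'
    have key := (hγ.hasDerivAt_snd τ).div (hdd τ) hne
    have key' := key.congr_of_eventuallyEq (f₁ := S.accel) (Eventually.of_forall h.accel_eq)
    rw [hat_eq_of_hasDerivAt key', h.sheetExp_eq, h.accel_eq, hV]
    field_simp; ring
  · have hne := (hd τ).ne'
    have key := ((hγ.hasDerivAt_trd τ).div (hdd τ) hne).const_mul √2
    have key' := key.congr_of_eventuallyEq (f₁ := S.scalarHat)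
      (Eventually.of_forall h.scalarHat_eq)
    rw [hat_eq_of_hasDerivAt key', h.sheetExp_eq, h.accel_eq, h.scalarHat_eq, deriv_expPotential, hV]
    field_simp; ring
  · have hne := (hd τ).ne'
    have hr := (h.radius_pos τ).ne'
    rw [h.sheetExp_eq, h.accel_eq, h.scalarHat_eq, hV, mul_pow, h2, gaussK]
    have hw : S.density τ ^ 2 = S.radius τ ^ 2 * (1 - normSq (γ τ)) := by
      rw [h.density_eq, mul_pow, Real.sq_sqrt (by linarith [hf τ])]
    field_simp
    rw [hw]; simp only [surf, normSq]; ring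

theorem x2_eq (τ : ℝ) : S.x2 τ = (γ τ).1 / √(1 - normSq (γ τ)) := by
  rw [Config.x2_eq (h.radius_pos τ), h.hat_radius]

theorem x3_eq (τ : ℝ) : S.x3 τ = (γ τ).2.1 / √(1 - normSq (γ τ)) := by
  rw [Config.x3_eq (h.radius_pos τ), h.accel_eq, h.density_eq]
  have := (h.radius_pos τ).ne'
  field_simp

theorem y1_eq (τ : ℝ) : S.y1 τ = (γ τ).2.2 / √(1 - normSq (γ τ)) := by
  rw [Config.y1_eq (h.radius_pos τ), h.scalarHat_eq, h.density_eq]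
  have := (h.radius_pos τ).ne'
  field_simp

theorem poincare_eq (hf : IsFinite γ) (τ : ℝ) : S.poincare τ = γ τ := by
  have hw : 0 < 1 - normSq (γ τ) := by linarith [hf τ]
  have hW := Real.sqrt_pos.2 hw
  have hsq := Real.sq_sqrt hw.le
  have hD : √(1 + S.x2 τ ^ 2 + S.x3 τ ^ 2 + S.y1 τ ^ 2) = 1 / √(1 - normSq (γ τ)) := by
    rw [← Real.sqrt_sq (one_div_pos.2 hW).le, h.x2_eq, h.x3_eq, h.y1_eq]
    congr 1
    field_simp
    rw [hsq]; simp only [normSq]; ring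
  have hp : S.poincare τ = (S.x2 τ / √(1 + S.x2 τ ^ 2 + S.x3 τ ^ 2 + S.y1 τ ^ 2),
      S.x3 τ / √(1 + S.x2 τ ^ 2 + S.x3 τ ^ 2 + S.y1 τ ^ 2),
      S.y1 τ / √(1 + S.x2 τ ^ 2 + S.x3 τ ^ 2 + S.y1 τ ^ 2)) := rfl
  rw [hp, hD, h.x2_eq, h.x3_eq, h.y1_eq]
  ext <;> simp only <;> field_simp

theorem realizes (hγ : IsFlowLine lam γ) (hf : IsFinite γ) : S.Realizes V0 lam γ := by
  refine ⟨h.isSolution hγ hf, fun τ => ?_, h.poincare_eq hf⟩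
  rw [h.poincare_eq hf, h.density_eq, sqrt_gaussK (h.radius_pos τ)]
  field_simp

theorem metricB_eq (hf : IsFinite γ) (τ : ℝ) : S.metricB τ = (γ τ).1 ^ 2 / (1 - normSq (γ τ)) := by
  rw [metricB, h.hat_radius, div_pow, Real.sq_sqrt (by linarith [hf τ])]

end Traces

/-- Every finite orbit on which the potential vanishes, resp. is positive, comes from a metric. -/
theorem exists_traces {lam V0 : ℝ} {γ : ℝ → Pt} (hγ : IsFlowLine lam γ) (hf : IsFinite γ)
    (hV : (V0 = 0 ∧ ∀ τ, surf (γ τ) = 0) ∨ (0 < V0 ∧ ∀ τ, surf (γ τ) < 0)) :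
    ∃ S : Config, S.Traces V0 lam γ := by
  have hcγ := hγ.continuous
  obtain ⟨R, hR, hRd⟩ := exists_integratingFactor (g := fun τ => (γ τ).1) (by fun_prop)
  obtain ⟨N, hN, hNd⟩ := exists_integratingFactor (g := fun τ => (γ τ).2.1) (by fun_prop)
  obtain ⟨ψ, hψd⟩ : ∃ ψ : ℝ → ℝ, ∀ τ, HasDerivAt ψ (√2 * (γ τ).2.2) τ :=
    ⟨fun t => ∫ s in (0 : ℝ)..t, √2 * (γ s).2.2, fun t => by
      have hc : Continuous fun s => √2 * (γ s).2.2 := by fun_prop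
      exact intervalIntegral.integral_hasDerivAt_right (hc.intervalIntegrable 0 t)
        (hc.stronglyMeasurableAtFilter _ _) hc.continuousAt⟩
  have hw : ∀ τ, 0 < 1 - normSq (γ τ) := fun τ => by linarith [hf τ]
  -- V R² (1 - normSq) and `surf` solve the same linear equation, hence are proportional. The
  -- positive constant is absorbed into the scale of the radius, so V₀ > 0 can be prescribed.
  obtain ⟨c, hc, hpot⟩ : ∃ c > 0, ∀ τ,
      expPotential V0 lam (ψ τ) * (c * R τ) ^ 2 * (1 - normSq (γ τ)) = -surf (γ τ) := by
    rcases hV with ⟨rfl, hs⟩ | ⟨hV0, hs⟩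
    · exact ⟨1, one_pos, fun τ => by simp [hs τ, expPotential]⟩
    · have hq : ∀ τ, 0 < expPotential V0 lam (ψ τ) * R τ ^ 2 * (1 - normSq (γ τ)) := fun τ =>
        mul_pos (mul_pos (mul_pos hV0 (Real.exp_pos _)) (pow_pos (hR τ) 2)) (hw τ)
      have hqd : ∀ τ, HasDerivAt
          (fun t => expPotential V0 lam (ψ t) * R t ^ 2 * (1 - normSq (γ t)))
          (2 * ((γ τ).1 - lam / √2 * (γ τ).2.2 - growth lam (γ τ)) *
            (expPotential V0 lam (ψ τ) * R τ ^ 2 * (1 - normSq (γ τ)))) τ := fun τ => by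
        refine ((((((hψd τ).const_mul (-lam)).exp).const_mul V0).mul ((hRd τ).pow 2)).mul
          (hasDerivAt_normSq hγ τ)).congr_deriv ?_
        have h2 : lam * √2 = 2 * (lam / √2) := by
          rw [← mul_div_assoc, mul_comm 2 lam, mul_div_assoc, Real.div_sqrt]
        simp only [expPotential, Pi.mul_apply, Pi.pow_apply]
        push_cast
        linear_combination (-V0 * Real.exp (-lam * ψ τ) * (γ τ).2.2 * R τ ^ 2
          * (1 - normSq (γ τ))) * h2
      obtain ⟨k, hk⟩ := linear_mul_eq (fun τ => (hasDerivAt_surf hγ τ)) hqd (fun τ => (hq τ).ne')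
      have hk0 : 0 < -k := by
        have h1 := hk 0
        have h2 := hs 0
        have h3 := hq 0
        by_contra hcon
        nlinarith
      refine ⟨√(-k), Real.sqrt_pos.2 hk0, fun τ => ?_⟩
      rw [hk τ, mul_pow, Real.sq_sqrt hk0.le]; ring
  exact ⟨⟨fun τ => c * R τ, N, fun τ => c * R τ * √(1 - normSq (γ τ)), ψ⟩,
    fun τ => mul_pos hc (hR τ), hN,
    fun τ => ((hRd τ).const_mul c).congr_deriv (by simp only; ring), hNd, hψd, fun _ => rfl, hpot⟩

/-! ### Reversal of the radial parameter -/

/-- The same spacetime with the opposite radial parameter. -/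
def rev (S : Config) : Config :=
  ⟨fun τ => S.radius (-τ), fun τ => S.lapse (-τ), fun τ => S.density (-τ), fun τ => S.scalar (-τ)⟩

theorem hat_rev (f : ℝ → ℝ) (τ : ℝ) : S.rev.hat (fun t => f (-t)) τ = -S.hat f (-τ) := by
  simp only [hat, rev]
  rw [deriv_comp_neg, neg_div]

theorem hat_rev_neg (f : ℝ → ℝ) (τ : ℝ) : S.rev.hat (fun t => -f (-t)) τ = S.hat f (-τ) := by
  simp only [hat, rev]
  rw [deriv.fun_neg, deriv_comp_neg, neg_neg]

theorem sheetExp_rev : S.rev.sheetExp = fun τ => -S.sheetExp (-τ) := funext fun τ => by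
  have := hat_rev (S := S) S.radius τ
  simp only [sheetExp]
  rw [show S.rev.radius = fun t => S.radius (-t) from rfl, this]; ring

theorem accel_rev : S.rev.accel = fun τ => -S.accel (-τ) := funext fun τ => by
  have := hat_rev (S := S) S.lapse τ
  simp only [accel]
  rw [show S.rev.lapse = fun t => S.lapse (-t) from rfl, this]; ring

theorem scalarHat_rev : S.rev.scalarHat = fun τ => -S.scalarHat (-τ) := funext fun τ =>
  hat_rev (S := S) S.scalar τ

theorem IsSolution.rev {V : ℝ → ℝ} (h : S.IsSolution V) : S.rev.IsSolution V where
  radius_smooth := h.radius_smooth.comp contDiff_neg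
  lapse_smooth := h.lapse_smooth.comp contDiff_neg
  scalar_smooth := h.scalar_smooth.comp contDiff_neg
  density_smooth := h.density_smooth.comp contDiff_neg
  radius_pos τ := h.radius_pos (-τ)
  lapse_pos τ := h.lapse_pos (-τ)
  density_pos τ := h.density_pos (-τ)
  sheetExp_eq τ := by
    have := h.sheetExp_eq (-τ)
    simp only [weyl] at this ⊢
    rw [sheetExp_rev, hat_rev_neg, this, accel_rev, scalarHat_rev,
      show S.rev.scalar τ = S.scalar (-τ) from rfl]
    ring
  accel_eq τ := by
    have := h.accel_eq (-τ)
    rw [sheetExp_rev, accel_rev, hat_rev_neg, this, show S.rev.scalar τ = S.scalar (-τ) from rfl]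
    ring
  scalar_eq τ := by
    have := h.scalar_eq (-τ)
    rw [sheetExp_rev, accel_rev, scalarHat_rev, hat_rev_neg, this,
      show S.rev.scalar τ = S.scalar (-τ) from rfl]
    ring
  gauss_eq τ := by
    have := h.gauss_eq (-τ)
    rw [sheetExp_rev, accel_rev, scalarHat_rev, show S.rev.scalar τ = S.scalar (-τ) from rfl,
      show S.rev.gaussK τ = S.gaussK (-τ) from rfl, this]
    ring

theorem poincare_rev (τ : ℝ) : S.rev.poincare τ = -S.poincare (-τ) := by
  have e2 : S.rev.x2 τ = -S.x2 (-τ) := by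
    simp only [x2]; rw [sheetExp_rev, show S.rev.gaussK τ = S.gaussK (-τ) from rfl]; ring
  have e3 : S.rev.x3 τ = -S.x3 (-τ) := by
    simp only [x3]; rw [accel_rev, show S.rev.gaussK τ = S.gaussK (-τ) from rfl]; ring
  have e1 : S.rev.y1 τ = -S.y1 (-τ) := by
    simp only [y1]; rw [scalarHat_rev, show S.rev.gaussK τ = S.gaussK (-τ) from rfl]; ring
  simp only [poincare, e1, e2, e3, neg_sq]
  ext <;> simp [neg_div]

theorem Realizes.rev {V0 lam : ℝ} {γ : ℝ → Pt} (h : S.Realizes V0 lam γ) :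
    S.rev.Realizes V0 lam fun τ => -γ (-τ) := by
  refine ⟨h.1.rev, fun τ => ?_, fun τ => by rw [poincare_rev, h.2.2]⟩
  rw [poincare_rev, normSq_neg]
  exact h.2.1 (-τ)

theorem metricB_rev (τ : ℝ) : S.rev.metricB τ = S.metricB (-τ) := by
  have := hat_rev (S := S) S.radius τ
  simp only [metricB]
  rw [show S.rev.radius = fun t => S.radius (-t) from rfl, this, neg_sq]

theorem kretschmann_rev (τ : ℝ) : S.rev.kretschmann τ = S.kretschmann (-τ) := by
  have h1 : S.rev.hat S.rev.radius = fun t => -S.hat S.radius (-t) :=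
    funext fun t => hat_rev (S := S) S.radius t
  have h2 : S.rev.hat S.rev.lapse = fun t => -S.hat S.lapse (-t) :=
    funext fun t => hat_rev (S := S) S.lapse t
  simp only [kretschmann]
  rw [h1, h2, hat_rev_neg, hat_rev_neg, show S.rev.radius τ = S.radius (-τ) from rfl,
    show S.rev.lapse τ = S.lapse (-τ) from rfl]
  ring

theorem integrableAtFilter_neg {f : ℝ → ℝ}
    (h : MeasureTheory.IntegrableAtFilter (fun t => f (-t)) atBot MeasureTheory.volume) :
    MeasureTheory.IntegrableAtFilter f atTop MeasureTheory.volume := by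
  obtain ⟨s, hs, hi⟩ := h
  obtain ⟨T, hT⟩ := mem_atBot_sets.1 hs
  refine ⟨Set.Ici (-T), Ici_mem_atTop _, ?_⟩
  have : MeasureTheory.IntegrableOn (fun t => f (-t)) (Set.Iic (- -T)) := by
    rw [neg_neg]; exact hi.mono_set hT
  simpa using this.comp_neg_Ici (c := -T)

theorem NakedSingularity.of_rev (h : S.rev.NakedSingularity atBot) : S.NakedSingularity atTop := by
  obtain ⟨h1, h2, h3, h4, h5⟩ := h
  refine ⟨tendsto_neg_neg_atTop h1, tendsto_neg_neg_atTop (h2.congr metricB_rev),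
    tendsto_neg_neg_atTop (h3.congr kretschmann_rev), integrableAtFilter_neg h4,
    integrableAtFilter_neg h5⟩

theorem IsSchwarzschild.of_rev (h : S.rev.IsSchwarzschild) : S.IsSchwarzschild := by
  obtain ⟨m, hm, c, hc, h1, h2, ψ0, h3⟩ := h
  refine ⟨m, hm, c, hc, fun τ => ?_, ?_, ψ0, fun τ => ?_⟩
  · have := h1 (-τ)
    rw [metricB_rev] at this
    simpa [rev] using this
  · rw [← h2]
    exact (neg_surjective.range_comp S.radius).symm
  · simpa [rev] using h3 (-τ)

end Config

/-! ### Naked singularities -/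

namespace Config

variable {S : Config} {V0 lam : ℝ} {γ : ℝ → Pt}

theorem Traces.radius_tendsto_zero (h : S.Traces V0 lam γ) {p : Pt} (hlim : Tendsto γ atBot (𝓝 p))
    (ha : 0 < p.1) : Tendsto S.radius atBot (𝓝 0) :=
  (exp_decay_atBot ha h.radius_pos h.radius_deriv ((continuous_fst.tendsto p).comp hlim)).1

/-- Radius, density and density/lapse have logarithmic derivatives tending to the three numbers
assumed positive, so they decay exponentially at -∞. B = X₂²/(1 - normSq) diverges because p lies at
infinity with X₂ > 0. -/
theorem Traces.nakedSingularity (h : S.Traces V0 lam γ) (hγ : IsFlowLine lam γ) (hf : IsFinite γ)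
    {p : Pt} (hlim : Tendsto γ atBot (𝓝 p)) (hn : normSq p = 1) (ha : 0 < p.1)
    (hd : 0 < p.1 - growth lam p) (hl : 0 < p.1 - growth lam p - p.2.1) :
    S.NakedSingularity atBot := by
  have hr0 := h.radius_tendsto_zero hlim ha
  have hw : Tendsto (fun τ => 1 - normSq (γ τ)) atBot (𝓝[>] 0) := by
    refine tendsto_nhdsWithin_iff.2 ⟨?_, Eventually.of_forall fun τ => by
      simpa using hf τ⟩
    simpa [hn] using ((continuous_normSq.tendsto p).comp hlim).const_sub 1
  have hB : Tendsto S.metricB atBot atTop := by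
    have h1 : Tendsto (fun τ => (γ τ).1 ^ 2) atBot (𝓝 (p.1 ^ 2)) :=
      ((continuous_fst.tendsto p).comp hlim).pow 2
    refine (h1.pos_mul_atTop (pow_pos ha 2) hw.inv_tendsto_nhdsGT_zero).congr fun τ => ?_
    rw [h.metricB_eq hf, div_eq_mul_inv]; rfl
  have hgc := continuous_growth lam
  have hg : Tendsto (fun τ => (γ τ).1 - growth lam (γ τ)) atBot (𝓝 (p.1 - growth lam p)) := by
    have hc : Continuous fun p : Pt => p.1 - growth lam p := by fun_prop
    exact (hc.tendsto p).comp hlim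
  refine ⟨hr0, hB, ?_, ?_, ?_⟩
  -- The curvature of the spheres suffices: ((B - 1)/r²)² ≥ B - 1 once B ≥ 2 and r ≤ 1.
  · refine tendsto_atTop_mono' _ ?_ (tendsto_atTop_add_const_right _ (-1) hB)
    filter_upwards [hB.eventually (eventually_ge_atTop 2),
      hr0.eventually (gt_mem_nhds one_pos)] with τ h1 h2
    have hr := h.radius_pos τ
    have hr2 : S.radius τ ^ 2 ≤ 1 := pow_le_one₀ hr.le h2.le
    have h3 : S.metricB τ - 1 ≤ (S.metricB τ - 1) / S.radius τ ^ 2 :=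
      le_div_self (by linarith) (pow_pos hr 2) hr2
    have h4 : S.metricB τ - 1 ≤ ((1 - S.hat S.radius τ ^ 2) / S.radius τ ^ 2) ^ 2 := by
      have e : ((1 - S.hat S.radius τ ^ 2) / S.radius τ ^ 2) ^ 2
          = ((S.metricB τ - 1) / S.radius τ ^ 2) ^ 2 := by
        rw [metricB, ← neg_sub, neg_div, neg_sq]
      rw [e]; nlinarith
    have h5 := sq_nonneg (S.hat (S.hat S.lapse) τ / S.lapse τ)
    have h6 := sq_nonneg (S.hat S.lapse τ * S.hat S.radius τ / (S.lapse τ * S.radius τ))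
    have h7 := sq_nonneg (S.hat (S.hat S.radius) τ / S.radius τ)
    simp only [kretschmann]
    linarith
  · exact (exp_decay_atBot hd (h.density_pos hf) (h.hasDerivAt_density hγ hf) hg).2
  · refine (exp_decay_atBot (g := fun τ => (γ τ).1 - growth lam (γ τ) - (γ τ).2.1) hl
      (fun τ => div_pos (h.density_pos hf τ) (h.lapse_pos τ)) (fun τ => ?_) (hg.sub ?_)).2
    · refine ((h.hasDerivAt_density hγ hf τ).div (h.lapse_deriv τ) (h.lapse_pos τ).ne').congr_deriv ?_
      have := (h.lapse_pos τ).ne'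
      field_simp
    · exact ((continuous_fst.comp continuous_snd).tendsto p).comp hlim

/-- On the critical curve growth = -(X₂ + X₃), so the rates of density and density/lapse are 2X₂ +
X₃ and 2X₂. Only P_H has X₂ = 0. -/
theorem Traces.nakedSingularity_of_critCurve (h : S.Traces V0 lam γ) (hγ : IsFlowLine lam γ)
    (hf : IsFinite γ) {p : Pt} (hlim : Tendsto γ atBot (𝓝 p)) (hp : p ∈ critCurve) (hne : p ≠ PH) :
    S.NakedSingularity atBot := by
  have ha : 0 < p.1 := lt_of_le_of_ne (fst_nonneg_of_mem_surfM hp.1) fun h0 =>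
    hne (eq_PH_of_mem_critCurve hp h0.symm)
  have hp' := (mem_critCurve_iff p).1 hp
  have hg := growth_of_surf_eq_zero lam hp'.1
  rw [hp'.2.1] at hg
  refine h.nakedSingularity hγ hf hlim hp'.2.1 ha ?_ ?_ <;> rw [hg] <;> linarith [hp'.2.2]

end Config

theorem Plam_eq (lam : ℝ) : Plam lam =
    (√2 * (√(lam ^ 2 + 4))⁻¹, √2 * (√(lam ^ 2 + 4))⁻¹, lam * (√(lam ^ 2 + 4))⁻¹) := by
  simp only [Plam, div_eq_mul_inv]

theorem inv_sqrt_Plam (lam : ℝ) : 0 < (√(lam ^ 2 + 4))⁻¹ ∧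
    (√(lam ^ 2 + 4))⁻¹ ^ 2 * (lam ^ 2 + 4) = 1 := by
  have h : 0 < lam ^ 2 + 4 := by positivity
  refine ⟨inv_pos.2 (Real.sqrt_pos.2 h), ?_⟩
  rw [inv_pow, Real.sq_sqrt h.le, inv_mul_cancel₀ h.ne']

theorem normSq_Plam (lam : ℝ) : normSq (Plam lam) = 1 := by
  obtain ⟨h1, h2⟩ := inv_sqrt_Plam lam
  have h22 : (√2 : ℝ) ^ 2 = 2 := Real.sq_sqrt zero_le_two
  rw [Plam_eq]; simp only [normSq, mul_pow, h22]; linarith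

theorem Plam_fst_pos (lam : ℝ) : 0 < (Plam lam).1 := by
  have := (inv_sqrt_Plam lam).1
  rw [Plam_eq]; positivity

theorem Plam_snd (lam : ℝ) : (Plam lam).2.1 = (Plam lam).1 := rfl

theorem Plam_trd (lam : ℝ) : lam / √2 * (Plam lam).2.2 = lam ^ 2 / 2 * (Plam lam).1 := by
  rw [Plam_eq]
  have h22 : (√2 : ℝ) ^ 2 = 2 := Real.sq_sqrt zero_le_two
  simp only
  field_simp
  rw [h22]

theorem surf_Plam (lam : ℝ) : surf (Plam lam) * (lam ^ 2 + 4) = 6 - lam ^ 2 := by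
  obtain ⟨h1, h2⟩ := inv_sqrt_Plam lam
  have h22 : (√2 : ℝ) ^ 2 = 2 := Real.sq_sqrt zero_le_two
  rw [Plam_eq]; simp only [surf, mul_pow]
  rw [mul_assoc 2 (√2 * _) (√2 * _), ← sq, mul_pow, h22]; linarith

theorem growth_Plam (lam : ℝ) : growth lam (Plam lam) = (1 - lam ^ 2 / 2) * (Plam lam).1 := by
  have hn := normSq_Plam lam
  have ht := Plam_trd lam
  simp only [growth, ht]
  simp only [normSq, surf, Plam_snd] at hn ⊢
  have h3 : (Plam lam).2.2 ^ 2 = 1 - 2 * (Plam lam).1 ^ 2 := by linarith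
  have h4 : (Plam lam).1 ^ 2 * (lam ^ 2 + 4) = 2 := by
    obtain ⟨h1, h2⟩ := inv_sqrt_Plam lam
    have h22 : (√2 : ℝ) ^ 2 = 2 := Real.sq_sqrt zero_le_two
    rw [Plam_eq]; simp only [mul_pow, h22]; linarith
  rw [h3]
  linear_combination (5 / 2 * (Plam lam).1) * h4

/-- At P_λ the rates of density and density/lapse are (λ²/2) X₂ and (λ²/2 - 1) X₂. -/
theorem Config.Traces.nakedSingularity_of_Plam {S : Config} {V0 lam : ℝ} {γ : ℝ → Pt}
    (h : S.Traces V0 lam γ) (hγ : IsFlowLine lam γ) (hf : IsFinite γ)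
    (hlim : Tendsto γ atBot (𝓝 (Plam lam))) (hlam : 6 < lam ^ 2) : S.NakedSingularity atBot := by
  have ha := Plam_fst_pos lam
  have hm : 0 < (lam ^ 2 / 2 - 1) * (Plam lam).1 := mul_pos (by linarith) ha
  refine h.nakedSingularity hγ hf hlim (normSq_Plam lam) ha ?_ ?_
  · rw [growth_Plam]; linarith
  · rw [growth_Plam, Plam_snd]; linarith

/-! ### Orbits on the invariant surface -/

section SurfM

variable {lam : ℝ} {γ : ℝ → Pt}

theorem hasDerivAt_fst_of_surf (h : IsFlowLine lam γ) {τ : ℝ} (hs : surf (γ τ) = 0) :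
    HasDerivAt (fun t => (γ t).1)
      (((γ τ).1 + (γ τ).2.1) * (γ τ).2.1 * (1 - normSq (γ τ))) τ := by
  refine (h.hasDerivAt_fst τ).congr_deriv ?_
  rw [growth_of_surf_eq_zero lam hs]
  simp only [surf] at hs
  simp only [normSq]
  linear_combination ((γ τ).1 ^ 2 + (γ τ).2.1 ^ 2 + (γ τ).2.2 ^ 2) * hs

/-- The coefficient is the same as for Y₁ in `hasDerivAt_trd_of_surf`; hence Y₁/X₃ is constant
wherever X₃ ≠ 0, and λ has dropped out. -/
theorem hasDerivAt_snd_of_surf (h : IsFlowLine lam γ) {τ : ℝ} (hs : surf (γ τ) = 0) :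
    HasDerivAt (fun t => (γ t).2.1)
      (-((2 * (γ τ).1 + (γ τ).2.1) * (1 - normSq (γ τ))) * (γ τ).2.1) τ := by
  refine (h.hasDerivAt_snd τ).congr_deriv ?_
  rw [growth_of_surf_eq_zero lam hs, hs]; ring

theorem hasDerivAt_trd_of_surf (h : IsFlowLine lam γ) {τ : ℝ} (hs : surf (γ τ) = 0) :
    HasDerivAt (fun t => (γ t).2.2)
      (-((2 * (γ τ).1 + (γ τ).2.1) * (1 - normSq (γ τ))) * (γ τ).2.2) τ := by
  refine (h.hasDerivAt_trd τ).congr_deriv ?_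
  rw [growth_of_surf_eq_zero lam hs, hs]; ring

theorem continuous_surf_rate (h : IsFlowLine lam γ) :
    Continuous fun τ => -((2 * (γ τ).1 + (γ τ).2.1) * (1 - normSq (γ τ))) := by
  have := h.continuous
  have := continuous_normSq
  fun_prop

/-- The angle on the invariant surface. -/
def angle (γ : ℝ → Pt) (τ : ℝ) : ℝ := Real.arccos (γ τ).1

theorem cos_sin_angle {τ : ℝ} (h : γ τ ∈ surfM) :
    Real.cos (angle γ τ) = (γ τ).1 ∧ Real.sin (angle γ τ) = (γ τ).1 + (γ τ).2.1 := by
  have h1 := abs_le.1 (sq_le_one_iff_abs_le_one _ |>.1 h.2.1)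
  exact ⟨Real.cos_arccos h1.1 h1.2, by rw [angle, Real.sin_arccos, h.1]⟩

/-- The trigonometric bracket measures the distance to infinity, so on M it vanishes exactly on the
critical curve. -/
theorem angle_bracket {τ : ℝ} (h : γ τ ∈ surfM) :
    1 + 2 * (γ τ).2.2 ^ 2 + Real.cos (2 * angle γ τ) - 2 * Real.sin (2 * angle γ τ)
      = -2 * (1 - normSq (γ τ)) := by
  obtain ⟨h1, h2⟩ := cos_sin_angle h
  have h3 := ((mem_surfM_iff _).1 h).1
  rw [Real.cos_two_mul, Real.sin_two_mul, h1, h2]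
  simp only [normSq]
  simp only [surf] at h3
  linear_combination -2 * h3

theorem angle_mem {τ : ℝ} (h : γ τ ∈ surfM) :
    angle γ τ ∈ Set.Icc (Real.arccos (2 / √5)) (Real.pi / 2) := by
  have ha := fst_nonneg_of_mem_surfM h
  refine ⟨Real.arccos_le_arccos ?_, Real.arccos_le_pi_div_two.2 ha⟩
  obtain ⟨h1, h2, h3⟩ := (mem_surfM_iff _).1 h
  simp only [surf] at h1
  simp only [normSq] at h2
  rw [le_div_iff₀ (by positivity)]
  refine le_of_sq_le_sq ?_ zero_le_two
  rw [mul_pow, Real.sq_sqrt (by norm_num)]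
  by_contra hcon
  push Not at hcon
  have h5 : 0 < (γ τ).1 := by
    rcases ha.eq_or_lt with h0 | h0
    · rw [← h0] at hcon; norm_num at hcon
    · exact h0
  -- surf = 0 and normSq ≤ 1 give X₂ (X₂ + 2X₃) ≥ Y₁² ≥ 0. Squared and combined with (X₂ + X₃)² = 1
  -- - X₂², the inequality becomes X₂² ≤ 4/5.
  have h6 : (γ τ).1 ≤ 2 * ((γ τ).1 + (γ τ).2.1) := by
    have : 0 ≤ (γ τ).1 * ((γ τ).1 + 2 * (γ τ).2.1) := by nlinarith [sq_nonneg (γ τ).2.2]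
    have := nonneg_of_mul_nonneg_right this h5
    linarith
  nlinarith

theorem hasDerivAt_angle (h : IsFlowLine lam γ) {τ : ℝ} (hs : γ τ ∈ surfM) :
    HasDerivAt (angle γ) (-(γ τ).2.1 * (1 - normSq (γ τ))) τ := by
  obtain ⟨h1, h2, h3⟩ := (mem_surfM_iff _).1 hs
  have h4 := (surf_eq_zero_iff _).1 h1
  have h5 : 0 < ((γ τ).1 + (γ τ).2.1) ^ 2 := pow_pos h3 2
  have hne1 : (γ τ).1 ≠ -1 := fun h0 => by rw [h4, h0] at h5; norm_num at h5
  have hne2 : (γ τ).1 ≠ 1 := fun h0 => by rw [h4, h0] at h5; norm_num at h5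
  have key := (Real.hasDerivAt_arccos hne1 hne2).comp τ (hasDerivAt_fst_of_surf h h1)
  refine key.congr_deriv ?_
  rw [← hs.1]
  field_simp

theorem surfM_angle_equations (h : IsFlowLine lam γ) (hs : ∀ τ, γ τ ∈ surfM) (τ : ℝ) :
    HasDerivAt (angle γ) (-((Real.cos (angle γ τ) - Real.sin (angle γ τ)) / 2) *
      (1 + 2 * (γ τ).2.2 ^ 2 + Real.cos (2 * angle γ τ) - 2 * Real.sin (2 * angle γ τ))) τ ∧
    HasDerivAt (fun t => (γ t).2.2) ((γ τ).2.2 *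
      ((Real.cos (angle γ τ) + Real.sin (angle γ τ)) / 2) *
      (1 + 2 * (γ τ).2.2 ^ 2 + Real.cos (2 * angle γ τ) - 2 * Real.sin (2 * angle γ τ))) τ := by
  obtain ⟨h1, h2⟩ := cos_sin_angle (hs τ)
  rw [angle_bracket (hs τ), h1, h2]
  exact ⟨(hasDerivAt_angle h (hs τ)).congr_deriv (by ring),
    (hasDerivAt_trd_of_surf h ((mem_surfM_iff _).1 (hs τ)).1).congr_deriv (by ring)⟩

theorem snd_eq_zero_or_trd_eq (h : IsFlowLine lam γ) (hs : ∀ τ, surf (γ τ) = 0) :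
    (∀ τ, (γ τ).2.1 = 0) ∨ (∀ τ, (γ τ).2.1 ≠ 0) ∧ ∃ c, ∀ τ, (γ τ).2.2 = c * (γ τ).2.1 := by
  by_cases h0 : ∃ τ, (γ τ).2.1 = 0
  · obtain ⟨τ, h0⟩ := h0
    exact Or.inl fun t => linear_eq_zero (continuous_surf_rate h)
      (fun t => hasDerivAt_snd_of_surf h (hs t)) h0 t
  · push Not at h0
    exact Or.inr ⟨h0, linear_mul_eq (fun t => hasDerivAt_trd_of_surf h (hs t))
      (fun t => hasDerivAt_snd_of_surf h (hs t)) h0⟩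

theorem surfM_first_integral (h : IsFlowLine lam γ) (hs : ∀ τ, γ τ ∈ surfM) :
    (∃ c₁ : ℝ, ∀ τ, (γ τ).2.2 = c₁ * (Real.cos (angle γ τ) - Real.sin (angle γ τ))) ∨
      ∀ τ, angle γ τ = Real.pi / 4 := by
  have hs' := fun τ => ((mem_surfM_iff _).1 (hs τ)).1
  rcases snd_eq_zero_or_trd_eq h hs' with h0 | ⟨-, c, hc⟩
  · right
    intro τ
    obtain ⟨h1, h2, h3⟩ := (mem_surfM_iff _).1 (hs τ)
    simp only [surf, h0 τ] at h1
    rw [h0 τ, add_zero] at h3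
    have h4 : (γ τ).1 = Real.cos (Real.pi / 4) := by
      rw [Real.cos_pi_div_four]
      have := Real.sq_sqrt (zero_le_two (α := ℝ))
      nlinarith [Real.sqrt_pos.2 (zero_lt_two (α := ℝ))]
    rw [angle, h4, Real.arccos_cos (by positivity) (by linarith [Real.pi_pos])]
  · refine Or.inl ⟨-c, fun τ => ?_⟩
    obtain ⟨h1, h2⟩ := cos_sin_angle (hs τ)
    rw [h1, h2, hc]; ring

/-- The finite orbits on `M` go from the critical curve to `P_M`. -/
theorem surfM_limits (h : IsFlowLine lam γ) (hf : IsFinite γ) (hs : ∀ τ, γ τ ∈ surfM)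
    (hne : ∀ τ, γ τ ≠ PM) :
    Tendsto γ atTop (𝓝 PM) ∧ ∃ p ∈ critCurve, Tendsto γ atBot (𝓝 p) := by
  have hs' := fun τ => (mem_surfM_iff _).1 (hs τ)
  have hsum : ∀ {l : Filter ℝ} [l.NeBot] {p : Pt}, Tendsto γ l (𝓝 p) → 0 ≤ p.1 + p.2.1 :=
    fun {l} _ {p} hl => by
      have hc : Continuous fun p : Pt => p.1 + p.2.1 := by fun_prop
      exact ge_of_tendsto' ((hc.tendsto p).comp hl) fun τ => (hs' τ).2.2.le
  have hbarneg : PMbar.1 + PMbar.2.1 < 0 := by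
    have := inv_sqrt_two_pos
    simp only [PMbar]; linarith
  constructor
  -- Of the possible limits of the reversed orbit, the sign X₂ + X₃ > 0 on M leaves only the one
  -- that reflects to P_M.
  · have hlim := exists_limit_atBot h.neg hf.neg
      fun τ => by rw [surf_neg]; exact (hs' _).1.le
    have hback : ∀ {p : Pt}, Tendsto (fun τ => -γ (-τ)) atBot (𝓝 p) → Tendsto γ atTop (𝓝 (-p)) :=
      fun hp => by simpa using tendsto_neg_of_atBot hp
    rcases hlim with h1 | h1 | ⟨p, h1, h2⟩
    · have := hback h1
      rw [neg_PM] at this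
      linarith [hsum this]
    · have := hback h1
      rwa [neg_PMbar] at this
    · have h3 := hsum (hback h1)
      simp only [Prod.fst_neg, Prod.snd_neg] at h3
      rcases h2 with h2 | ⟨-, rfl⟩
      · linarith [((mem_critCurve_iff p).1 h2).2.2]
      · have := Plam_fst_pos lam
        rw [Plam_snd] at h3
        linarith
  · rcases exists_limit_atBot h hf (fun τ => (hs' τ).1.le) with h1 | h1 | ⟨p, h1, h2⟩
    -- X₃² + Y₁² does not increase along orbits on M and vanishes at P_M, so an orbit emerging from
    -- P_M would be P_M itself.
    · exfalso
      have hd : ∀ τ, HasDerivAt (fun t => (γ t).2.1 ^ 2 + (γ t).2.2 ^ 2)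
          (-2 * ((2 * (γ τ).1 + (γ τ).2.1) * (1 - normSq (γ τ)))
            * ((γ τ).2.1 ^ 2 + (γ τ).2.2 ^ 2)) τ := fun τ =>
        (((hasDerivAt_snd_of_surf h (hs' τ).1).pow 2).add
          ((hasDerivAt_trd_of_surf h (hs' τ).1).pow 2)).congr_deriv (by push_cast; ring)
      have hanti := antitone_of_hasDerivAt hd fun τ => by
        have h1 := fst_nonneg_of_mem_surfM (hs τ)
        have h2 : 0 ≤ (2 * (γ τ).1 + (γ τ).2.1) * (1 - normSq (γ τ)) :=
          mul_nonneg (by linarith [(hs' τ).2.2]) (by linarith [hf τ])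
        nlinarith [sq_nonneg (γ τ).2.1, sq_nonneg (γ τ).2.2, mul_nonneg h2 (sq_nonneg (γ τ).2.1),
          mul_nonneg h2 (sq_nonneg (γ τ).2.2)]
      have hl : Tendsto (fun t => (γ t).2.1 ^ 2 + (γ t).2.2 ^ 2) atBot (𝓝 0) := by
        have hc : Continuous fun p : Pt => p.2.1 ^ 2 + p.2.2 ^ 2 := by fun_prop
        have := (hc.tendsto PM).comp h1
        simpa [PM, Function.comp_def] using this
      have h0 : (γ 0).2.1 ^ 2 + (γ 0).2.2 ^ 2 ≤ 0 :=
        ge_of_tendsto hl ((eventually_le_atBot 0).mono fun t ht => hanti ht)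
      have hb : (γ 0).2.1 = 0 := by nlinarith [sq_nonneg (γ 0).2.1, sq_nonneg (γ 0).2.2]
      have hy : (γ 0).2.2 = 0 := by nlinarith [sq_nonneg (γ 0).2.1, sq_nonneg (γ 0).2.2]
      obtain ⟨h3, -, h5⟩ := hs' 0
      simp only [surf, hb] at h3
      rw [hb, add_zero] at h5
      have ha : (γ 0).1 = 1 / √2 := by
        have := inv_sqrt_two_sq
        have := inv_sqrt_two_pos
        nlinarith
      exact hne 0 (by ext <;> simp [PM, ha, hb, hy])
    · linarith [hsum h1]
    · rcases h2 with h2 | ⟨h2, rfl⟩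
      · exact ⟨p, h2, h1⟩
      · exfalso
        have h3 : surf (Plam lam) = 0 :=
          tendsto_nhds_unique ((continuous_surf.tendsto _).comp h1)
            (tendsto_const_nhds.congr fun τ => ((hs' τ).1).symm)
        have := surf_Plam lam
        rw [h3] at this
        linarith

end SurfM

/-! ### The exterior Schwarzschild solution -/

/-- Right-hand side of the equation for the angle along the orbits on `M` with `Y₁ = 0`. -/
def angleRate (θ : ℝ) : ℝ :=
  (Real.cos θ - Real.sin θ) * Real.cos θ * (2 * Real.sin θ - Real.cos θ)

theorem lipschitzWith_angleRate : LipschitzWith 18 angleRate := by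
  have hd : ∀ x, HasDerivAt angleRate
      ((-Real.sin x - Real.cos x) * Real.cos x * (2 * Real.sin x - Real.cos x)
        + (Real.cos x - Real.sin x) * -Real.sin x * (2 * Real.sin x - Real.cos x)
        + (Real.cos x - Real.sin x) * Real.cos x * (2 * Real.cos x + Real.sin x)) x := fun x => by
    have hs := Real.hasDerivAt_sin x
    have hc := Real.hasDerivAt_cos x
    exact (((hc.sub hs).mul hc).mul ((hs.const_mul 2).sub hc)).congr_deriv (by
      simp only [Pi.sub_apply, Pi.mul_apply]; ring)
  refine lipschitzWith_of_nnnorm_deriv_le (fun x => (hd x).differentiableAt) fun x => ?_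
  rw [(hd x).deriv, ← NNReal.coe_le_coe, coe_nnnorm]
  have h1 := Real.abs_sin_le_one x
  have h2 := Real.abs_cos_le_one x
  generalize Real.sin x = s at *
  generalize Real.cos x = c at *
  have a1 : |-s - c| ≤ 2 := (abs_sub _ _).trans (by rw [abs_neg]; linarith)
  have a2 : |2 * s - c| ≤ 3 := (abs_sub _ _).trans (by rw [abs_mul, abs_two]; linarith)
  have a3 : |c - s| ≤ 2 := (abs_sub _ _).trans (by linarith)
  have a4 : |2 * c + s| ≤ 3 := (abs_add_le _ _).trans (by rw [abs_mul, abs_two]; linarith)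
  have m1 : |(-s - c) * c * (2 * s - c)| ≤ 2 * 1 * 3 := by
    rw [abs_mul, abs_mul]; gcongr
  have m2 : |(c - s) * -s * (2 * s - c)| ≤ 2 * 1 * 3 := by
    rw [abs_mul, abs_mul, abs_neg]; gcongr
  have m3 : |(c - s) * c * (2 * c + s)| ≤ 2 * 1 * 3 := by
    rw [abs_mul, abs_mul]; gcongr
  rw [Real.norm_eq_abs]
  refine (abs_add_le _ _).trans ((add_le_add (abs_add_le _ _) le_rfl).trans ?_)
  norm_num at m1 m2 m3 ⊢
  linarith

theorem norm_angleRate_le (θ : ℝ) : ‖angleRate θ‖ ≤ (6 : NNReal) := by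
  have h1 := Real.abs_sin_le_one θ
  have h2 := Real.abs_cos_le_one θ
  simp only [angleRate]
  generalize Real.sin θ = s at *
  generalize Real.cos θ = c at *
  have a2 : |2 * s - c| ≤ 3 := (abs_sub _ _).trans (by rw [abs_mul, abs_two]; linarith)
  have a3 : |c - s| ≤ 2 := (abs_sub _ _).trans (by linarith)
  rw [Real.norm_eq_abs, abs_mul, abs_mul]
  calc |c - s| * |c| * |2 * s - c| ≤ 2 * 1 * 3 := by gcongr
    _ = ((6 : NNReal) : ℝ) := by norm_num

/-- There is an orbit on `M` with `Y₁ = 0` strictly between the horizon and Minkowski points. -/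
theorem exists_schwarzschild_orbit (lam : ℝ) : ∃ γ : ℝ → Pt, IsFlowLine lam γ ∧ IsFinite γ ∧
    (∀ τ, γ τ ∈ surfM) ∧ (∀ τ, 0 < (γ τ).1) ∧ (∀ τ, 0 < (γ τ).2.1) ∧ ∀ τ, (γ τ).2.2 = 0 := by
  -- The start π/3 lies strictly between π/4 (Minkowski) and π/2 (horizon). Both cos θ and sin θ -
  -- cos θ satisfy linear equations, so they stay positive.
  obtain ⟨θ, h0, hθ⟩ := exists_global_solution lipschitzWith_angleRate norm_angleRate_le
    (Real.pi / 3)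
  have hcont : Continuous θ := continuous_iff_continuousAt.2 fun t => (hθ t).continuousAt
  have hc := fun t => (hθ t).cos
  have hs := fun t => (hθ t).sin
  have hcpos : ∀ t, 0 < Real.cos (θ t) := by
    refine linear_pos (g := fun t => -Real.sin (θ t) * ((Real.cos (θ t) - Real.sin (θ t)) *
      (2 * Real.sin (θ t) - Real.cos (θ t)))) (by fun_prop)
      (fun t => (hc t).congr_deriv (by simp only [angleRate]; ring)) (s := 0) ?_
    rw [h0, Real.cos_pi_div_three]; norm_num
  have hbpos : ∀ t, 0 < Real.sin (θ t) - Real.cos (θ t) := by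
    refine linear_pos (g := fun t => -((Real.cos (θ t) + Real.sin (θ t)) * Real.cos (θ t) *
      (2 * Real.sin (θ t) - Real.cos (θ t)))) (by fun_prop)
      (fun t => ((hs t).sub (hc t)).congr_deriv (by simp only [angleRate]; ring)) (s := 0) ?_
    rw [h0, Real.cos_pi_div_three, Real.sin_pi_div_three]
    have : (1 : ℝ) < √3 := by rw [Real.lt_sqrt zero_le_one]; norm_num
    linarith
  have hsq := fun t => Real.sin_sq_add_cos_sq (θ t)
  have hsurf : ∀ t, surf (Real.cos (θ t), Real.sin (θ t) - Real.cos (θ t), 0) = 0 := fun t => by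
    simp only [surf]; nlinarith [hsq t]
  have hfin : ∀ t, normSq (Real.cos (θ t), Real.sin (θ t) - Real.cos (θ t), 0) < 1 := fun t => by
    simp only [normSq]
    nlinarith [hsq t, mul_pos (hcpos t) (hcpos t), mul_pos (hcpos t) (hbpos t)]
  refine ⟨fun t => (Real.cos (θ t), Real.sin (θ t) - Real.cos (θ t), 0), fun t => ?_, hfin,
    fun t => (mem_surfM_iff _).2 ⟨hsurf t, (hfin t).le, ?_⟩, hcpos, hbpos, fun _ => rfl⟩
  · refine ((hc t).prodMk (((hs t).sub (hc t)).prodMk (hasDerivAt_const t (0 : ℝ)))).congr_deriv ?_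
    have e := hsq t
    ext
    · rw [field_fst, growth_of_surf_eq_zero lam (hsurf t)]
      simp only [angleRate, normSq]
      generalize Real.sin (θ t) = s at *
      generalize Real.cos (θ t) = c at *
      linear_combination (s * c - 2 * c ^ 2) * e
    · rw [field_snd, growth_of_surf_eq_zero lam (hsurf t), hsurf t]
      simp only [angleRate, normSq]
      generalize Real.sin (θ t) = s at *
      generalize Real.cos (θ t) = c at *
      linear_combination (c ^ 2 - s ^ 2) * e
    · rw [field_trd, hsurf t]; simp
  · have := hcpos t
    have := hbpos t
    simp only; linarith

section

variable {lam : ℝ} {γ : ℝ → Pt}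

theorem ne_PM_of_snd_pos {p : Pt} (h : 0 < p.2.1) : p ≠ PM := fun h0 => by
  rw [h0] at h; simp [PM] at h

/-- On the critical curve Y₁ = 0 gives X₂ (X₂ + 2X₃) = 0; with X₂, X₃ ≥ 0 only P_H is left. -/
theorem schwarzschild_limits (h : IsFlowLine lam γ) (hf : IsFinite γ) (hs : ∀ τ, γ τ ∈ surfM)
    (hb : ∀ τ, 0 < (γ τ).2.1) (hy : ∀ τ, (γ τ).2.2 = 0) :
    Tendsto γ atBot (𝓝 PH) ∧ Tendsto γ atTop (𝓝 PM) := by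
  obtain ⟨h1, p, hp, h2⟩ := surfM_limits h hf hs fun τ => ne_PM_of_snd_pos (hb τ)
  have hy0 : p.2.2 = 0 := tendsto_nhds_unique
    (((continuous_snd.comp continuous_snd).tendsto p).comp h2)
    (tendsto_const_nhds.congr fun τ => (hy τ).symm)
  have hb0 : 0 ≤ p.2.1 := ge_of_tendsto'
    (((continuous_fst.comp continuous_snd).tendsto p).comp h2) fun τ => (hb τ).le
  have ha0 := fst_nonneg_of_mem_surfM hp.1
  obtain ⟨e1, e2, e3⟩ := (mem_critCurve_iff p).1 hp
  simp only [surf] at e1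
  simp only [normSq, hy0] at e2
  have h0 : p.1 = 0 := by nlinarith [mul_nonneg ha0 hb0]
  rw [eq_PH_of_mem_critCurve hp h0] at h2
  exact ⟨h2, h1⟩

theorem finite_of_limit (h : IsOrbit lam γ) {p : Pt} (hl : Tendsto γ atTop (𝓝 p))
    (hp : normSq p < 1) : IsFinite γ := by
  obtain ⟨T, hT⟩ := ((continuous_normSq.tendsto p).comp hl |>.eventually (gt_mem_nhds hp)).exists
  have hc := (continuous_growth lam).comp h.1.continuous
  intro τ
  have := linear_pos (f := fun t => 1 - normSq (γ t)) (g := fun τ => -2 * growth lam (γ τ))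
    (by simp only [Function.comp_def] at hc; fun_prop) (hasDerivAt_normSq h.1) (s := T)
    (by simp only [Function.comp_apply] at hT; linarith) τ
  linarith

theorem surf_zero_or_neg (h : IsFlowLine lam γ) (hs : ∀ τ, surf (γ τ) ≤ 0) :
    (∀ τ, surf (γ τ) = 0) ∨ ∀ τ, surf (γ τ) < 0 := by
  by_cases h0 : ∃ τ, surf (γ τ) = 0
  · obtain ⟨τ, h0⟩ := h0
    exact Or.inl fun t => surf_eq_zero_on Set.ordConnected_univ
      (fun τ _ => (h τ).hasDerivWithinAt) (Set.mem_univ τ) (Set.mem_univ t) h0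
  · push Not at h0
    exact Or.inr fun t => lt_of_le_of_ne (hs t) (h0 t)

theorem mem_surfM_or_mem_surfMbar (h : IsFlowLine lam γ) (hn : ∀ τ, normSq (γ τ) ≤ 1)
    (hs : ∀ τ, surf (γ τ) = 0) : (∀ τ, γ τ ∈ surfM) ∨ ∀ τ, γ τ ∈ surfMbar := by
  have h0 : γ 0 ∈ surfM ∪ surfMbar := surf_zero_ball_eq ▸ ⟨hs 0, hn 0⟩
  rcases h0 with h0 | h0
  · exact Or.inl fun t => mem_surfM_on Set.ordConnected_univ
      (fun τ _ => (h τ).hasDerivWithinAt) (Set.mem_univ 0) (Set.mem_univ t) h0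
  · exact Or.inr fun t => mem_surfMbar_on Set.ordConnected_univ
      (fun τ _ => (h τ).hasDerivWithinAt) (Set.mem_univ 0) (Set.mem_univ t) h0

/-- An orbit from the horizon to Minkowski space lies on `M` and has `Y₁ = 0`. -/
theorem horizon_to_minkowski (h : IsOrbit lam γ) (h1 : Tendsto γ atBot (𝓝 PH))
    (h2 : Tendsto γ atTop (𝓝 PM)) : IsFinite γ ∧ (∀ τ, γ τ ∈ surfM) ∧ (∀ τ, 0 < (γ τ).1) ∧
      (∀ τ, 0 < (γ τ).2.1) ∧ ∀ τ, (γ τ).2.2 = 0 := by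
  have hf : IsFinite γ := finite_of_limit h h2 (by rw [normSq_PM]; norm_num)
  have hs : ∀ τ, surf (γ τ) = 0 := (surf_zero_or_neg h.1 fun τ => (h.2 τ).1).resolve_right
    fun hneg => not_tendsto_PM_atTop h.1 hneg h2
  have hM : ∀ τ, γ τ ∈ surfM :=
    (mem_surfM_or_mem_surfMbar h.1 (fun τ => (h.2 τ).2) hs).resolve_right fun hbar => by
      have hc : Continuous fun p : Pt => p.1 + p.2.1 := by fun_prop
      have := le_of_tendsto' ((hc.tendsto PM).comp h2)
        fun τ => ((mem_surfMbar_iff _).1 (hbar τ)).2.2.le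
      have h3 := inv_sqrt_two_pos
      simp only [PM] at this
      linarith
  have hblim : Tendsto (fun τ => (γ τ).2.1) atBot (𝓝 1) :=
    ((continuous_fst.comp continuous_snd).tendsto PH).comp h1
  obtain ⟨T, hT⟩ := (hblim.eventually (lt_mem_nhds one_pos)).exists
  have hb : ∀ τ, 0 < (γ τ).2.1 := linear_pos (continuous_surf_rate h.1)
    (fun t => hasDerivAt_snd_of_surf h.1 (hs t)) hT
  refine ⟨hf, hM, fun τ => ?_, hb, ?_⟩
  · refine lt_of_le_of_ne (fst_nonneg_of_mem_surfM (hM τ)) fun h0 => ?_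
    have e1 := hs τ
    have e2 := hf τ
    simp only [surf, ← h0] at e1
    simp only [normSq, ← h0] at e2
    nlinarith [sq_nonneg (γ τ).2.2]
  · rcases snd_eq_zero_or_trd_eq h.1 hs with h0 | ⟨-, c, hc⟩
    · exact absurd (h0 T) hT.ne'
    · have hy : Tendsto (fun τ => (γ τ).2.2) atBot (𝓝 0) :=
        ((continuous_snd.comp continuous_snd).tendsto PH).comp h1
      have hc0 : c * 1 = 0 := tendsto_nhds_unique ((hblim.const_mul c).congr fun τ => (hc τ).symm) hy
      intro τ
      rw [hc, show c = 0 by linarith, zero_mul]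

theorem hasDerivAt_angle_schwarzschild (h : IsFlowLine lam γ) (hs : ∀ τ, γ τ ∈ surfM)
    (hy : ∀ τ, (γ τ).2.2 = 0) (τ : ℝ) : HasDerivAt (angle γ) (angleRate (angle γ τ)) τ := by
  refine (hasDerivAt_angle h (hs τ)).congr_deriv ?_
  obtain ⟨h1, h2⟩ := cos_sin_angle (hs τ)
  have h3 := ((mem_surfM_iff _).1 (hs τ)).1
  rw [angleRate, h1, h2]
  simp only [surf] at h3
  simp only [normSq, hy τ]
  linear_combination (γ τ).2.1 * h3

theorem fst_lt_of_mem_surfM {p : Pt} (h : p ∈ surfM) (ha : 0 < p.1) (hb : 0 < p.2.1) :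
    p.1 < 1 / √2 := by
  have h1 := ((mem_surfM_iff _).1 h).1
  simp only [surf] at h1
  have h2 := inv_sqrt_two_sq
  have h3 := inv_sqrt_two_pos
  nlinarith [mul_pos ha hb]

/-- X₂ sweeps (0, 1/√2) along γ, so some shift matches δ at 0. The angle determines the point when
Y₁ = 0 and solves a Lipschitz scalar equation. -/
theorem schwarzschild_orbit_unique {δ : ℝ → Pt} (hγ : IsOrbit lam γ)
    (h1 : Tendsto γ atBot (𝓝 PH)) (h2 : Tendsto γ atTop (𝓝 PM)) (hδ : IsOrbit lam δ)
    (h3 : Tendsto δ atBot (𝓝 PH)) (h4 : Tendsto δ atTop (𝓝 PM)) :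
    ∃ c : ℝ, ∀ τ, δ τ = γ (τ + c) := by
  obtain ⟨-, hM, ha, hb, hy⟩ := horizon_to_minkowski hγ h1 h2
  obtain ⟨-, hM', ha', hb', hy'⟩ := horizon_to_minkowski hδ h3 h4
  have hcont : Continuous fun τ => (γ τ).1 := continuous_fst.comp hγ.1.continuous
  have hl1 : Tendsto (fun τ => (γ τ).1) atBot (𝓝 0) := (continuous_fst.tendsto PH).comp h1
  have hl2 : Tendsto (fun τ => (γ τ).1) atTop (𝓝 (1 / √2)) := (continuous_fst.tendsto PM).comp h2
  obtain ⟨c, hc⟩ : (δ 0).1 ∈ Set.range fun τ => (γ τ).1 :=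
    mem_range_of_exists_le_of_exists_ge hcont
      ((hl1.eventually (gt_mem_nhds (ha' 0))).exists.imp fun _ h => h.le)
      ((hl2.eventually (lt_mem_nhds (fst_lt_of_mem_surfM (hM' 0) (ha' 0) (hb' 0)))).exists.imp
        fun _ h => h.le)
  refine ⟨c, fun τ => ?_⟩
  have heq : angle δ = fun τ => angle γ (τ + c) := by
    refine ODE_solution_unique_univ (v := fun _ => angleRate) (s := fun _ => Set.univ) (t₀ := 0)
      (fun _ => lipschitzWith_angleRate.lipschitzOnWith)
      (fun t => ⟨hasDerivAt_angle_schwarzschild hδ.1 hM' hy' t, trivial⟩)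
      (fun t => ⟨(hasDerivAt_angle_schwarzschild hγ.1 hM hy (t + c)).comp_add_const t c, trivial⟩) ?_
    simp only [angle, zero_add, ← hc]
  have heq' := congrFun heq τ
  obtain ⟨e1, e2⟩ := cos_sin_angle (hM' τ)
  obtain ⟨e3, e4⟩ := cos_sin_angle (hM (τ + c))
  rw [heq'] at e1 e2
  have ea := e1.symm.trans e3
  have eb := e2.symm.trans e4
  rw [ea] at eb
  ext
  · exact ea
  · exact add_left_cancel eb
  · rw [hy', hy]

/-- With Y₁ = 0 on M, B = X₂/(X₂ + 2X₃). The conserved quantity r X₃/(X₂ + 2X₃) is the mass, and N²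
(X₂ + 2X₃)/X₂ is the constant fixing the unit of time. -/
theorem Config.Traces.isSchwarzschild {S : Config} {V0 : ℝ} (hS : S.Traces V0 lam γ)
    (h : IsOrbit lam γ) (h1 : Tendsto γ atBot (𝓝 PH)) (h2 : Tendsto γ atTop (𝓝 PM)) :
    V0 = 0 ∧ S.IsSchwarzschild := by
  obtain ⟨hf, hM, ha, hb, hy⟩ := horizon_to_minkowski h h1 h2
  have hs := fun τ => ((mem_surfM_iff _).1 (hM τ)).1
  have hw : ∀ τ, 1 - normSq (γ τ) = (γ τ).1 * ((γ τ).1 + 2 * (γ τ).2.1) := fun τ => by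
    have := hs τ
    simp only [surf] at this
    simp only [normSq, hy τ]; linarith
  have hpos : ∀ τ, 0 < (γ τ).1 + 2 * (γ τ).2.1 := fun τ => by linarith [ha τ, hb τ]
  have hB : ∀ τ, S.metricB τ = (γ τ).1 / ((γ τ).1 + 2 * (γ τ).2.1) := fun τ => by
    rw [hS.metricB_eq hf, hw]
    have := (ha τ).ne'
    have := (hpos τ).ne'
    field_simp
  have hda := fun τ => hasDerivAt_fst_of_surf h.1 (hs τ)
  have hdb := fun τ => hasDerivAt_snd_of_surf h.1 (hs τ)
  have hm : ∀ τ, S.radius τ * (γ τ).2.1 / ((γ τ).1 + 2 * (γ τ).2.1)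
      = S.radius 0 * (γ 0).2.1 / ((γ 0).1 + 2 * (γ 0).2.1) := by
    have hd : ∀ τ, HasDerivAt
        (fun τ => S.radius τ * (γ τ).2.1 / ((γ τ).1 + 2 * (γ τ).2.1)) 0 τ := fun τ => by
      refine (((hS.radius_deriv τ).mul (hdb τ)).div ((hda τ).add ((hdb τ).const_mul 2))
        (hpos τ).ne').congr_deriv ?_
      have e := hs τ
      simp only [surf] at e
      rw [hw τ, div_eq_zero_iff]
      left
      simp only [Pi.mul_apply, Pi.add_apply]
      linear_combination (-S.radius τ * (γ τ).2.1 * (γ τ).1 * ((γ τ).1 + 2 * (γ τ).2.1)) * e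
    exact fun τ => is_const_of_deriv_eq_zero (fun τ => (hd τ).differentiableAt)
      (fun τ => (hd τ).deriv) τ 0
  have hl : ∀ τ, S.lapse τ ^ 2 * ((γ τ).1 + 2 * (γ τ).2.1) / (γ τ).1
      = S.lapse 0 ^ 2 * ((γ 0).1 + 2 * (γ 0).2.1) / (γ 0).1 := by
    have hd : ∀ τ, HasDerivAt
        (fun τ => S.lapse τ ^ 2 * ((γ τ).1 + 2 * (γ τ).2.1) / (γ τ).1) 0 τ := fun τ => by
      refine ((((hS.lapse_deriv τ).pow 2).mul ((hda τ).add ((hdb τ).const_mul 2))).div (hda τ)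
        (ha τ).ne').congr_deriv ?_
      have e := hs τ
      simp only [surf] at e
      rw [hw τ, div_eq_zero_iff]
      left
      simp only [Pi.mul_apply, Pi.add_apply, Pi.pow_apply]
      push_cast
      linear_combination (-2 * S.lapse τ ^ 2 * (γ τ).2.1 * (γ τ).1 * ((γ τ).1 + 2 * (γ τ).2.1)) * e
    exact fun τ => is_const_of_deriv_eq_zero (fun τ => (hd τ).differentiableAt)
      (fun τ => (hd τ).deriv) τ 0
  set m := S.radius 0 * (γ 0).2.1 / ((γ 0).1 + 2 * (γ 0).2.1) with hmdef
  have hm0 : 0 < m := div_pos (mul_pos (hS.radius_pos 0) (hb 0)) (hpos 0)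
  set k := S.lapse 0 ^ 2 * ((γ 0).1 + 2 * (γ 0).2.1) / (γ 0).1 with hk
  have hk0 : 0 < k := div_pos (mul_pos (pow_pos (hS.lapse_pos 0) 2) (hpos 0)) (ha 0)
  have hBm : ∀ τ, S.metricB τ = 1 - 2 * m / S.radius τ := fun τ => by
    rw [hB, ← hm τ]
    have := (hS.radius_pos τ).ne'
    have := (hpos τ).ne'
    field_simp; ring
  refine ⟨?_, m, hm0, √k, Real.sqrt_pos.2 hk0, fun τ => ⟨hBm τ, ?_⟩, ?_, ?_⟩
  · have hp := hS.potential 0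
    rw [hs 0, neg_zero] at hp
    have hw0 : 1 - normSq (γ 0) ≠ 0 := by have := hf 0; linarith
    have := (mul_eq_zero.1 hp).resolve_right hw0
    have := (mul_eq_zero.1 this).resolve_right (pow_pos (hS.radius_pos 0) 2).ne'
    exact (mul_eq_zero.1 this).resolve_right (Real.exp_pos _).ne'
  · rw [← hBm, Real.sq_sqrt hk0.le, hB, ← hl τ]
    have := (ha τ).ne'
    have := (hpos τ).ne'
    field_simp
  · have hr : ∀ τ, S.radius τ = m * ((γ τ).1 + 2 * (γ τ).2.1) / (γ τ).2.1 := fun τ => by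
      rw [← hm τ, div_mul_cancel₀ _ (hpos τ).ne', mul_div_cancel_right₀ _ (hb τ).ne']
    refine Set.Subset.antisymm ?_ fun x hx => ?_
    · rintro _ ⟨τ, rfl⟩
      rw [Set.mem_Ioi, hr, lt_div_iff₀ (hb τ)]
      nlinarith [mul_pos hm0 (ha τ)]
    · have hcont : Continuous S.radius :=
        continuous_iff_continuousAt.2 fun τ => (hS.radius_deriv τ).continuousAt
      have c1 : Continuous fun p : Pt => m * (p.1 + 2 * p.2.1) := by fun_prop
      have c2 : Continuous fun p : Pt => p.2.1 := by fun_prop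
      have hl1 : Tendsto S.radius atBot (𝓝 (2 * m)) := by
        have := ((c1.tendsto PH).comp h1).div ((c2.tendsto PH).comp h1) (by simp [PH])
        have e : m * (PH.1 + 2 * PH.2.1) / PH.2.1 = 2 * m := by simp [PH]; ring
        rw [e] at this
        exact this.congr fun τ => (hr τ).symm
      have hl2 : Tendsto S.radius atTop atTop := by
        have hb0 : Tendsto (fun τ => (γ τ).2.1) atTop (𝓝[>] 0) :=
          tendsto_nhdsWithin_iff.2 ⟨(c2.tendsto PM).comp h2, Eventually.of_forall hb⟩
        have e : 0 < m * (PM.1 + 2 * PM.2.1) := by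
          have := inv_sqrt_two_pos
          simp only [PM, mul_zero, add_zero]; positivity
        refine (((c1.tendsto PM).comp h2).pos_mul_atTop e hb0.inv_tendsto_nhdsGT_zero).congr
          fun τ => ?_
        rw [hr τ, div_eq_mul_inv]; rfl
      exact mem_range_of_exists_le_of_exists_ge hcont
        ((hl1.eventually (gt_mem_nhds hx)).exists.imp fun _ h => h.le)
        (hl2.eventually (eventually_ge_atTop x)).exists
  · refine ⟨S.scalar 0, fun τ => ?_⟩
    exact is_const_of_deriv_eq_zero (fun τ => (hS.scalar_deriv τ).differentiableAt)
      (fun τ => by rw [(hS.scalar_deriv τ).deriv, hy, mul_zero]) τ 0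

end

/-! ### Orbits with a positive potential -/

section

variable {lam : ℝ} {γ : ℝ → Pt}

theorem limit_atBot_of_neg (h : IsFlowLine lam γ) (hf : IsFinite γ) (hs : ∀ τ, surf (γ τ) < 0) :
    ∃ p, Tendsto γ atBot (𝓝 p) ∧
      (p = PM ∨ p ∈ critCurve ∨ (6 < lam ^ 2 ∧ p = Plam lam)) := by
  rcases exists_limit_atBot h hf (fun τ => (hs τ).le) with h1 | h1 | ⟨p, h1, h2⟩
  · exact ⟨PM, h1, Or.inl rfl⟩
  · exact absurd h1 (not_tendsto_PMbar_atBot h hs)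
  · exact ⟨p, h1, Or.inr h2⟩

theorem neg_eq_iff_Plam {p : Pt} : -p = Plam lam ↔ p = PlamBar lam := by
  rw [← neg_Plam, neg_eq_iff_eq_neg]

theorem neg_eq_PM_iff {p : Pt} : -p = PM ↔ p = PMbar := by rw [← neg_PM, neg_eq_iff_eq_neg]

theorem neg_eq_PH_iff {p : Pt} : -p = PH ↔ p = PHbar := by rw [← neg_PH, neg_eq_iff_eq_neg]

theorem limit_atTop_of_neg (h : IsFlowLine lam γ) (hf : IsFinite γ) (hs : ∀ τ, surf (γ τ) < 0) :
    ∃ q, Tendsto γ atTop (𝓝 q) ∧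
      (q = PMbar ∨ q ∈ critCurveBar ∨ (6 < lam ^ 2 ∧ q = PlamBar lam)) := by
  obtain ⟨p, h1, h2⟩ := limit_atBot_of_neg h.neg hf.neg fun τ => by rw [surf_neg]; exact hs _
  refine ⟨-p, by simpa using tendsto_neg_of_atBot h1, ?_⟩
  rw [← neg_eq_PM_iff, ← neg_eq_iff_Plam, mem_critCurveBar_iff_neg, neg_neg]
  exact h2

/-- `X₂`, up to a positive factor, decreases strictly. -/
theorem exists_strictAnti_fst (h : IsFlowLine lam γ) (hs : ∀ τ, surf (γ τ) < 0) (hlam : lam ≠ 0) :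
    ∃ E : ℝ → ℝ, (∀ τ, 0 < E τ) ∧ StrictAnti fun τ => (γ τ).1 * E τ := by
  have hc := h.continuous
  have hg := continuous_growth lam
  -- On a finite orbit traced by a metric, X₂ E is a constant multiple of x₂/N.
  obtain ⟨E, hE, hEd⟩ := exists_integratingFactor
    (g := fun τ => growth lam (γ τ) - (γ τ).2.1) (by fun_prop)
  have hd : ∀ τ, HasDerivAt (fun τ => (γ τ).1 * E τ) (-((γ τ).2.2 ^ 2 * E τ)) τ := fun τ =>
    ((h.hasDerivAt_fst τ).mul (hEd τ)).congr_deriv (by ring)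
  have hanti := antitone_of_hasDerivAt hd fun τ =>
    neg_nonpos.2 (mul_nonneg (sq_nonneg _) (hE τ).le)
  refine ⟨E, hE, fun s t hst => lt_of_le_of_ne (hanti hst.le) fun heq => ?_⟩
  simp only at heq
  -- Equal values at s and t would make Y₁ vanish between them; its equation then reduces to λ ·
  -- surf = 0.
  have hconst : ∀ x ∈ Set.Ioo s t, (γ x).2.2 = 0 := fun x hx => by
    have hev : (fun τ => (γ τ).1 * E τ) =ᶠ[𝓝 x] fun _ => (γ s).1 * E s := by
      filter_upwards [Ioo_mem_nhds hx.1 hx.2] with y hy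
      exact le_antisymm (hanti hy.1.le) (heq ▸ hanti hy.2.le)
    have h0 := (hd x).unique ((hasDerivAt_const x _).congr_of_eventuallyEq hev)
    have := (mul_eq_zero.1 (neg_eq_zero.1 h0)).resolve_right (hE x).ne'
    exact pow_eq_zero_iff two_ne_zero |>.1 this
  obtain ⟨x, hx⟩ := exists_between hst
  have hev : (fun τ => (γ τ).2.2) =ᶠ[𝓝 x] fun _ => 0 := by
    filter_upwards [Ioo_mem_nhds hx.1 hx.2] with y hy using hconst y hy
  have h0 := (h.hasDerivAt_trd x).unique ((hasDerivAt_const x _).congr_of_eventuallyEq hev)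
  rw [hconst x hx] at h0
  have h1 : lam / √2 * surf (γ x) = 0 := by linarith
  have h2 : lam / √2 ≠ 0 := div_ne_zero hlam (by positivity)
  exact (hs x).ne ((mul_eq_zero.1 h1).resolve_left h2)

theorem fst_trichotomy (h : IsFlowLine lam γ) (hs : ∀ τ, surf (γ τ) < 0) (hlam : lam ≠ 0) :
    (∃ τ₀, (γ τ₀).1 = 0 ∧ (∀ τ < τ₀, 0 < (γ τ).1) ∧ ∀ τ > τ₀, (γ τ).1 < 0) ∨
      (∀ τ, 0 < (γ τ).1) ∨ ∀ τ, (γ τ).1 < 0 := by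
  obtain ⟨E, hE, hanti⟩ := exists_strictAnti_fst h hs hlam
  have hpos : ∀ {s t}, s < t → 0 ≤ (γ t).1 → 0 < (γ s).1 := fun {s t} hst ht => by
    have h1 : 0 < (γ s).1 * E s := (mul_nonneg ht (hE t).le).trans_lt (hanti hst)
    exact (mul_pos_iff_of_pos_right (hE s)).1 h1
  have hneg : ∀ {s t}, s < t → (γ s).1 ≤ 0 → (γ t).1 < 0 := fun {s t} hst hs' => by
    by_contra hcon
    exact absurd hs' (not_le.2 (hpos hst (not_lt.1 hcon)))
  by_cases h0 : ∃ τ, (γ τ).1 = 0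
  · obtain ⟨τ, h0⟩ := h0
    exact Or.inl ⟨τ, h0, fun t ht => hpos ht h0.ge, fun t ht => hneg ht h0.le⟩
  · push Not at h0
    have hc : Continuous fun τ => (γ τ).1 := continuous_fst.comp h.continuous
    right
    by_contra hcon
    push Not at hcon
    obtain ⟨⟨s, hs'⟩, t, ht⟩ := hcon
    obtain ⟨x, hx⟩ := mem_range_of_exists_le_of_exists_ge hc ⟨s, hs'⟩ ⟨t, ht⟩
    exact h0 x hx

/-! ### The charge of the scaling symmetry -/

/-- Because V' = -λV, the source terms in the equations for Y₁ and X₃ are proportional and cancel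
here. The resulting equation is linear, so the charge never changes sign. -/
theorem hasDerivAt_charge (h : IsFlowLine lam γ) (τ : ℝ) :
    HasDerivAt (fun t => (γ t).2.2 - lam / √2 * (γ t).2.1)
      (-((γ τ).1 + (γ τ).2.1 + growth lam (γ τ)) * ((γ τ).2.2 - lam / √2 * (γ τ).2.1)) τ :=
  ((h.hasDerivAt_trd τ).sub ((h.hasDerivAt_snd τ).const_mul (lam / √2))).congr_deriv (by ring)

theorem continuous_charge_rate (h : IsFlowLine lam γ) :
    Continuous fun τ => -((γ τ).1 + (γ τ).2.1 + growth lam (γ τ)) := by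
  have := h.continuous
  have := continuous_growth lam
  fun_prop

theorem eventually_rate_PM (hl : Tendsto γ atBot (𝓝 PM)) :
    ∃ T, ∀ t ≤ T, 0 < (γ t).1 + (γ t).2.1 + growth lam (γ t) := by
  have hg := continuous_growth lam
  have hc : Continuous fun p : Pt => p.1 + p.2.1 + growth lam p := by fun_prop
  have hpos : 0 < PM.1 + PM.2.1 + growth lam PM := by
    rw [growth_PM]; simp [PM]
  exact eventually_atBot.1 (((hc.tendsto PM).comp hl).eventually (lt_mem_nhds hpos))

/-- Near P_M the square of the charge does not increase in τ; since it starts from the limit 0, it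
vanishes. -/
theorem charge_eq_zero_of_PM (h : IsFlowLine lam γ) (hl : Tendsto γ atBot (𝓝 PM)) (τ : ℝ) :
    (γ τ).2.2 - lam / √2 * (γ τ).2.1 = 0 := by
  obtain ⟨T, hT⟩ := eventually_rate_PM (lam := lam) hl
  have hmono := monotoneOn_Iic_of_hasDerivAt (T := T)
    (fun t _ => ((hasDerivAt_charge h t).pow 2).neg) fun t ht => by
      have h1 := hT t ht
      have h2 := mul_nonneg h1.le (sq_nonneg ((γ t).2.2 - lam / √2 * (γ t).2.1))
      push_cast
      simp only [pow_one]
      linarith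
  have hlim : Tendsto (fun t => ((γ t).2.2 - lam / √2 * (γ t).2.1) ^ 2) atBot (𝓝 0) := by
    have hc : Continuous fun p : Pt => (p.2.2 - lam / √2 * p.2.1) ^ 2 := by fun_prop
    have := (hc.tendsto PM).comp hl
    simpa [PM, Function.comp_def] using this
  have h0 : ((γ T).2.2 - lam / √2 * (γ T).2.1) ^ 2 ≤ 0 :=
    ge_of_tendsto hlim ((eventually_le_atBot T).mono fun t ht =>
      neg_le_neg_iff.1 (hmono ht (Set.mem_Iic.2 le_rfl) ht))
  exact linear_eq_zero (continuous_charge_rate h) (hasDerivAt_charge h)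
    (pow_eq_zero_iff two_ne_zero |>.1 (le_antisymm h0 (sq_nonneg _))) τ

theorem exists_strictAnti_snd (h : IsFlowLine lam γ) (hs : ∀ τ, surf (γ τ) < 0) :
    ∃ E : ℝ → ℝ, (∀ τ, 0 < E τ) ∧ StrictAnti fun τ => (γ τ).2.1 * E τ := by
  obtain ⟨E, hE, hEd⟩ := exists_integratingFactor (continuous_charge_rate h).neg
  have hd : ∀ τ, HasDerivAt (fun τ => (γ τ).2.1 * E τ) (surf (γ τ) * E τ) τ := fun τ =>
    ((h.hasDerivAt_snd τ).mul (hEd τ)).congr_deriv (by simp only [Pi.neg_apply]; ring)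
  refine ⟨E, hE, strictAnti_of_deriv_neg fun τ => ?_⟩
  rw [(hd τ).deriv]
  exact mul_neg_of_neg_of_pos (hs τ) (hE τ)

/-- A positive X₃ would have been positive at all earlier times and decreasing near P_M, contrary to
its limit 0 there. -/
theorem snd_nonpos_of_PM (h : IsFlowLine lam γ) (hs : ∀ τ, surf (γ τ) < 0)
    (hl : Tendsto γ atBot (𝓝 PM)) (τ : ℝ) : (γ τ).2.1 ≤ 0 := by
  by_contra hcon
  push Not at hcon
  obtain ⟨E, hE, hanti⟩ := exists_strictAnti_snd h hs
  have hpos : ∀ t ≤ τ, 0 < (γ t).2.1 := fun t ht => by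
    have h1 : 0 < (γ t).2.1 * E t := (mul_pos hcon (hE τ)).trans_le (hanti.antitone ht)
    exact (mul_pos_iff_of_pos_right (hE t)).1 h1
  obtain ⟨T, hT⟩ := eventually_rate_PM (lam := lam) hl
  have hmono := monotoneOn_Iic_of_hasDerivAt (T := min T τ)
    (fun t _ => (h.hasDerivAt_snd t).neg) fun t ht => by
      have h1 := mul_pos (hT t (ht.trans (min_le_left _ _))) (hpos t (ht.trans (min_le_right _ _)))
      linarith [hs t]
  have hlim : Tendsto (fun t => (γ t).2.1) atBot (𝓝 0) :=
    ((continuous_fst.comp continuous_snd).tendsto PM).comp hl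
  have h0 : (γ (min T τ)).2.1 ≤ 0 :=
    ge_of_tendsto hlim ((eventually_le_atBot (min T τ)).mono fun t ht =>
      neg_le_neg_iff.1 (hmono ht (Set.mem_Iic.2 le_rfl) ht))
  linarith [hpos _ (min_le_right T τ)]

theorem charge_tendsto {l : Filter ℝ} {p : Pt} (hl : Tendsto γ l (𝓝 p)) :
    Tendsto (fun t => (γ t).2.2 - lam / √2 * (γ t).2.1) l (𝓝 (p.2.2 - lam / √2 * p.2.1)) := by
  have hc : Continuous fun p : Pt => p.2.2 - lam / √2 * p.2.1 := by fun_prop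
  exact (hc.tendsto p).comp hl

theorem not_PM_PHbar (h : IsFlowLine lam γ) (hlam : lam ≠ 0) (h1 : Tendsto γ atBot (𝓝 PM)) :
    ¬ Tendsto γ atTop (𝓝 PHbar) := fun h2 => by
  have h3 := charge_tendsto (lam := lam) h2
  simp only [charge_eq_zero_of_PM h h1] at h3
  have h4 := tendsto_nhds_unique tendsto_const_nhds h3
  have h5 : lam / √2 ≠ 0 := div_ne_zero hlam (by positivity)
  simp only [PHbar] at h4
  exact h5 (by linarith)

/-- The ends of an orbit with positive potential cannot both be regular. -/
theorem not_both_regular (h : IsFlowLine lam γ) (hs : ∀ τ, surf (γ τ) < 0) (hlam : lam ≠ 0)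
    {p q : Pt} (hp : Tendsto γ atBot (𝓝 p)) (hq : Tendsto γ atTop (𝓝 q)) :
    ¬ ((p = PM ∨ p = PH) ∧ (q = PMbar ∨ q = PHbar)) := by
  have hs' : ∀ τ, surf (-γ (-τ)) < 0 := fun τ => by rw [surf_neg]; exact hs _
  rintro ⟨rfl | rfl, rfl | rfl⟩
  -- X₃ ≤ 0 from P_M and X₃ ≥ 0 from the reversed orbit make X₃ identically zero, against its strict
  -- decrease up to a positive factor.
  · have h1 := snd_nonpos_of_PM h hs hp
    have h2 := snd_nonpos_of_PM h.neg hs' (by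
      have := tendsto_neg_of_atTop hq
      rwa [neg_PMbar] at this)
    obtain ⟨E, hE, hanti⟩ := exists_strictAnti_snd h hs
    have h3 : ∀ τ, (γ τ).2.1 = 0 := fun τ => by
      have := h2 (-τ)
      simp only [neg_neg, Prod.snd_neg, Prod.fst_neg] at this
      linarith [h1 τ]
    have := hanti (zero_lt_one (α := ℝ))
    simp only [h3, zero_mul, lt_irrefl] at this
  · exact not_PM_PHbar h hlam hp hq
  · refine not_PM_PHbar h.neg hlam ?_ (by rw [← neg_PH]; exact tendsto_neg_of_atBot hp)
    have := tendsto_neg_of_atTop hq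
    rwa [neg_PMbar] at this
  -- The charge is -λ/√2 at P_H and +λ/√2 at the opposite point, although its sign is constant.
  -- Multiplying by ∓λ/√2 treats both signs of λ at once.
  · have h5 : lam / √2 ≠ 0 := div_ne_zero hlam (by positivity)
    have h6 : 0 < (lam / √2) ^ 2 := by positivity
    have h1 := (charge_tendsto (lam := lam) hp).const_mul (-(lam / √2))
    have h2 := (charge_tendsto (lam := lam) hq).const_mul (lam / √2)
    have e1 : 0 < -(lam / √2) * (PH.2.2 - lam / √2 * PH.2.1) := by
      simp only [PH]; linarith
    have e2 : 0 < lam / √2 * (PHbar.2.2 - lam / √2 * PHbar.2.1) := by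
      simp only [PHbar]; linarith
    obtain ⟨s, hs1⟩ := (h1.eventually (lt_mem_nhds e1)).exists
    obtain ⟨t, ht1⟩ := (h2.eventually (lt_mem_nhds e2)).exists
    obtain ⟨c, hc, hst⟩ := exists_pos_mul_of_linear Set.ordConnected_univ
      (continuous_charge_rate h).continuousOn (fun t _ => (hasDerivAt_charge h t).hasDerivWithinAt)
      (Set.mem_univ s) (Set.mem_univ t)
    rw [hst] at ht1
    have := mul_pos hc hs1
    linarith

/-! ### The radius along the orbits -/

/-- All candidates at +∞ have X₂ ≤ 0, with equality only at the dual horizon point. -/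
theorem limit_of_fst_pos {q : Pt} (ha : ∀ τ, 0 < (γ τ).1) (hl : Tendsto γ atTop (𝓝 q))
    (hq : q = PMbar ∨ q ∈ critCurveBar ∨ (6 < lam ^ 2 ∧ q = PlamBar lam)) : q = PHbar := by
  have h0 : 0 ≤ q.1 := ge_of_tendsto' ((continuous_fst.tendsto q).comp hl) fun τ => (ha τ).le
  rcases hq with rfl | hq | ⟨-, rfl⟩
  · have := inv_sqrt_two_pos
    simp only [PMbar] at h0; linarith
  · rw [mem_critCurveBar_iff_neg] at hq
    have h1 := fst_nonneg_of_mem_surfM hq.1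
    rw [← neg_eq_PH_iff]
    refine eq_PH_of_mem_critCurve hq ?_
    simp only [Prod.fst_neg] at h1 ⊢
    linarith
  · have := Plam_fst_pos lam
    rw [← neg_Plam] at h0
    simp only [Prod.fst_neg] at h0
    linarith

end

namespace Config

variable {S : Config} {V0 lam : ℝ} {γ : ℝ → Pt}

theorem Traces.horizon_atTop (hS : S.Traces V0 lam γ) (h : IsFlowLine lam γ)
    (ha : ∀ τ, 0 < (γ τ).1) (hl : Tendsto γ atTop (𝓝 PHbar)) :
    StrictMono S.radius ∧ (∃ rH > 0, Tendsto S.radius atTop (𝓝 rH)) ∧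
      Tendsto S.lapse atTop (𝓝 0) := by
  have hmono : StrictMono S.radius := strictMono_of_deriv_pos fun τ => by
    rw [(hS.radius_deriv τ).deriv]; exact mul_pos (ha τ) (hS.radius_pos τ)
  refine ⟨hmono, ?_, ?_⟩
  · have hg := continuous_growth lam
    have hc : Continuous fun p : Pt => p.2.1 - growth lam p := by fun_prop
    have hv : PHbar.2.1 - growth lam PHbar < -1 := by
      rw [← neg_PH, growth_neg, growth_PH]; simp [PH]
    obtain ⟨T, hT⟩ := eventually_atTop.1
      (((hc.tendsto PHbar).comp hl).eventually (gt_mem_nhds hv))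
    -- X₃ - growth → -2 at the dual horizon point, so eventually X₂' ≤ -X₂ and r exp X₂ does not
    -- increase; this bounds r.
    have hanti := antitoneOn_Ici_of_hasDerivAt (T := T)
      (f := fun τ => S.radius τ * Real.exp (γ τ).1)
      (fun t _ => (hS.radius_deriv t).mul (h.hasDerivAt_fst t).exp) fun t ht => by
        have h1 := hT t ht
        simp only [Function.comp_apply] at h1
        have h2 := mul_pos (hS.radius_pos t) (Real.exp_pos (γ t).1)
        have h3 : (γ t).1 + ((γ t).1 * (γ t).2.1 - (γ t).2.2 ^ 2 - growth lam (γ t) * (γ t).1)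
            ≤ 0 := by
          nlinarith [ha t, sq_nonneg (γ t).2.2]
        have h4 := mul_nonneg h2.le (neg_nonneg.2 h3)
        linarith
    have hb : BddAbove (Set.range S.radius) := by
      refine ⟨S.radius T * Real.exp (γ T).1, ?_⟩
      rintro _ ⟨t, rfl⟩
      have h1 : S.radius (max t T) * Real.exp (γ (max t T)).1 ≤ S.radius T * Real.exp (γ T).1 :=
        hanti (Set.mem_Ici.2 le_rfl) (Set.mem_Ici.2 (le_max_right _ _)) (le_max_right _ _)
      have h2 := hmono.monotone (le_max_left t T)
      have h3 : 1 ≤ Real.exp (γ (max t T)).1 := Real.one_le_exp (ha _).le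
      have h4 := hS.radius_pos (max t T)
      nlinarith
    exact ⟨_, (hS.radius_pos 0).trans_le (le_ciSup hb 0), tendsto_atTop_ciSup hmono.monotone hb⟩
  · refine tendsto_neg_neg_atTop (exp_decay_atBot (g := fun τ => -(γ (-τ)).2.1) one_pos
      (fun t => hS.lapse_pos _) (fun t => ?_) ?_).1
    · exact (hasDerivAt_comp_neg (hS.lapse_deriv (-t))).congr_deriv (by ring)
    · have := (((continuous_fst.comp continuous_snd).tendsto PHbar).comp hl).comp
        tendsto_neg_atBot_atTop |>.neg
      simpa [PHbar, Function.comp_def] using this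

theorem Traces.horizon_atBot (hS : S.rev.Traces V0 lam fun τ => -γ (-τ)) (h : IsFlowLine lam γ)
    (ha : ∀ τ, (γ τ).1 < 0) (hl : Tendsto γ atBot (𝓝 PH)) :
    StrictAnti S.radius ∧ (∃ rH > 0, Tendsto S.radius atBot (𝓝 rH)) ∧
      Tendsto S.lapse atBot (𝓝 0) := by
  obtain ⟨h1, ⟨rH, hr, h2⟩, h3⟩ := hS.horizon_atTop h.neg
    (fun τ => by simpa using ha (-τ)) (by rw [← neg_PH]; exact tendsto_neg_of_atBot hl)
  refine ⟨fun s t hst => ?_, ⟨rH, hr, ?_⟩, ?_⟩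
  · simpa [rev] using h1 (neg_lt_neg hst)
  · simpa [rev, Function.comp_def] using h2.comp tendsto_neg_atBot_atTop
  · simpa [rev, Function.comp_def] using h3.comp tendsto_neg_atBot_atTop

theorem Traces.maximum_radius (hS : S.Traces V0 lam γ) (h : IsFlowLine lam γ) (hf : IsFinite γ)
    {τ₀ : ℝ} (h0 : (γ τ₀).1 = 0) (h1 : ∀ τ < τ₀, 0 < (γ τ).1) (h2 : ∀ τ > τ₀, (γ τ).1 < 0) :
    (∀ τ, τ ≠ τ₀ → S.radius τ < S.radius τ₀) ∧ S.x2 τ₀ = 0 ∧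
      S.normDeriv S.x2 τ₀ = -S.y1 τ₀ ^ 2 ∧ ¬ S.FlareOut τ₀ := by
  have hcont : Continuous S.radius :=
    continuous_iff_continuousAt.2 fun τ => (hS.radius_deriv τ).continuousAt
  have hsol := hS.isSolution h hf
  have hr := hS.radius_pos τ₀
  have hd := hS.density_pos hf τ₀
  have hx2 : S.x2 τ₀ = 0 := by rw [hS.x2_eq, h0, zero_div]
  have hx2d := hsol.hasDerivAt_x2 τ₀
  rw [hx2, zero_mul, zero_sub] at hx2d
  refine ⟨fun τ hτ => ?_, hx2, ?_, fun hfl => ?_⟩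
  · rcases lt_or_gt_of_ne hτ with hlt | hgt
    · refine strictMonoOn_of_deriv_pos (convex_Iic τ₀) hcont.continuousOn (fun t ht => ?_)
        (Set.mem_Iic.2 hlt.le) (Set.mem_Iic.2 le_rfl) hlt
      rw [interior_Iic] at ht
      rw [(hS.radius_deriv t).deriv]
      exact mul_pos (h1 t ht) (hS.radius_pos t)
    · refine strictAntiOn_of_deriv_neg (convex_Ici τ₀) hcont.continuousOn (fun t ht => ?_)
        (Set.mem_Ici.2 le_rfl) (Set.mem_Ici.2 hgt.le) hgt
      rw [interior_Ici] at ht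
      rw [(hS.radius_deriv t).deriv]
      exact mul_neg_of_neg_of_pos (h2 t ht) (hS.radius_pos t)
  · rw [normDeriv, hat_eq_of_hasDerivAt hx2d, sqrt_gaussK hr]
    field_simp
  · have hfun : S.hat S.radius = S.x2 := funext fun t => (Config.x2_eq (hS.radius_pos t)).symm
    -- At x₂ = 0 the root is stationary and equal to 1, so the flare-out quantity has the sign of
    -- x₂', which is nonpositive.
    have hdiv : HasDerivAt (fun t => S.x2 t / √(1 - S.x2 t ^ 2))
        (S.density τ₀ / S.radius τ₀ * -S.y1 τ₀ ^ 2) τ₀ := by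
      have hne : (1 : ℝ) - S.x2 τ₀ ^ 2 ≠ 0 := by rw [hx2]; norm_num
      refine (hx2d.div (((hx2d.pow 2).const_sub 1).sqrt hne)
        (by simp [hx2])).congr_deriv ?_
      simp [hx2]
    have h3 := hfl.2
    rw [hfun] at h3
    rw [hat_eq_of_hasDerivAt hdiv, hx2] at h3
    norm_num at h3
    have h4 : 0 ≤ S.density τ₀ / S.radius τ₀ * S.y1 τ₀ ^ 2 / S.density τ₀ := by positivity
    rw [neg_div] at h3
    linarith

theorem Traces.naked_atBot (hS : S.Traces V0 lam γ) (h : IsFlowLine lam γ) (hf : IsFinite γ)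
    {p : Pt} (hl : Tendsto γ atBot (𝓝 p))
    (hp : p = PM ∨ p ∈ critCurve ∨ (6 < lam ^ 2 ∧ p = Plam lam)) :
    p = PM ∨ p = PH ∨ S.NakedSingularity atBot := by
  rcases hp with hp | hp | ⟨hlam, rfl⟩
  · exact Or.inl hp
  · by_cases hne : p = PH
    · exact Or.inr (Or.inl hne)
    · exact Or.inr (Or.inr (hS.nakedSingularity_of_critCurve h hf hl hp hne))
  · exact Or.inr (Or.inr (hS.nakedSingularity_of_Plam h hf hl hlam))

theorem naked_atTop (hS : S.rev.Traces V0 lam fun τ => -γ (-τ)) (h : IsFlowLine lam γ)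
    (hf : IsFinite γ) {q : Pt} (hl : Tendsto γ atTop (𝓝 q))
    (hq : q = PMbar ∨ q ∈ critCurveBar ∨ (6 < lam ^ 2 ∧ q = PlamBar lam)) :
    q = PMbar ∨ q = PHbar ∨ S.NakedSingularity atTop := by
  have := hS.naked_atBot h.neg hf.neg (tendsto_neg_of_atTop hl)
    (by rwa [neg_eq_PM_iff, neg_eq_iff_Plam, ← mem_critCurveBar_iff_neg])
  rw [neg_eq_PM_iff, neg_eq_PH_iff] at this
  exact this.imp id (Or.imp id NakedSingularity.of_rev)

end Config

/-! ### The anti-de Sitter points -/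

section

variable {lam : ℝ} {γ : ℝ → Pt}

theorem neg_PAdS : -PAdS = PAdSbar := by
  simp only [PAdS, PAdSbar, Prod.neg_mk, neg_zero]

theorem field_PAdS_trd_ne_zero (hlam : lam ≠ 0) : (field lam PAdS).2.2 ≠ 0 := by
  have h1 : lam / √2 ≠ 0 := div_ne_zero hlam (by positivity)
  have h2 : surf PAdS = 3 / 2 := by
    have h3 := inv_sqrt_two_sq
    simp only [surf, PAdS]
    linarith
  rw [field_trd, h2]
  simp only [PAdS, mul_zero, neg_zero, zero_add, sub_zero]
  exact mul_ne_zero h1 (by norm_num)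

/-- A flow line converges only to critical points. -/
theorem field_trd_eq_zero_of_tendsto_atTop (h : IsFlowLine lam γ) {p : Pt}
    (hl : Tendsto γ atTop (𝓝 p)) : (field lam p).2.2 = 0 := by
  have hc : Continuous fun p => (field lam p).2.2 := by
    have := continuous_field lam
    fun_prop
  have hc' : Continuous fun p : Pt => p.2.2 := by fun_prop
  refine limit_deriv_eq_zero_atTop (T := 0) (f' := fun t => (field lam (γ t)).2.2)
    (fun t _ => ?_) ((hc'.tendsto p).comp hl) ((hc.tendsto p).comp hl)
  simp only [field_trd]
  exact h.hasDerivAt_trd t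

theorem not_tendsto_PAdS (h : IsFlowLine lam γ) (hlam : lam ≠ 0) :
    ¬ Tendsto γ atTop (𝓝 PAdS) ∧ ¬ Tendsto γ atTop (𝓝 PAdSbar) :=
  ⟨fun hl => field_PAdS_trd_ne_zero hlam (field_trd_eq_zero_of_tendsto_atTop h hl), fun hl => by
    have := field_trd_eq_zero_of_tendsto_atTop h hl
    rw [← neg_PAdS, field_neg] at this
    exact field_PAdS_trd_ne_zero hlam this⟩

end

namespace Config

variable {S : Config} {V0 lam : ℝ}

/-- The charge of the scaling symmetry is conserved. -/
theorem IsSolution.exists_charge (h : S.IsSolution (expPotential V0 lam)) :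
    ∃ c, ∀ τ, (S.y1 τ - lam / √2 * S.x3 τ) * (S.radius τ * S.lapse τ) = c := by
  have hd : ∀ τ, HasDerivAt
      (fun τ => (S.y1 τ - lam / √2 * S.x3 τ) * (S.radius τ * S.lapse τ)) 0 τ := fun τ => by
    have h1 := h.hasDerivAt_y1 τ
    rw [deriv_expPotential] at h1
    refine ((h1.sub ((h.hasDerivAt_x3 τ).const_mul (lam / √2))).mul
      ((h.hasDerivAt_radius τ).mul (h.hasDerivAt_lapse τ))).congr_deriv ?_
    simp only [Pi.sub_apply, Pi.mul_apply]
    ring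
  exact ⟨_, fun τ => is_const_of_deriv_eq_zero (fun t => (hd t).differentiableAt)
    (fun t => (hd t).deriv) τ 0⟩

/-- Without zeros x₂ keeps its sign eventually, and a negative one would keep r from growing. -/
theorem IsSolution.eventually_x2_pos {V : ℝ → ℝ} (h : S.IsSolution V)
    (hr : Tendsto S.radius atTop atTop) (hx : ∀ᶠ τ in atTop, S.x2 τ ≠ 0) :
    ∀ᶠ τ in atTop, 0 < S.x2 τ := by
  obtain ⟨T, hT⟩ := eventually_atTop.1 hx
  have hc : Continuous S.x2 :=
    continuous_iff_continuousAt.2 fun τ => (h.hasDerivAt_x2 τ).continuousAt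
  filter_upwards [eventually_ge_atTop T] with s hs
  by_contra hcon
  have hneg : ∀ t ≥ s, S.x2 t ≤ 0 := fun t ht => by
    by_contra hpos
    obtain ⟨x, hx, hx0⟩ := intermediate_value_Icc ht hc.continuousOn
      (show (0 : ℝ) ∈ Set.Icc (S.x2 s) (S.x2 t) from ⟨not_lt.1 hcon, (not_le.1 hpos).le⟩)
    exact hT x (hs.trans hx.1) hx0
  have hanti := antitoneOn_Ici_of_hasDerivAt (T := s) (fun t _ => h.hasDerivAt_radius t)
    fun t ht => by
      have h1 := h.radius_pos t
      have h2 := h.density_pos t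
      exact mul_nonpos_of_nonpos_of_nonneg
        (mul_nonpos_of_nonneg_of_nonpos (by positivity) (hneg t ht)) h1.le
  obtain ⟨t, ht1, ht2⟩ := ((hr.eventually_gt_atTop (S.radius s)).and
    (eventually_ge_atTop s)).exists
  exact absurd (hanti (Set.mem_Ici.2 le_rfl) (Set.mem_Ici.2 ht2) ht2) (not_le.2 ht1)

theorem IsSolution.not_asymptoticallyAdS_atTop (h : S.IsSolution (expPotential V0 lam))
    (hlam : lam ≠ 0) : ¬ S.AsymptoticallyAdS atTop := by
  rintro ⟨hr, ⟨L, hL, hB⟩, hA⟩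
  have hL2 : 0 < 1 / L ^ 2 := by positivity
  have hμ : 0 < (lam / √2) ^ 2 := by
    have : lam / √2 ≠ 0 := div_ne_zero hlam (by positivity)
    positivity
  have hB' : Tendsto (fun τ => S.x2 τ ^ 2 / S.radius τ ^ 2) atTop (𝓝 (1 / L ^ 2)) :=
    hB.congr fun τ => by rw [Config.x2_eq (h.radius_pos τ), metricB]
  have hX0 : ∀ᶠ τ in atTop, S.x2 τ ≠ 0 := by
    filter_upwards [hB'.eventually (lt_mem_nhds hL2)] with τ hτ h0
    simp [h0] at hτ
  have hXpos := h.eventually_x2_pos hr hX0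
  have hZX : Tendsto (fun τ => S.x3 τ / S.x2 τ) atTop (𝓝 1) := by
    have := hA.div_const 2
    rw [div_self two_ne_zero] at this
    refine this.congr fun τ => ?_
    have h1 := (h.radius_pos τ).ne'
    rw [Config.x3_eq (h.radius_pos τ), Config.x2_eq (h.radius_pos τ)]
    by_cases h0 : S.hat S.radius τ = 0
    · simp [h0]
    · field_simp
  obtain ⟨c, hc⟩ := h.exists_charge
  obtain ⟨T, hT⟩ := eventually_atTop.1 (hXpos.and (hZX.eventually (lt_mem_nhds zero_lt_one)))
  have hmono : ∀ t ≥ T, S.radius T * S.lapse T ≤ S.radius t * S.lapse t := fun t ht => by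
    have := antitoneOn_Ici_of_hasDerivAt (T := T)
      (fun t _ => ((h.hasDerivAt_radius t).mul (h.hasDerivAt_lapse t)).neg) (fun t ht => by
        have h1 := h.radius_pos t
        have h2 := h.density_pos t
        have h3 := h.lapse_pos t
        have h4 := (hT t ht).1
        have h5 := (div_pos_iff_of_pos_right h4).1 (hT t ht).2
        exact neg_nonpos.2 (by positivity)) (Set.mem_Ici.2 le_rfl) (Set.mem_Ici.2 ht) ht
    exact neg_le_neg_iff.1 this
  have hX2 : Tendsto (fun τ => S.x2 τ ^ 2) atTop atTop := by
    refine (hB'.pos_mul_atTop hL2 ((tendsto_pow_atTop two_ne_zero).comp hr)).congr fun τ => ?_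
    have h1 := (h.radius_pos τ).ne'
    simp only [Function.comp_apply]
    field_simp
  -- The charge is constant and r N does not decrease near the end, so y₁ - μ x₃ stays bounded while
  -- x₂ → ∞.
  have hu : Tendsto (fun τ => (S.y1 τ - lam / √2 * S.x3 τ) / S.x2 τ) atTop (𝓝 0) := by
    refine tendsto_zero_of_sq ?_
    refine squeeze_zero' (Eventually.of_forall fun τ => sq_nonneg _) ?_
      (hX2.const_div_atTop ((c / (S.radius T * S.lapse T)) ^ 2))
    filter_upwards [eventually_ge_atTop T] with t ht
    have h1 : 0 < S.radius T * S.lapse T := mul_pos (h.radius_pos T) (h.lapse_pos T)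
    rw [div_pow]
    refine div_le_div_of_nonneg_right ?_ (sq_nonneg _)
    rw [div_pow, le_div_iff₀ (pow_pos h1 2), ← hc t, mul_pow (S.y1 t - _)]
    exact mul_le_mul_of_nonneg_left (pow_le_pow_left₀ h1.le (hmono t ht) 2) (sq_nonneg _)
  have hYX : Tendsto (fun τ => S.y1 τ / S.x2 τ) atTop (𝓝 (lam / √2)) := by
    have := hu.add (hZX.const_mul (lam / √2))
    rw [zero_add, mul_one] at this
    exact this.congr fun τ => by ring
  have hq : Tendsto (fun τ => S.x3 τ / S.x2 τ - (S.y1 τ / S.x2 τ) ^ 2 - 1) atTop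
      (𝓝 (1 - (lam / √2) ^ 2 - 1)) := (hZX.sub (hYX.pow 2)).sub_const 1
  obtain ⟨T', hT'⟩ := eventually_atTop.1 (hXpos.and (hq.eventually
    (gt_mem_nhds (show 1 - (lam / √2) ^ 2 - 1 < -((lam / √2) ^ 2 / 2) by linarith))))
  -- d ln x₂ / d ln r = x₃/x₂ - (y₁/x₂)² → 1 - μ², so x₂ is at most of order r^(1 - μ²/2), whereas
  -- an anti-de Sitter end needs x₂ of order r.
  have hanti := antitoneOn_Ici_of_hasDerivAt (T := T')
    (f := fun τ => Real.log (S.x2 τ) - (1 - (lam / √2) ^ 2 / 2) * Real.log (S.radius τ))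
    (f' := fun τ => S.density τ / S.radius τ * S.x2 τ *
      (S.x3 τ / S.x2 τ - (S.y1 τ / S.x2 τ) ^ 2 - 1 + (lam / √2) ^ 2 / 2))
    (fun t ht => by
      have h1 := (hT' t ht).1.ne'
      have h2 := (h.radius_pos t).ne'
      refine (((h.hasDerivAt_x2 t).log h1).sub
        (((h.hasDerivAt_radius t).log h2).const_mul _)).congr_deriv ?_
      field_simp
      ring) fun t ht => by
        have h1 := (hT' t ht).1
        have h2 := h.radius_pos t
        have h3 := h.density_pos t
        exact mul_nonpos_of_nonneg_of_nonpos (by positivity) (by linarith [(hT' t ht).2])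
  have hlim : Tendsto (fun τ => 1 / 2 * Real.log (S.x2 τ ^ 2 / S.radius τ ^ 2)
      + (lam / √2) ^ 2 / 2 * Real.log (S.radius τ)) atTop atTop :=
    ((hB'.log hL2.ne').const_mul (1 / 2)).add_atTop
      ((Real.tendsto_log_atTop.comp hr).const_mul_atTop (half_pos hμ))
  obtain ⟨t, ht1, ht2⟩ := ((hlim.eventually_gt_atTop
    (Real.log (S.x2 T') - (1 - (lam / √2) ^ 2 / 2) * Real.log (S.radius T'))).and
    (eventually_ge_atTop T')).exists
  have h1 := hanti (Set.mem_Ici.2 le_rfl) (Set.mem_Ici.2 ht2) ht2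
  have h2 := (h.radius_pos t).ne'
  have h3 := (hT' t ht2).1.ne'
  rw [Real.log_div (pow_ne_zero 2 h3) (pow_ne_zero 2 h2), Real.log_pow, Real.log_pow] at ht1
  push_cast at ht1
  simp only at h1
  linarith

theorem AsymptoticallyAdS.rev (h : S.AsymptoticallyAdS atBot) : S.rev.AsymptoticallyAdS atTop := by
  obtain ⟨h1, ⟨L, hL, h2⟩, h3⟩ := h
  refine ⟨h1.comp tendsto_neg_atTop_atBot, ⟨L, hL, ?_⟩, ?_⟩
  · refine (h2.comp tendsto_neg_atTop_atBot).congr fun τ => ?_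
    rw [metricB_rev]; rfl
  · refine (h3.comp tendsto_neg_atTop_atBot).congr fun τ => ?_
    have := hat_rev (S := S) S.radius τ
    rw [accel_rev, show S.rev.radius = fun t => S.radius (-t) from rfl, this]
    simp only [Function.comp_apply]
    rw [neg_div, div_neg, mul_neg, neg_div, neg_neg]

end Config

/-! ### Solutions and their orbits -/

namespace Config

variable {S : Config} {V0 lam : ℝ} {γ : ℝ → Pt}

theorem Realizes.surf_eq_zero (h : S.Realizes 0 lam γ) (τ : ℝ) : surf (γ τ) = 0 := by
  have := h.potential τ
  simp only [expPotential, zero_mul] at this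
  linarith

theorem Realizes.surf_neg (h : S.Realizes V0 lam γ) (hV : 0 < V0) (τ : ℝ) : surf (γ τ) < 0 := by
  have h1 := h.potential τ
  have h2 := h.1.radius_pos τ
  have h3 : 0 < 1 - normSq (γ τ) := by linarith [h.isFinite τ]
  have h4 : 0 < expPotential V0 lam (S.scalar τ) := mul_pos hV (Real.exp_pos _)
  have h5 := mul_pos (mul_pos h4 (pow_pos h2 2)) h3
  linarith

theorem Realizes.isOrbit (h : S.Realizes V0 lam γ) (hV : 0 ≤ V0) : IsOrbit lam γ := by
  refine ⟨h.isFlowLine, fun τ => ⟨?_, (h.isFinite τ).le⟩⟩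
  rcases hV.eq_or_lt with rfl | hV
  · exact (h.surf_eq_zero τ).le
  · exact (h.surf_neg hV τ).le

theorem Realizes.isSchwarzschild (h : S.Realizes V0 lam γ) (hγ : IsOrbit lam γ)
    (hl : (Tendsto γ atBot (𝓝 PH) ∧ Tendsto γ atTop (𝓝 PM)) ∨
      (Tendsto γ atBot (𝓝 PMbar) ∧ Tendsto γ atTop (𝓝 PHbar))) : V0 = 0 ∧ S.IsSchwarzschild := by
  rcases hl with ⟨h1, h2⟩ | ⟨h1, h2⟩
  · exact h.traces.isSchwarzschild hγ h1 h2
  · have h3 := tendsto_neg_of_atTop h2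
    have h4 := tendsto_neg_of_atBot h1
    rw [neg_PHbar] at h3
    rw [neg_PMbar] at h4
    have := h.rev.traces.isSchwarzschild hγ.neg h3 h4
    exact ⟨this.1, this.2.of_rev⟩

/-- A solution on `M` has a naked singularity unless it is the Schwarzschild solution. -/
theorem Realizes.schwarzschild_or_naked_of_surfM (h : S.Realizes V0 lam γ) (hγ : IsOrbit lam γ)
    (hs : ∀ τ, γ τ ∈ surfM) (hne : ∀ τ, γ τ ≠ PM) :
    S.IsSchwarzschild ∨ S.NakedSingularity atBot := by
  obtain ⟨h1, p, hp, h2⟩ := surfM_limits hγ.1 h.isFinite hs hne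
  by_cases h0 : p = PH
  · exact Or.inl (h.isSchwarzschild hγ (Or.inl ⟨h0 ▸ h2, h1⟩)).2
  · exact Or.inr (h.traces.nakedSingularity_of_critCurve hγ.1 h.isFinite h2 hp h0)

theorem Realizes.schwarzschild_or_naked (h : S.Realizes V0 lam γ) (hlam : lam ≠ 0) (hV : 0 ≤ V0)
    (hne : ∀ τ, γ τ ≠ PM ∧ γ τ ≠ PMbar) :
    S.IsSchwarzschild ∨ S.NakedSingularity atBot ∨ S.NakedSingularity atTop := by
  have hγ := h.isOrbit hV
  have hf := h.isFinite
  rcases hV.eq_or_lt with rfl | hV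
  · rcases mem_surfM_or_mem_surfMbar hγ.1 (fun τ => (hγ.2 τ).2) h.surf_eq_zero with hM | hM
    · exact (h.schwarzschild_or_naked_of_surfM hγ hM fun τ => (hne τ).1).imp id Or.inl
    · have := h.rev.schwarzschild_or_naked_of_surfM hγ.neg
        (fun τ => (mem_surfMbar_iff_neg _).1 (hM _))
        fun τ h0 => (hne (-τ)).2 (neg_eq_PM_iff.1 h0)
      exact this.imp IsSchwarzschild.of_rev fun h => Or.inr h.of_rev
  · have hs := h.surf_neg hV
    obtain ⟨p, hp, hp'⟩ := limit_atBot_of_neg hγ.1 hf hs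
    obtain ⟨q, hq, hq'⟩ := limit_atTop_of_neg hγ.1 hf hs
    have h1 := h.traces.naked_atBot hγ.1 hf hp hp'
    have h2 := naked_atTop h.rev.traces hγ.1 hf hq hq'
    have h3 := not_both_regular hγ.1 hs hlam hp hq
    tauto

end Config

theorem surfMbar_limits {lam : ℝ} {γ : ℝ → Pt} (h : IsFlowLine lam γ) (hf : IsFinite γ)
    (hs : ∀ τ, γ τ ∈ surfMbar) (hne : ∀ τ, γ τ ≠ PMbar) :
    Tendsto γ atBot (𝓝 PMbar) ∧ ∃ p ∈ critCurveBar, Tendsto γ atTop (𝓝 p) := by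
  obtain ⟨h1, p, hp, h2⟩ := surfM_limits h.neg hf.neg
    (fun τ => (mem_surfMbar_iff_neg _).1 (hs _)) fun τ h0 => hne (-τ) (neg_eq_PM_iff.1 h0)
  have h3 := tendsto_neg_of_atTop h1
  have h4 := tendsto_neg_of_atBot h2
  simp only [neg_neg] at h3 h4
  rw [neg_PM] at h3
  exact ⟨h3, -p, by rwa [mem_critCurveBar_iff_neg, neg_neg], h4⟩

end ExpPotential
end

open ExpPotential
theorem mainTheorem4 (lam : ℝ) :
    -- solutions with `V₀ ≥ 0` trace finite orbits, on `I = 0` exactly when `V₀ = 0`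
    (∀ (V0 : ℝ) (S : Config) (γ : ℝ → Pt), 0 ≤ V0 → S.Realizes V0 lam γ →
      IsOrbit lam γ ∧ IsFinite γ ∧ (V0 = 0 → ∀ τ, surf (γ τ) = 0) ∧
        (0 < V0 → ∀ τ, surf (γ τ) < 0)) ∧
    -- conversely, each finite orbit is traced by a solution
    (∀ γ : ℝ → Pt, IsOrbit lam γ → IsFinite γ →
      ((∀ τ, surf (γ τ) = 0) → ∃ S : Config, S.Realizes 0 lam γ) ∧
      ((∀ τ, surf (γ τ) < 0) → ∀ V0 > 0, ∃ S : Config, S.Realizes V0 lam γ)) ∧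
    -- invariance of the surface `I = 0` and of its two parts `M` and `M̄`
    {p : Pt | surf p = 0 ∧ normSq p ≤ 1} = surfM ∪ surfMbar ∧ Disjoint surfM surfMbar ∧
    (∀ (J : Set ℝ) (γ : ℝ → Pt), J.OrdConnected →
      (∀ τ ∈ J, HasDerivWithinAt γ (field lam (γ τ)) J τ) → ∀ τ₀ ∈ J,
        (surf (γ τ₀) = 0 → ∀ τ ∈ J, surf (γ τ) = 0) ∧
        (γ τ₀ ∈ surfM → ∀ τ ∈ J, γ τ ∈ surfM) ∧
        (γ τ₀ ∈ surfMbar → ∀ τ ∈ J, γ τ ∈ surfMbar)) ∧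
    -- the dynamics on `M̄` is the reverse of the one on `M`
    (∀ γ : ℝ → Pt, IsOrbit lam γ → IsOrbit lam (fun τ => -γ (-τ))) ∧
    (∀ p : Pt, p ∈ surfM ↔ -p ∈ surfMbar) ∧
    -- the orbits on `M`
    (∀ γ : ℝ → Pt, IsOrbit lam γ → (∀ τ, γ τ ∈ surfM) →
      ∃ θ : ℝ → ℝ,
        (∀ τ, θ τ ∈ Set.Icc (Real.arccos (2 / √5)) (Real.pi / 2) ∧
          (γ τ).1 = Real.cos (θ τ) ∧ (γ τ).2.1 = Real.sin (θ τ) - Real.cos (θ τ) ∧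
          HasDerivAt θ (-((Real.cos (θ τ) - Real.sin (θ τ)) / 2) *
            (1 + 2 * (γ τ).2.2 ^ 2 + Real.cos (2 * θ τ) - 2 * Real.sin (2 * θ τ))) τ ∧
          HasDerivAt (fun t => (γ t).2.2) ((γ τ).2.2 *
            ((Real.cos (θ τ) + Real.sin (θ τ)) / 2) *
            (1 + 2 * (γ τ).2.2 ^ 2 + Real.cos (2 * θ τ) - 2 * Real.sin (2 * θ τ))) τ) ∧
        ((∃ c₁ : ℝ, ∀ τ, (γ τ).2.2 = c₁ * (Real.cos (θ τ) - Real.sin (θ τ))) ∨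
          ∀ τ, θ τ = Real.pi / 4)) ∧
    -- there is a unique orbit from the horizon to Minkowski, and it is Schwarzschild
    (∃ γ : ℝ → Pt, (IsOrbit lam γ ∧ Tendsto γ atBot (𝓝 PH) ∧ Tendsto γ atTop (𝓝 PM)) ∧
      (∀ τ, γ τ ∈ surfM) ∧ IsFinite γ ∧
      (∀ δ : ℝ → Pt, IsOrbit lam δ → Tendsto δ atBot (𝓝 PH) → Tendsto δ atTop (𝓝 PM) →
        ∃ c : ℝ, ∀ τ, δ τ = γ (τ + c))) ∧
    (∀ γ : ℝ → Pt, IsOrbit lam γ →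
      (Tendsto γ atBot (𝓝 PH) ∧ Tendsto γ atTop (𝓝 PM)) ∨
        (Tendsto γ atBot (𝓝 PMbar) ∧ Tendsto γ atTop (𝓝 PHbar)) →
      ∀ (V0 : ℝ) (S : Config), 0 ≤ V0 → S.Realizes V0 lam γ → V0 = 0 ∧ S.IsSchwarzschild) ∧
    -- the other orbits on `M` and on `M̄` are naked singularities
    (∀ γ : ℝ → Pt, IsOrbit lam γ → IsFinite γ → (∀ τ, γ τ ∈ surfM) → (∀ τ, γ τ ≠ PM) →
      Tendsto γ atTop (𝓝 PM) ∧ ∃ p ∈ critCurve, Tendsto γ atBot (𝓝 p) ∧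
        (p ≠ PH → ∀ (V0 : ℝ) (S : Config), 0 ≤ V0 → S.Realizes V0 lam γ →
          S.NakedSingularity atBot)) ∧
    (∀ γ : ℝ → Pt, IsOrbit lam γ → IsFinite γ → (∀ τ, γ τ ∈ surfMbar) → (∀ τ, γ τ ≠ PMbar) →
      Tendsto γ atBot (𝓝 PMbar) ∧ ∃ p ∈ critCurveBar, Tendsto γ atTop (𝓝 p) ∧
        (p ≠ PHbar → ∀ (V0 : ℝ) (S : Config), 0 ≤ V0 → S.Realizes V0 lam γ →
          S.NakedSingularity atTop)) ∧
    (lam ≠ 0 →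
      -- the orbits outside `M` and `M̄`
      (∀ γ : ℝ → Pt, IsOrbit lam γ → IsFinite γ → (∀ τ, surf (γ τ) < 0) →
        ∃ p q : Pt, Tendsto γ atBot (𝓝 p) ∧ Tendsto γ atTop (𝓝 q) ∧
          (p = PM ∨ p ∈ critCurve ∨ (6 < lam ^ 2 ∧ p = Plam lam)) ∧
          (q = PMbar ∨ q ∈ critCurveBar ∨ (6 < lam ^ 2 ∧ q = PlamBar lam)) ∧
          -- the passage through the maximum radius
          ((∃ τ₀, (γ τ₀).1 = 0 ∧ (∀ τ < τ₀, 0 < (γ τ).1) ∧ (∀ τ > τ₀, (γ τ).1 < 0) ∧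
              ∀ (V0 : ℝ) (S : Config), 0 < V0 → S.Realizes V0 lam γ →
                (∀ τ, τ ≠ τ₀ → S.radius τ < S.radius τ₀) ∧
                S.x2 τ₀ = 0 ∧ S.normDeriv S.x2 τ₀ = -S.y1 τ₀ ^ 2 ∧ ¬ S.FlareOut τ₀) ∨
            ((∀ τ, 0 < (γ τ).1) ∧ q = PHbar ∧
              ∀ (V0 : ℝ) (S : Config), 0 < V0 → S.Realizes V0 lam γ →
                StrictMono S.radius ∧ (∃ rH > 0, Tendsto S.radius atTop (𝓝 rH)) ∧
                Tendsto S.lapse atTop (𝓝 0)) ∨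
            ((∀ τ, (γ τ).1 < 0) ∧ p = PH ∧
              ∀ (V0 : ℝ) (S : Config), 0 < V0 → S.Realizes V0 lam γ →
                StrictAnti S.radius ∧ (∃ rH > 0, Tendsto S.radius atBot (𝓝 rH)) ∧
                Tendsto S.lapse atBot (𝓝 0))) ∧
          -- at least one end is singular, and each end other than Minkowski or horizon is
          ¬ ((p = PM ∨ p = PH) ∧ (q = PMbar ∨ q = PHbar)) ∧
          ∀ (V0 : ℝ) (S : Config), 0 < V0 → S.Realizes V0 lam γ →
            (p = PM ∨ p = PH ∨ S.NakedSingularity atBot) ∧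
            (q = PMbar ∨ q = PHbar ∨ S.NakedSingularity atTop)) ∧
      -- hence no other non-stationary solution is free of naked singularities
      (∀ (V0 : ℝ) (S : Config) (γ : ℝ → Pt), 0 ≤ V0 → S.Realizes V0 lam γ →
        (∀ τ, γ τ ≠ PM ∧ γ τ ≠ PMbar) →
        S.IsSchwarzschild ∨ S.NakedSingularity atBot ∨ S.NakedSingularity atTop) ∧
      -- no asymptotically anti-de Sitter solution, whatever the sign of the potential
      field lam PAdS ≠ 0 ∧ field lam PAdSbar ≠ 0 ∧
      (∀ γ : ℝ → Pt, IsFlowLine lam γ → (∀ τ, normSq (γ τ) ≤ 1) →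
        ¬ Tendsto γ atTop (𝓝 PAdS) ∧ ¬ Tendsto γ atBot (𝓝 PAdS) ∧
        ¬ Tendsto γ atTop (𝓝 PAdSbar) ∧ ¬ Tendsto γ atBot (𝓝 PAdSbar)) ∧
      (∀ (V0 : ℝ) (S : Config), S.IsSolution (expPotential V0 lam) →
        ¬ S.AsymptoticallyAdS atTop ∧ ¬ S.AsymptoticallyAdS atBot)) := by
  refine ⟨fun V0 S γ hV h => ⟨h.isOrbit hV, h.isFinite, fun h0 => ?_, fun h0 => h.surf_neg h0⟩,
    fun γ h hf => ⟨fun hs => ?_, fun hs V0 hV => ?_⟩, surf_zero_ball_eq, disjoint_surfM_surfMbar,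
    fun J γ hJ hγ τ₀ h0 => ⟨fun hs τ hτ => surf_eq_zero_on hJ hγ h0 hτ hs,
      fun hs τ hτ => mem_surfM_on hJ hγ h0 hτ hs, fun hs τ hτ => mem_surfMbar_on hJ hγ h0 hτ hs⟩,
    fun γ h => h.neg, mem_surfM_iff_neg, fun γ h hs => ?_, ?_, fun γ h hl V0 S _ hR =>
      hR.isSchwarzschild h hl, fun γ h hf hs hne => ?_, fun γ h hf hs hne => ?_, fun hlam =>
      ⟨fun γ h hf hs => ?_, fun V0 S γ hV h hne => h.schwarzschild_or_naked hlam hV hne,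
        fun h0 => field_PAdS_trd_ne_zero hlam (by rw [h0]; rfl),
        fun h0 => field_PAdS_trd_ne_zero hlam (by rw [← field_neg, neg_PAdS, h0]; rfl),
        fun γ h _ => ?_, fun V0 S h => ⟨h.not_asymptoticallyAdS_atTop hlam, fun hA =>
          h.rev.not_asymptoticallyAdS_atTop hlam hA.rev⟩⟩⟩
  · subst h0
    exact h.surf_eq_zero
  · obtain ⟨S, hS⟩ := Config.exists_traces h.1 hf (V0 := 0) (Or.inl ⟨rfl, hs⟩)
    exact ⟨S, hS.realizes h.1 hf⟩
  · obtain ⟨S, hS⟩ := Config.exists_traces h.1 hf (V0 := V0) (Or.inr ⟨hV, hs⟩)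
    exact ⟨S, hS.realizes h.1 hf⟩
  · refine ⟨angle γ, fun τ => ⟨angle_mem (hs τ), (cos_sin_angle (hs τ)).1.symm, ?_,
      surfM_angle_equations h.1 hs τ⟩, surfM_first_integral h.1 hs⟩
    rw [(cos_sin_angle (hs τ)).1, (cos_sin_angle (hs τ)).2]; ring
  · obtain ⟨γ, h1, hf, hM, -, hb, hy⟩ := exists_schwarzschild_orbit lam
    have h : IsOrbit lam γ := ⟨h1, fun τ => ⟨((mem_surfM_iff _).1 (hM τ)).1.le, (hf τ).le⟩⟩
    have hl := schwarzschild_limits h1 hf hM hb hy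
    exact ⟨γ, ⟨h, hl⟩, hM, hf, fun δ hδ h3 h4 => schwarzschild_orbit_unique h hl.1 hl.2 hδ h3 h4⟩
  · obtain ⟨h1, p, hp, h2⟩ := surfM_limits h.1 hf hs hne
    exact ⟨h1, p, hp, h2, fun h0 V0 S _ hR =>
      hR.traces.nakedSingularity_of_critCurve h.1 hf h2 hp h0⟩
  · obtain ⟨h1, p, hp, h2⟩ := surfMbar_limits h.1 hf hs hne
    exact ⟨h1, p, hp, h2, fun h0 V0 S _ hR =>
      (hR.rev.traces.nakedSingularity_of_critCurve h.neg.1 hf.neg (tendsto_neg_of_atTop h2)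
        ((mem_critCurveBar_iff_neg p).1 hp) fun hc => h0 (neg_eq_PH_iff.1 hc)).of_rev⟩
  · obtain ⟨p, hp, hp'⟩ := limit_atBot_of_neg h.1 hf hs
    obtain ⟨q, hq, hq'⟩ := limit_atTop_of_neg h.1 hf hs
    refine ⟨p, q, hp, hq, hp', hq', ?_, not_both_regular h.1 hs hlam hp hq, fun V0 S _ hR =>
      ⟨hR.traces.naked_atBot h.1 hf hp hp', Config.naked_atTop hR.rev.traces h.1 hf hq hq'⟩⟩
    rcases fst_trichotomy h.1 hs hlam with ⟨τ₀, h0, h1, h2⟩ | h1 | h1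
    · exact Or.inl ⟨τ₀, h0, h1, h2, fun V0 S _ hR => hR.traces.maximum_radius h.1 hf h0 h1 h2⟩
    · have hqH := limit_of_fst_pos h1 hq hq'
      exact Or.inr (Or.inl ⟨h1, hqH, fun V0 S _ hR => hR.traces.horizon_atTop h.1 h1 (hqH ▸ hq)⟩)
    · have hpH : p = PH := by
        rw [← neg_neg p, neg_eq_PH_iff]
        -- Reversal turns X₂ < 0 into X₂ > 0 and exchanges the two ends.
        refine limit_of_fst_pos (lam := lam) (γ := fun τ => -γ (-τ))
          (fun τ => by simpa using h1 (-τ)) (tendsto_neg_of_atBot hp) ?_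
        rwa [← neg_eq_PM_iff, ← neg_eq_iff_Plam, mem_critCurveBar_iff_neg, neg_neg]
      exact Or.inr (Or.inr ⟨h1, hpH, fun V0 S _ hR =>
        Config.Traces.horizon_atBot hR.rev.traces h.1 h1 (hpH ▸ hp)⟩)
  · have h1 := not_tendsto_PAdS h hlam
    have h2 := not_tendsto_PAdS h.neg hlam
    refine ⟨h1.1, fun hl => h2.2 ?_, h1.2, fun hl => h2.1 ?_⟩
    · rw [← neg_PAdS]; exact tendsto_neg_of_atBot hl
    · have := tendsto_neg_of_atBot hl
      rwa [← neg_PAdS, neg_neg] at this
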